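/- All systems are finite-dimensional and nonzero; $\log=\log_2$; $\mathbb N=\{1,2,\dots\}$; $\|\cdot\|_\diamond$ is the diamond norm, and for channels (completely positive trace-preserving maps) $\mathcal N'\approx_\varepsilon\mathcal N$ means $\frac12\|\mathcal N'-\mathcal N\|_\diamond\le\varepsilon$. A bipartite channel $\mathcal N_{AB}:A_0B_0\to A_1B_1$ is separable, $\mathcal N_{AB}\in\mathrm{SEPC}(A{:}B)$, if it has a Kraus representation by product operators $X_k\otimes Y_k$, $X_k:A_0\to A_1$, $Y_k:B_0\to B_1$. Put $$R(\mathcal N_{AB})=\min\Big\{s\ge0:\tfrac{\mathcal N_{AB}+s\mathcal M_{AB}}{1+s}\in\mathrm{SEPC}(A{:}B)\text{ for some channel }\mathcal M_{AB}\Big\},$$ $$LR(\mathcal N_{AB})=\log(1+R(\mathcal N_{AB})),\qquad LR^{\varepsilon}(\mathcal N_{AB})=\min_{\mathcal N'_{AB}\approx_\varepsilon\mathcal N_{AB}}LR(\mathcal N'_{AB}),$$ the minimum being over channels. A superchannel is a linear map from linear maps to linear maps that is completely CP-preserving and TP-preserving; it is a $\delta$-SEPPSC if $R(\Theta[\mathcal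 M])\le\delta$ for every separable channel $\mathcal M$. Let $\mathcal F^K$ be the $K$-swap channel, that is, conjugation by $\sum_{i,j=0}^{K-1}|ij\rangle\langle ji|$. The one-shot catalytic dynamic entanglement cost under $\delta$-SEPPSC is $$\widetilde E^{(1),\varepsilon}_{C}(\mathcal N_{AB})=\min\big\{\log K^2:\ \Theta[\mathcal F^K_{A'B'}\otimes\mathcal F^{M}_{CD}]=\mathcal N'_{AB}\otimes\mathcal F^{M}_{CD}\big\},$$ the minimum being over $K,M\in\mathbb N$, channels $\mathcal N'_{AB}\approx_\varepsilon\mathcal N_{AB}$ and $\delta$-SEPPSCs $\Theta$ from $A'C{:}B'D$ to $AC{:}BD$. **Theorem.** Fix systems $A_0,A_1,B_0,B_1$. For every $\delta>0$ and $\varepsilon\ge0$ there is $L\in\mathbb N$ with $L^2\ge1+\frac1\delta$ such that for every channel $\mathcal N_{AB}:A_0B_0\to A_1B_1$ the minimum defining $\widetilde E^{(1),\varepsilon}_{C}(\mathcal N_{AB})$ is attained and $$LR^{\varepsilon}(\mathcal N_{AB}\otimes\mathcal F^L_{CD})-\log L^2-\log(1+\delta)\ \le\ \widetilde E^{(1),\varepsilon}_{C}(\mathcal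 N_{AB}),$$ and, with $\varepsilon'=\varepsilon^2/(2|A_0|^2|B_0|^2)$ and provided that $2\varepsilon'<1$ (so that the logarithm below is defined), $$\widetilde E^{(1),\varepsilon}_{C}(\mathcal N_{AB})\ \le\ LR^{\varepsilon'}(\mathcal N_{AB}\otimes\mathcal F^L_{CD})-\log L^2-\log(1-2\varepsilon')+2.$$ Here $\mathcal N_{AB}\otimes\mathcal F^L_{CD}$ is taken with respect to the cut $AC{:}BD$. -/

import Mathlib

open Matrix
open scoped Kronecker ENNReal ComplexOrder

noncomputable section

/-- Linear maps `𝓑(ℂ^x) → 𝓑(ℂ^y)`; a finite type stands for a system with that orthonormal basis. -/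
abbrev LMap (x y : Type*) := Matrix x x ℂ →ₗ[ℂ] Matrix y y ℂ

section Tensor

variable {x₀ x₁ z₀ z₁ : Type*} [Fintype x₀] [DecidableEq x₀] [Fintype z₀] [DecidableEq z₀]

/-- The tensor product `N ⊗ F` of two linear maps, expanded in matrix units. It is the linear map
with `(N ⊗ F)(X ⊗ Y) = N X ⊗ F Y`, see `LMap.tensor_kronecker`. -/
def LMap.tensor (N : LMap x₀ x₁) (F : LMap z₀ z₁) : LMap (x₀ × z₀) (x₁ × z₁) where
  toFun Z := ∑ i, ∑ j, ∑ k, ∑ l,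
    Z (i, k) (j, l) • (N (Matrix.single i j 1) ⊗ₖ F (Matrix.single k l 1))
  map_add' Z W := by simp only [Matrix.add_apply, add_smul, Finset.sum_add_distrib]
  map_smul' c Z := by
    simp only [Matrix.smul_apply, smul_eq_mul, mul_smul, Finset.smul_sum, RingHom.id_apply]

theorem LMap.eq_sum_single (N : LMap x₀ x₁) (X : Matrix x₀ x₀ ℂ) :
    N X = ∑ i, ∑ j, X i j • N (Matrix.single i j 1) := by
  conv_lhs => rw [Matrix.matrix_eq_sum_single X]
  simp only [map_sum, ← map_smul, Matrix.smul_single, smul_eq_mul, mul_one]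

theorem LMap.tensor_kronecker (N : LMap x₀ x₁) (F : LMap z₀ z₁)
    (X : Matrix x₀ x₀ ℂ) (Y : Matrix z₀ z₀ ℂ) : LMap.tensor N F (X ⊗ₖ Y) = N X ⊗ₖ F Y := by
  rw [LMap.eq_sum_single N X, LMap.eq_sum_single F Y]
  ext ⟨a, c⟩ ⟨b, d⟩
  simp only [LMap.tensor, LinearMap.coe_mk, AddHom.coe_mk, Matrix.sum_apply, Matrix.smul_apply,
    Matrix.kroneckerMap_apply, smul_eq_mul, Finset.sum_mul, Finset.mul_sum]
  have hswap : ∀ f : x₀ → x₀ → z₀ → z₀ → ℂ,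
      ∑ i, ∑ j, ∑ k, ∑ l, f i j k l = ∑ k, ∑ l, ∑ i, ∑ j, f i j k l := by
    intro f
    calc ∑ i, ∑ j, ∑ k, ∑ l, f i j k l = ∑ i, ∑ k, ∑ j, ∑ l, f i j k l :=
          Finset.sum_congr rfl fun i _ => Finset.sum_comm
      _ = ∑ k, ∑ i, ∑ j, ∑ l, f i j k l := Finset.sum_comm
      _ = ∑ k, ∑ i, ∑ l, ∑ j, f i j k l :=
          Finset.sum_congr rfl fun k _ => Finset.sum_congr rfl fun i _ => Finset.sum_comm
      _ = ∑ k, ∑ l, ∑ i, ∑ j, f i j k l := Finset.sum_congr rfl fun k _ => Finset.sum_comm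
  rw [hswap]
  refine Finset.sum_congr rfl fun k _ => Finset.sum_congr rfl fun l _ =>
    Finset.sum_congr rfl fun i _ => Finset.sum_congr rfl fun j _ => ?_
  ring

end Tensor

section Channels

variable {x₀ x₁ : Type*} [Fintype x₀] [DecidableEq x₀] [Fintype x₁]

/-- Complete positivity: `id_r ⊗ N` preserves positive semidefiniteness for every `r`. -/
def IsCP (N : LMap x₀ x₁) : Prop :=
  ∀ (r : ℕ) (Z : Matrix (Fin r × x₀) (Fin r × x₀) ℂ), Z.PosSemidef →
    (LMap.tensor (LinearMap.id : LMap (Fin r) (Fin r)) N Z).PosSemidef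

/-- Trace preservation. -/
def IsTP (N : LMap x₀ x₁) : Prop :=
  ∀ X : Matrix x₀ x₀ ℂ, (N X).trace = X.trace

/-- Quantum channels: completely positive trace-preserving maps. -/
def IsChannel (N : LMap x₀ x₁) : Prop := IsCP N ∧ IsTP N

/-- The trace norm: the sum of the singular values. -/
def traceNorm {y : Type*} [Fintype y] [DecidableEq y] (X : Matrix y y ℂ) : ℝ :=
  ∑ i, √((Matrix.isHermitian_conjTranspose_mul_self X).eigenvalues i)

/-- The diamond norm `sup_r sup_{‖Z‖₁ ≤ 1} ‖(id_r ⊗ N) Z‖₁`. -/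
def diamondNorm [DecidableEq x₁] (N : LMap x₀ x₁) : ℝ≥0∞ :=
  ⨆ (r : ℕ) (Z : Matrix (Fin r × x₀) (Fin r × x₀) ℂ) (_ : traceNorm Z ≤ 1),
    ENNReal.ofReal (traceNorm (LMap.tensor (LinearMap.id : LMap (Fin r) (Fin r)) N Z))

/-- `N' ≈_ε N`, that is, `½ ‖N' - N‖_⋄ ≤ ε`. -/
def DiamondClose [DecidableEq x₁] (ε : ℝ) (N' N : LMap x₀ x₁) : Prop :=
  diamondNorm (N' - N) / 2 ≤ ENNReal.ofReal ε

end Channels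

section Superchannels

/-- Linear supermaps `𝕃(X → Y)`. -/
abbrev Supermap (x₀ x₁ y₀ y₁ : Type*) := LMap x₀ x₁ →ₗ[ℂ] LMap y₀ y₁

/-- The map `X ↦ X i j • |k⟩⟨l|`. These maps form a basis of `𝓛(R₀ → R₁)`. -/
def unitMap {r₀ r₁ : Type*} [DecidableEq r₁] (i j : r₀) (k l : r₁) : LMap r₀ r₁ where
  toFun X := X i j • Matrix.single k l 1
  map_add' X Y := by simp only [Matrix.add_apply, add_smul]
  map_smul' c X := by simp only [Matrix.smul_apply, smul_eq_mul, mul_smul, RingHom.id_apply]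

/-- The coefficient of `Ψ : R₀X₀ → R₁X₁` at `unitMap i j k l`: the linear map
`X ↦ (⟨k| ⊗ I) Ψ(|i⟩⟨j| ⊗ X) (|l⟩ ⊗ I)`. -/
def LMap.coeff {r₀ r₁ x₀ x₁ : Type*} [DecidableEq r₀]
    (Ψ : LMap (r₀ × x₀) (r₁ × x₁)) (i j : r₀) (k l : r₁) : LMap x₀ x₁ where
  toFun X := Matrix.of fun a b => Ψ (Matrix.single i j 1 ⊗ₖ X) (k, a) (l, b)
  map_add' X Y := by
    ext a b
    simp only [Matrix.kronecker_add, map_add, Matrix.of_apply, Matrix.add_apply]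
  map_smul' c X := by
    ext a b
    simp only [Matrix.kronecker_smul, map_smul, Matrix.of_apply, Matrix.smul_apply,
      RingHom.id_apply]

variable {r₀ r₁ x₀ x₁ y₀ y₁ : Type*} [Fintype r₀] [DecidableEq r₀] [Fintype r₁] [DecidableEq r₁]
  [Fintype x₀] [DecidableEq x₀] [Fintype y₀] [DecidableEq y₀]

/-- The action of `𝟙_R ⊗ Θ` on a map `Ψ : R₀X₀ → R₁X₁`. It satisfies
`(𝟙_R ⊗ Θ)[G ⊗ N] = G ⊗ Θ[N]`, see `Supermap.extend_tensor`. -/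
def Supermap.extend (Θ : Supermap x₀ x₁ y₀ y₁) (Ψ : LMap (r₀ × x₀) (r₁ × x₁)) :
    LMap (r₀ × y₀) (r₁ × y₁) :=
  ∑ i, ∑ j, ∑ k, ∑ l, LMap.tensor (unitMap i j k l) (Θ (Ψ.coeff i j k l))

theorem LMap.eq_sum_unitMap (G : LMap r₀ r₁) :
    G = ∑ i, ∑ j, ∑ k, ∑ l, G (Matrix.single i j 1) k l • unitMap i j k l := by
  apply LinearMap.ext
  intro X
  rw [LMap.eq_sum_single G X]
  simp only [LinearMap.sum_apply, LinearMap.smul_apply, unitMap, LinearMap.coe_mk, AddHom.coe_mk]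
  refine Finset.sum_congr rfl fun i _ => Finset.sum_congr rfl fun j _ => ?_
  conv_lhs => rw [Matrix.matrix_eq_sum_single (G (Matrix.single i j 1))]
  simp only [Finset.smul_sum, Matrix.smul_single, smul_eq_mul, mul_one, mul_comm]

theorem Supermap.extend_tensor (Θ : Supermap x₀ x₁ y₀ y₁) (G : LMap r₀ r₁) (N : LMap x₀ x₁) :
    Θ.extend (LMap.tensor G N) = LMap.tensor G (Θ N) := by
  have hc : ∀ i j k l, (LMap.tensor G N).coeff i j k l = (G (Matrix.single i j 1) k l) • N := by
    intro i j k l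
    ext1 X
    ext a b
    simp [LMap.coeff, LMap.tensor_kronecker]
  let T : LMap r₀ r₁ →ₗ[ℂ] LMap (r₀ × y₀) (r₁ × y₁) :=
    { toFun := fun H => LMap.tensor H (Θ N)
      map_add' := fun H K => by
        apply LinearMap.ext
        intro Z
        simp only [LMap.tensor, LinearMap.coe_mk, AddHom.coe_mk, LinearMap.add_apply,
          Matrix.add_kronecker, smul_add, Finset.sum_add_distrib]
      map_smul' := fun c H => by
        apply LinearMap.ext
        intro Z
        simp only [LMap.tensor, LinearMap.coe_mk, AddHom.coe_mk, LinearMap.smul_apply,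
          Matrix.smul_kronecker, Finset.smul_sum, RingHom.id_apply]
        simp only [smul_comm c] }
  have hs : ∀ (c : ℂ) (H : LMap r₀ r₁), LMap.tensor H (c • Θ N) = c • T H := by
    intro c H
    apply LinearMap.ext
    intro Z
    simp only [T, LMap.tensor, LinearMap.coe_mk, AddHom.coe_mk, LinearMap.smul_apply,
      Matrix.kronecker_smul, Finset.smul_sum]
    simp only [smul_comm c]
  change _ = T G
  conv_rhs => rw [LMap.eq_sum_unitMap G]
  simp only [Supermap.extend, hc, map_smul, hs, map_sum]

/-- A superchannel: a linear supermap that is completely CP-preserving (also when it acts on a part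
of a map with an arbitrary reference system) and TP-preserving. -/
def IsSuperchannel [Fintype x₁] [Fintype y₁] (Θ : Supermap x₀ x₁ y₀ y₁) : Prop :=
  (∀ (m n : ℕ) (Ψ : LMap (Fin m × x₀) (Fin n × x₁)), IsCP Ψ → IsCP (Θ.extend Ψ)) ∧
  (∀ N : LMap x₀ x₁, IsTP N → IsTP (Θ N))

end Superchannels

section Bipartite

variable {a₀ a₁ b₀ b₁ c₀ c₁ d₀ d₁ : Type*}
  [Fintype a₀] [DecidableEq a₀] [Fintype a₁] [DecidableEq a₁]
  [Fintype b₀] [DecidableEq b₀] [Fintype b₁] [DecidableEq b₁]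
  [Fintype c₀] [DecidableEq c₀] [Fintype d₀] [DecidableEq d₀]

/-- `N_AB ⊗ F_CD`, seen as a bipartite map with respect to the cut `AC : BD`. -/
def bipTensor (N : LMap (a₀ × b₀) (a₁ × b₁)) (F : LMap (c₀ × d₀) (c₁ × d₁)) :
    LMap ((a₀ × c₀) × (b₀ × d₀)) ((a₁ × c₁) × (b₁ × d₁)) :=
  (Matrix.reindexLinearEquiv ℂ ℂ (Equiv.prodProdProdComm a₁ b₁ c₁ d₁)
      (Equiv.prodProdProdComm a₁ b₁ c₁ d₁)).toLinearMap ∘ₗ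
    LMap.tensor N F ∘ₗ
    (Matrix.reindexLinearEquiv ℂ ℂ (Equiv.prodProdProdComm a₀ c₀ b₀ d₀)
      (Equiv.prodProdProdComm a₀ c₀ b₀ d₀)).toLinearMap

/-- Separable channels `SEPC(A:B)`: channels with a Kraus representation by product operators. -/
def IsSepChannel (N : LMap (a₀ × b₀) (a₁ × b₁)) : Prop :=
  IsChannel N ∧
  ∃ (n : ℕ) (A : Fin n → Matrix a₁ a₀ ℂ) (B : Fin n → Matrix b₁ b₀ ℂ),
    ∀ X, N X = ∑ k, (A k ⊗ₖ B k) * X * (A k ⊗ₖ B k)ᴴ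

/-- The generalized robustness with respect to separable channels. -/
def robustness (N : LMap (a₀ × b₀) (a₁ × b₁)) : ℝ :=
  sInf {s : ℝ | 0 ≤ s ∧ ∃ M : LMap (a₀ × b₀) (a₁ × b₁), IsChannel M ∧
    IsSepChannel (((1 + s : ℝ) : ℂ)⁻¹ • (N + (s : ℂ) • M))}

/-- The generalized log-robustness `LR(N) = log₂ (1 + R(N))`. -/
def logRobustness (N : LMap (a₀ × b₀) (a₁ × b₁)) : ℝ :=
  Real.logb 2 (1 + robustness N)

/-- The smooth generalized log-robustness `LR^ε`. -/
def smoothLogRobustness (ε : ℝ) (N : LMap (a₀ × b₀) (a₁ × b₁)) : ℝ :=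
  sInf {l : ℝ | ∃ N' : LMap (a₀ × b₀) (a₁ × b₁), IsChannel N' ∧ DiamondClose ε N' N ∧
    l = logRobustness N'}

/-- The swap gate `∑_{i,j} |ij⟩⟨ji|` on two `K`-dimensional systems. -/
def swapGate (K : ℕ) : Matrix (Fin K × Fin K) (Fin K × Fin K) ℂ :=
  ∑ i, ∑ j, Matrix.single (i, j) (j, i) 1

/-- The `K`-swap channel. -/
def swapChannel (K : ℕ) : LMap (Fin K × Fin K) (Fin K × Fin K) where
  toFun X := swapGate K * X * (swapGate K)ᴴ
  map_add' X Y := by rw [Matrix.mul_add, Matrix.add_mul]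
  map_smul' c X := by simp only [Matrix.mul_smul, Matrix.smul_mul, RingHom.id_apply]

/-- `δ`-separability-preserving superchannels. -/
def IsDeltaSEPPSC {a₀' a₁' b₀' b₁' : Type*}
    [Fintype a₀'] [DecidableEq a₀'] [Fintype a₁'] [Fintype b₀'] [DecidableEq b₀'] [Fintype b₁']
    (δ : ℝ) (Θ : Supermap (a₀' × b₀') (a₁' × b₁') (a₀ × b₀) (a₁ × b₁)) : Prop :=
  IsSuperchannel Θ ∧
  ∀ M : LMap (a₀' × b₀') (a₁' × b₁'), IsSepChannel M → robustness (Θ M) ≤ δ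

/-- The values `log₂ K²` attained by catalytic simulations of `N` up to error `ε`: a swap channel
`F^K` and a catalyst `F^L` are sent by a `δ`-SEPPSC to `N' ⊗ F^L` with `N' ≈_ε N`. -/
def catalyticCostSet (δ ε : ℝ) (N : LMap (a₀ × b₀) (a₁ × b₁)) : Set ℝ :=
  {e : ℝ | ∃ K L : ℕ, 0 < K ∧ 0 < L ∧
    ∃ Θ : Supermap ((Fin K × Fin L) × (Fin K × Fin L)) ((Fin K × Fin L) × (Fin K × Fin L))
        ((a₀ × Fin L) × (b₀ × Fin L)) ((a₁ × Fin L) × (b₁ × Fin L)),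
      IsDeltaSEPPSC δ Θ ∧
      ∃ N' : LMap (a₀ × b₀) (a₁ × b₁), IsChannel N' ∧ DiamondClose ε N' N ∧
        Θ (bipTensor (swapChannel K) (swapChannel L)) = bipTensor N' (swapChannel L) ∧
        e = Real.logb 2 ((K : ℝ) ^ 2)}

/-- The one-shot catalytic dynamic entanglement cost under `δ`-SEPPSC. -/
def catalyticCost (δ ε : ℝ) (N : LMap (a₀ × b₀) (a₁ × b₁)) : ℝ :=
  sInf (catalyticCostSet δ ε N)

end Bipartite

end

set_option linter.unusedSectionVars false

noncomputable section

/-! ### Positive semidefinite matrices: block sums, block traces and Gram matrices -/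

section PosSemidefBlocks

variable {p q u v : Type*} [Fintype u]

/-! Robustness is handled through domination: `SepDom μ N` says N ≤ μT in the completely positive
order for some separable channel T, and for a channel the infimum of such μ is 1 + R(N)
(`robustness_le`, `sepDom_of_robustness_lt`). Both bounds then become inequalities between Choi
matrices.

The heart is `SepDom.transfer`: once L² ≥ |A₀A₁| + |B₀B₁|, a catalyst of any dimension M can be
exchanged for one of dimension L. Let T be separable with S ≤ μT, where S lives on AB with catalysts
of dimension M. The blocks of the product Kraus operators of T give, for each Kraus index, vectors
α(i,a) and β(j,b) on the catalyst. Contracting T with the swap vector on CD, and its input marginal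
averaged over the catalyst, depend only on the pairings of the α with the β and on the Gram matrices
within each family. There are at most |A₀A₁| + |B₀B₁| vectors per Kraus index, so they can be
realised in ℂ^L ⊗ ℂ^L (`sepDom_of_gram`). Applying Weyl operators to α, their conjugates to β, and
summing restores trace preservation and correlates the two sides along the swap (`sepDom_of_twirl`).
Since n∑vv* ≥ (∑v)(∑v)*, the resulting separable channel dominates N ⊗ F^L.

Lower bound (`smoothLogRobustness_le_of_mem`): the dephased swap is separable and, times (KM)²,
dominates F^K ⊗ F^M. A δ-SEPPSC Θ sends it to a channel of robustness at most δ, so N' ⊗ F^M has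
domination constants arbitrarily close to (KM)²(1+δ); transfer turns this into (KL)²(1+δ) for the
fixed L.

Upper bound (`catalyticCost_le`): a channel S near N ⊗ F^L is contracted with the swap vector to a
trace-nonincreasing map near N and completed to a channel N' by a map below a small multiple of the
depolarizing channel (`exists_sepDom_bipTensor_swap`). By transfer, N' ⊗ F^L ≤ K²L²T with T
separable and a suitable integer K. The superchannel that tests its argument against the swap of
dimension KL, and prepares N' ⊗ F^L or (K²L²T − N' ⊗ F^L)/(K²L² − 1), is then a δ-SEPPSC
(`exists_isDeltaSEPPSC`), because a separable channel passes the test with probability at most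
1/(KL)².

Only suprema, infima and slack parameters are used, no compactness; the cost is attained because its
values are log K² with K a positive integer. -/

theorem Matrix.PosSemidef.weighted_sum_block [Fintype p] [DecidableEq p]
    {M : Matrix (p × u) (p × u) ℂ} (hM : M.PosSemidef) (c : u → ℂ) :
    (Matrix.of fun i j => ∑ x, ∑ y, c x * M (i, x) (j, y) * star (c y) :
      Matrix p p ℂ).PosSemidef := by
  let B : Matrix p (p × u) ℂ := Matrix.of fun i k => if i = k.1 then c k.2 else 0
  convert hM.mul_mul_conjTranspose_same B using 1
  ext i j
  simp only [of_apply, mul_apply, B, conjTranspose_apply, Fintype.sum_prod_type, ite_mul, zero_mul,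
    Finset.sum_ite_irrel, Finset.sum_const_zero, Finset.sum_ite_eq, Finset.mem_univ, if_true,
    apply_ite star, star_zero, mul_ite, mul_zero, Finset.sum_mul]
  exact Finset.sum_comm

theorem Matrix.PosSemidef.sum_block [Fintype p] [DecidableEq p]
    {M : Matrix (p × u) (p × u) ℂ} (hM : M.PosSemidef) :
    (Matrix.of fun i j => ∑ x, ∑ y, M (i, x) (j, y) : Matrix p p ℂ).PosSemidef := by
  simpa using hM.weighted_sum_block (fun _ => 1)

theorem Matrix.PosSemidef.trace_block
    {M : Matrix (p × u) (p × u) ℂ} (hM : M.PosSemidef) :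
    (Matrix.of fun i j => ∑ x, M (i, x) (j, x) : Matrix p p ℂ).PosSemidef := by
  convert Matrix.posSemidef_sum Finset.univ
    (fun x _ => hM.submatrix (fun i : p => (i, x))) using 1
  ext i j
  simp [Matrix.sum_apply]

/-- The difference equals ½ ∑ over pairs s, t of the compression of M by e_s − e_t, each term being
positive semidefinite. In operator terms: the projector on the uniform vector is at most the
identity. -/
theorem Matrix.PosSemidef.card_smul_trace_block_sub_sum_block [Fintype p] [DecidableEq p]
    [DecidableEq u] {M : Matrix (p × u) (p × u) ℂ} (hM : M.PosSemidef) :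
    (Matrix.of fun i j => (Fintype.card u : ℂ) * ∑ x, M (i, x) (j, x)
      - ∑ x, ∑ y, M (i, x) (j, y) : Matrix p p ℂ).PosSemidef := by
  have h := (Matrix.posSemidef_sum Finset.univ (fun s _ => Matrix.posSemidef_sum Finset.univ
    (fun t _ => hM.weighted_sum_block
      (fun x : u => (if x = s then 1 else 0) - (if x = t then 1 else 0))))).smul
    (show (0 : ℂ) ≤ 1 / 2 by norm_num [Complex.le_def])
  convert h using 1
  ext i j
  have e : ∀ s t : u, (∑ x, ∑ y, ((if x = s then (1 : ℂ) else 0) - (if x = t then 1 else 0)) *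
      M (i, x) (j, y) * star ((if y = s then (1 : ℂ) else 0) - (if y = t then 1 else 0)))
      = M (i, s) (j, s) - M (i, s) (j, t) - M (i, t) (j, s) + M (i, t) (j, t) := by
    intro s t
    simp only [star_sub, apply_ite star, star_one, star_zero, mul_sub, sub_mul, ite_mul, one_mul,
      zero_mul, mul_ite, mul_one, mul_zero, Finset.sum_sub_distrib, Finset.sum_ite_eq',
      Finset.mem_univ, if_true]
    ring
  simp only [smul_apply, sum_apply, of_apply, e, Finset.sum_add_distrib, Finset.sum_sub_distrib,
    smul_eq_mul, Finset.sum_const, Finset.card_univ, nsmul_eq_mul, ← Finset.mul_sum]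
  rw [Finset.sum_comm (f := fun x y => M (i, y) (j, x))]
  ring

theorem Matrix.PosSemidef.exists_gram {ι : Type*} [Fintype ι] [DecidableEq ι]
    {M : Matrix ι ι ℂ} (hM : M.PosSemidef) :
    ∃ w : ι → ι → ℂ, ∀ i j, M i j = ∑ k, w k i * star (w k j) := by
  open scoped MatrixOrder in
  obtain ⟨B, hB⟩ := CStarAlgebra.nonneg_iff_eq_star_mul_self.mp hM.nonneg
  refine ⟨fun k i => star (B k i), fun i j => ?_⟩
  rw [hB]
  simp [mul_apply, star_apply]

theorem Matrix.posSemidef_of_gram {ι κ : Type*} [Fintype ι] [Fintype κ] (w : κ → ι → ℂ) :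
    (Matrix.of fun i j => ∑ k, w k i * star (w k j) : Matrix ι ι ℂ).PosSemidef := by
  convert Matrix.posSemidef_sum Finset.univ
    (fun k _ => posSemidef_vecMulVec_self_star (w k)) using 1
  ext i j
  simp [Matrix.sum_apply, vecMulVec_apply]

/-- `n ∑ v v* ≥ (∑ v) (∑ v)*`. -/
theorem Matrix.posSemidef_card_smul_gram_sub {ι κ : Type*} [Fintype κ] [DecidableEq κ]
    [Fintype ι] [DecidableEq ι] (w : κ → ι → ℂ) :
    (Matrix.of fun i j => (Fintype.card κ : ℂ) * ∑ k, w k i * star (w k j)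
      - (∑ k, w k i) * star (∑ k, w k j) : Matrix ι ι ℂ).PosSemidef := by
  have h := (posSemidef_vecMulVec_self_star
    (fun x : ι × κ => w x.2 x.1)).card_smul_trace_block_sub_sum_block
  convert h using 1
  ext i j
  simp [vecMulVec_apply, Finset.sum_mul_sum]

end PosSemidefBlocks

/-! ### Choi matrices, complete positivity and trace preservation -/

section Choi

variable {x y : Type*} [DecidableEq x]

/-- The (unnormalised) Choi matrix of a linear map. -/
def choi (N : LMap x y) : Matrix (x × y) (x × y) ℂ :=
  Matrix.of fun p q => N (Matrix.single p.1 q.1 1) p.2 q.2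

theorem choi_apply (N : LMap x y) (p q : x × y) :
    choi N p q = N (Matrix.single p.1 q.1 1) p.2 q.2 := rfl

@[simp] theorem choi_add (N M : LMap x y) : choi (N + M) = choi N + choi M := rfl
@[simp] theorem choi_sub (N M : LMap x y) : choi (N - M) = choi N - choi M := rfl
@[simp] theorem choi_smul (c : ℂ) (N : LMap x y) : choi (c • N) = c • choi N := rfl

variable [Fintype x]

theorem apply_eq_sum_choi (N : LMap x y) (X : Matrix x x ℂ) (a b : y) :
    N X a b = ∑ i, ∑ j, X i j * choi N (i, a) (j, b) := by
  rw [LMap.eq_sum_single N X]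
  simp [Matrix.sum_apply, choi_apply]

theorem choi_injective : Function.Injective (choi : LMap x y → _) := by
  intro N M h
  ext1 X
  ext a b
  rw [apply_eq_sum_choi, apply_eq_sum_choi, h]

/-- The linear map with a given Choi matrix. -/
def ofChoi (J : Matrix (x × y) (x × y) ℂ) : LMap x y where
  toFun X := Matrix.of fun a b => ∑ i, ∑ j, X i j * J (i, a) (j, b)
  map_add' X Y := by
    ext a b
    simp [add_mul, Finset.sum_add_distrib]
  map_smul' c X := by
    ext a b
    simp [mul_assoc, Finset.mul_sum]

theorem ofChoi_apply (J : Matrix (x × y) (x × y) ℂ) (X : Matrix x x ℂ) (a b : y) :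
    ofChoi J X a b = ∑ i, ∑ j, X i j * J (i, a) (j, b) := rfl

@[simp] theorem choi_ofChoi (J : Matrix (x × y) (x × y) ℂ) : choi (ofChoi J) = J := by
  ext p q
  simp [choi_apply, ofChoi_apply, Matrix.single_apply, ite_and]

theorem isTP_iff [Fintype y] {N : LMap x y} :
    IsTP N ↔ ∀ i j, ∑ a, choi N (i, a) (j, a) = if i = j then 1 else 0 := by
  constructor
  · intro h i j
    have := h (Matrix.single i j 1)
    rw [Matrix.trace] at this
    simp only [choi_apply]
    simp only [diag_apply] at this
    rw [this]
    split_ifs with hij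
    · subst hij; simp
    · simp [Matrix.trace_single_eq_of_ne _ _ _ hij]
  · intro h X
    simp only [Matrix.trace, diag_apply, apply_eq_sum_choi]
    rw [Finset.sum_comm]
    refine Finset.sum_congr rfl fun i _ => ?_
    rw [Finset.sum_comm]
    simp [← Finset.mul_sum, h]

theorem tensor_id_apply {r : Type*} [Fintype r] [DecidableEq r] (N : LMap x y)
    (Z : Matrix (r × x) (r × x) ℂ) (s t : r × y) :
    LMap.tensor (LinearMap.id : LMap r r) N Z s t =
      ∑ i, ∑ j, Z (s.1, i) (t.1, j) * choi N (i, s.2) (j, t.2) := by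
  simp [LMap.tensor, Matrix.sum_apply, choi_apply, Matrix.single_apply, ite_and,
    Finset.sum_ite_irrel]

/-- Choi's theorem. One direction tests N on the unnormalised maximally entangled vector; in the
other, (id ⊗ N)(Z) is a block sum of Z ⊗ choi N. -/
theorem isCP_iff [Fintype y] [DecidableEq y] {N : LMap x y} : IsCP N ↔ (choi N).PosSemidef := by
  constructor
  · intro h
    let e := Fintype.equivFin x
    have hZ := posSemidef_vecMulVec_self_star
      (fun z : Fin (Fintype.card x) × x => if z.1 = e z.2 then (1 : ℂ) else 0)
    have := (h _ _ hZ).submatrix (fun z : x × y => (e z.1, z.2))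
    convert this using 1
    ext p q
    simp [tensor_id_apply, vecMulVec_apply, apply_ite star]
  · intro h r Z hZ
    have h1 := ((hZ.kronecker h).submatrix
      (fun z : (Fin r × y) × x => ((z.1.1, z.2), (z.2, z.1.2)))).sum_block
    convert h1 using 1
    ext s t
    simp [tensor_id_apply]

theorem choi_tensor {z w : Type*} [Fintype z] [DecidableEq z] (N : LMap x y) (F : LMap z w)
    (s t : (x × z) × (y × w)) :
    choi (LMap.tensor N F) s t =
      choi N (s.1.1, s.2.1) (t.1.1, t.2.1) * choi F (s.1.2, s.2.2) (t.1.2, t.2.2) := by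
  have : (Matrix.single s.1 t.1 1 : Matrix (x × z) (x × z) ℂ) =
      Matrix.single s.1.1 t.1.1 1 ⊗ₖ Matrix.single s.1.2 t.1.2 1 := by
    rw [Matrix.single_kronecker_single]; simp
  rw [choi_apply, this, LMap.tensor_kronecker]
  rfl

end Choi

/-! ### Separable channels, domination and robustness -/

section Separable

variable {a₀ a₁ b₀ b₁ : Type*}
  [Fintype a₀] [DecidableEq a₀] [Fintype a₁] [DecidableEq a₁]
  [Fintype b₀] [DecidableEq b₀] [Fintype b₁] [DecidableEq b₁]

/-- The vectorisation of the product operator `A ⊗ B`. -/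
def prodVec (A : Matrix a₁ a₀ ℂ) (B : Matrix b₁ b₀ ℂ) (p : (a₀ × b₀) × (a₁ × b₁)) : ℂ :=
  A p.2.1 p.1.1 * B p.2.2 p.1.2

theorem isSepChannel_of_choi {κ : Type*} [Fintype κ] {N : LMap (a₀ × b₀) (a₁ × b₁)}
    (hN : IsTP N) (A : κ → Matrix a₁ a₀ ℂ) (B : κ → Matrix b₁ b₀ ℂ)
    (h : ∀ p q, choi N p q = ∑ k, prodVec (A k) (B k) p * star (prodVec (A k) (B k) q)) :
    IsSepChannel N := by
  refine ⟨⟨?_, hN⟩, ?_⟩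
  · rw [isCP_iff]
    convert posSemidef_of_gram (fun k => prodVec (A k) (B k)) using 1
    ext p q
    exact h p q
  · let e := (Fintype.equivFin κ).symm
    refine ⟨Fintype.card κ, A ∘ e, B ∘ e, fun X => ?_⟩
    ext p q
    rw [apply_eq_sum_choi, Matrix.sum_apply]
    have : ∀ k, ((A k ⊗ₖ B k) * X * (A k ⊗ₖ B k)ᴴ) p q = ∑ i, ∑ j, X i j *
        (prodVec (A k) (B k) (i, p) * star (prodVec (A k) (B k) (j, q))) := by
      intro k
      simp only [mul_apply, conjTranspose_apply, kroneckerMap_apply, prodVec, Finset.sum_mul]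
      rw [Finset.sum_comm]
      refine Finset.sum_congr rfl fun i _ => Finset.sum_congr rfl fun j _ => by ring
    simp only [Function.comp, this]
    rw [e.sum_comp (fun k => ∑ i, ∑ j, X i j *
        (prodVec (A k) (B k) (i, p) * star (prodVec (A k) (B k) (j, q))))]
    simp only [h, Finset.mul_sum]
    rw [Finset.sum_comm]
    rw [Finset.sum_congr rfl fun j _ => Finset.sum_comm, Finset.sum_comm]
    rw [Finset.sum_congr rfl fun k _ => Finset.sum_comm]

theorem IsSepChannel.exists_kraus {N : LMap (a₀ × b₀) (a₁ × b₁)} (hN : IsSepChannel N) :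
    ∃ (n : ℕ) (A : Fin n → Matrix a₁ a₀ ℂ) (B : Fin n → Matrix b₁ b₀ ℂ),
      ∀ p q, choi N p q = ∑ k, prodVec (A k) (B k) p * star (prodVec (A k) (B k) q) := by
  obtain ⟨-, n, A, B, h⟩ := hN
  refine ⟨n, A, B, fun p q => ?_⟩
  rw [choi_apply, h, Matrix.sum_apply]
  refine Finset.sum_congr rfl fun k _ => ?_
  simp only [mul_apply, conjTranspose_apply, Matrix.single_apply, prodVec, ite_and,
    kroneckerMap_apply]
  simp

theorem IsTP.convexComb {x y : Type*} [Fintype x] [Fintype y] {N M : LMap x y}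
    (hN : IsTP N) (hM : IsTP M) {s t : ℂ} (h : s + t = 1) : IsTP (s • N + t • M) := by
  intro X
  rw [LinearMap.add_apply, LinearMap.smul_apply, LinearMap.smul_apply, trace_add, trace_smul,
    trace_smul, hN X, hM X, ← add_smul, h, one_smul]

theorem IsSepChannel.convexComb {N M : LMap (a₀ × b₀) (a₁ × b₁)} (hN : IsSepChannel N)
    (hM : IsSepChannel M) {s t : ℝ} (hs : 0 ≤ s) (ht : 0 ≤ t) (h : s + t = 1) :
    IsSepChannel ((s : ℂ) • N + (t : ℂ) • M) := by
  obtain ⟨n, A, B, hAB⟩ := hN.exists_kraus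
  obtain ⟨m, A', B', hAB'⟩ := hM.exists_kraus
  refine isSepChannel_of_choi (hN.1.2.convexComb hM.1.2 (by exact_mod_cast h))
    (κ := Fin n ⊕ Fin m) (Sum.elim (fun k => ((√s : ℝ) : ℂ) • A k) (fun k => ((√t : ℝ) : ℂ) • A' k))
    (Sum.elim B B') fun p q => ?_
  have hs' : (s : ℂ) = (√s : ℝ) * (√s : ℝ) := by
    rw [← Complex.ofReal_mul, Real.mul_self_sqrt hs]
  have ht' : (t : ℂ) = (√t : ℝ) * (√t : ℝ) := by
    rw [← Complex.ofReal_mul, Real.mul_self_sqrt ht]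
  simp only [choi_add, choi_smul, Matrix.add_apply, Matrix.smul_apply, hAB, hAB', smul_eq_mul,
    Fintype.sum_sum_type, Sum.elim_inl, Sum.elim_inr, Finset.mul_sum, prodVec, star_mul',
    Complex.star_def]
  congr 1
  · refine Finset.sum_congr rfl fun k _ => ?_
    rw [hs']
    simp only [map_mul, Complex.conj_ofReal]
    ring
  · refine Finset.sum_congr rfl fun k _ => ?_
    rw [ht']
    simp only [map_mul, Complex.conj_ofReal]
    ring

/-- `N ≤ μ T` in the completely positive order, for some separable channel `T`. -/
def SepDom (μ : ℝ) (N : LMap (a₀ × b₀) (a₁ × b₁)) : Prop :=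
  ∃ T, IsSepChannel T ∧ ((μ : ℂ) • choi T - choi N).PosSemidef

theorem IsSepChannel.posSemidef {T : LMap (a₀ × b₀) (a₁ × b₁)} (hT : IsSepChannel T) :
    (choi T).PosSemidef := isCP_iff.1 hT.1.1

theorem Matrix.PosSemidef.smul_ofReal {ι : Type*} {M : Matrix ι ι ℂ} (hM : M.PosSemidef) {c : ℝ}
    (hc : 0 ≤ c) : ((c : ℂ) • M).PosSemidef :=
  hM.smul (Complex.zero_le_real.2 hc)

theorem SepDom.mono {μ ν : ℝ} {N : LMap (a₀ × b₀) (a₁ × b₁)} (h : SepDom μ N) (hμ : μ ≤ ν) :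
    SepDom ν N := by
  obtain ⟨T, hT, h⟩ := h
  refine ⟨T, hT, ?_⟩
  convert h.add (hT.posSemidef.smul_ofReal (sub_nonneg.2 hμ)) using 1
  push_cast
  module

theorem SepDom.of_le {μ : ℝ} {N M : LMap (a₀ × b₀) (a₁ × b₁)} (h : SepDom μ M)
    (hNM : (choi M - choi N).PosSemidef) : SepDom μ N := by
  obtain ⟨T, hT, h⟩ := h
  refine ⟨T, hT, ?_⟩
  convert h.add hNM using 1
  module

theorem SepDom.smul {μ c : ℝ} {N : LMap (a₀ × b₀) (a₁ × b₁)} (h : SepDom μ N) (hc : 0 ≤ c) :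
    SepDom (c * μ) ((c : ℂ) • N) := by
  obtain ⟨T, hT, h⟩ := h
  refine ⟨T, hT, ?_⟩
  convert h.smul_ofReal hc using 1
  rw [choi_smul]
  push_cast
  module

theorem SepDom.add {μ ν : ℝ} {N M : LMap (a₀ × b₀) (a₁ × b₁)} (hN : SepDom μ N)
    (hM : SepDom ν M) (hμ : 0 < μ) (hν : 0 ≤ ν) : SepDom (μ + ν) (N + M) := by
  obtain ⟨T, hT, h⟩ := hN
  obtain ⟨S, hS, h'⟩ := hM
  have h0 : μ + ν ≠ 0 := by positivity
  refine ⟨_, hT.convexComb hS (s := μ / (μ + ν)) (t := ν / (μ + ν)) (by positivity) (by positivity)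
    (by field_simp), ?_⟩
  convert h.add h' using 1
  have h0' : (μ : ℂ) + ν ≠ 0 := by exact_mod_cast h0
  simp only [choi_add, choi_smul, smul_add, smul_smul]
  push_cast
  rw [mul_div_cancel₀ _ h0', mul_div_cancel₀ _ h0']
  module

theorem robustness_nonneg (N : LMap (a₀ × b₀) (a₁ × b₁)) : 0 ≤ robustness N :=
  Real.sInf_nonneg fun _ h => h.1

/-- The admixed channel is the normalised remainder ((1+r)T − N)/r. Passing to r > s avoids dividing
by zero when s = 0, and costs nothing for an infimum. -/
theorem robustness_le {s : ℝ} {N : LMap (a₀ × b₀) (a₁ × b₁)} (hN : IsTP N) (hs : 0 ≤ s)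
    (h : SepDom (1 + s) N) : robustness N ≤ s := by
  refine le_of_forall_gt_imp_ge_of_dense fun r hr => ?_
  obtain ⟨T, hT, h⟩ := h
  have hr0 : 0 < r := hs.trans_lt hr
  have hrc : (r : ℂ) ≠ 0 := by exact_mod_cast hr0.ne'
  refine csInf_le ⟨0, fun _ h => h.1⟩
    ⟨hr0.le, ((r⁻¹ : ℝ) : ℂ) • (((1 + r : ℝ) : ℂ) • T - N), ⟨?_, ?_⟩, ?_⟩
  · rw [isCP_iff]
    convert (h.add (hT.posSemidef.smul_ofReal (sub_nonneg.2 hr.le))).smul_ofReal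
      (inv_nonneg.2 hr0.le) using 1
    simp only [choi_smul, choi_sub]
    push_cast
    module
  · intro X
    simp only [LinearMap.smul_apply, LinearMap.sub_apply, trace_smul, trace_sub, hN X, hT.1.2 X,
      smul_eq_mul]
    push_cast
    field_simp
    ring
  · convert hT using 1
    have h1 : (1 : ℂ) + r ≠ 0 := by exact_mod_cast (by positivity : (1 : ℝ) + r ≠ 0)
    push_cast
    rw [smul_smul, mul_inv_cancel₀ hrc, one_smul, add_sub_cancel, smul_smul, inv_mul_cancel₀ h1,
      one_smul]

/-- The completely depolarising channel is separable. -/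
theorem isSepChannel_depolarizing [Nonempty a₁] [Nonempty b₁] :
    IsSepChannel (ofChoi ((((Fintype.card a₁ * Fintype.card b₁ : ℝ)⁻¹ : ℝ) : ℂ) • 1) :
      LMap (a₀ × b₀) (a₁ × b₁)) := by
  set c : ℝ := (Fintype.card a₁ * Fintype.card b₁ : ℝ) with hc
  have hc0 : 0 < c := by simp only [hc]; positivity
  have hcc : (c : ℂ) ≠ 0 := by exact_mod_cast hc0.ne'
  refine isSepChannel_of_choi (κ := (a₀ × b₀) × (a₁ × b₁)) ?_
    (fun k => Matrix.single k.2.1 k.1.1 ((√c⁻¹ : ℝ) : ℂ)) (fun k => Matrix.single k.2.2 k.1.2 1) ?_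
  · rw [isTP_iff]
    intro i j
    simp only [choi_ofChoi, Matrix.smul_apply, Matrix.one_apply, Prod.mk.injEq, and_true, smul_eq_mul,
      Finset.sum_const, Finset.card_univ, Fintype.card_prod, nsmul_eq_mul]
    split_ifs
    · push_cast [hc]
      field_simp
    · simp
  · intro p q
    have e : ∀ k p : (a₀ × b₀) × (a₁ × b₁), prodVec (Matrix.single k.2.1 k.1.1 ((√c⁻¹ : ℝ) : ℂ))
        (Matrix.single k.2.2 k.1.2 1) p = if k = p then ((√c⁻¹ : ℝ) : ℂ) else 0 := by
      rintro ⟨⟨_, _⟩, _, _⟩ ⟨⟨_, _⟩, _, _⟩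
      simp only [prodVec, Matrix.single_apply, Prod.mk.injEq]
      split_ifs <;> simp_all
    simp only [e, choi_ofChoi, Matrix.smul_apply, Matrix.one_apply, smul_eq_mul, ite_mul, zero_mul,
      Finset.sum_ite_eq', Finset.mem_univ, if_true, apply_ite star, star_zero, mul_ite, mul_zero,
      mul_one, Complex.star_def, Complex.conj_ofReal]
    simp only [eq_comm (a := q)]
    rw [← Complex.ofReal_mul, Real.mul_self_sqrt (by positivity)]

/-- The Choi matrix is at most its operator norm times the identity, and the identity is a multiple
of the Choi matrix of the depolarizing channel. This makes the infimum in the robustness, and later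
the cost set, nonvacuous. -/
theorem exists_sepDom [Nonempty a₁] [Nonempty b₁] (N : LMap (a₀ × b₀) (a₁ × b₁))
    (hN : IsChannel N) : ∃ μ : ℝ, 0 < μ ∧ SepDom μ N := by
  set c : ℝ := (Fintype.card a₁ * Fintype.card b₁ : ℝ) with hc
  have hc0 : 0 < c := by simp only [hc]; positivity
  have hcc : (c : ℂ) ≠ 0 := by exact_mod_cast hc0.ne'
  obtain ⟨μ, hμ, h⟩ : ∃ μ : ℝ, 0 ≤ μ ∧ ((μ : ℂ) • 1 - choi N).PosSemidef := by
    open scoped MatrixOrder Matrix.Norms.L2Operator in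
    refine ⟨‖choi N‖, norm_nonneg _, ?_⟩
    have := IsSelfAdjoint.le_algebraMap_norm_self (a := choi N) (isCP_iff.1 hN.1).1
    rw [Matrix.le_iff, Algebra.algebraMap_eq_smul_one] at this
    exact this
  refine ⟨c * μ + 1, by positivity, SepDom.mono (μ := c * μ) ⟨_, isSepChannel_depolarizing, ?_⟩ (by linarith)⟩
  convert h using 1
  rw [choi_ofChoi, ← hc, smul_smul]
  push_cast
  congr 2
  field_simp

theorem sepDom_of_robustness_lt [Nonempty a₁] [Nonempty b₁] {s : ℝ} {N : LMap (a₀ × b₀) (a₁ × b₁)}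
    (hN : IsChannel N) (h : robustness N < s) : SepDom (1 + s) N := by
  -- The real `sInf` of the empty set is 0, so nonemptiness is needed before a bound on `robustness`
  -- says anything.
  have hne : {s : ℝ | 0 ≤ s ∧ ∃ M : LMap (a₀ × b₀) (a₁ × b₁), IsChannel M ∧
    IsSepChannel (((1 + s : ℝ) : ℂ)⁻¹ • (N + (s : ℂ) • M))}.Nonempty := by
    obtain ⟨μ, hμ, T, hT, h⟩ := exists_sepDom N hN
    have hm : (μ : ℂ) ≠ 0 := by exact_mod_cast hμ.ne'
    have h1 : (1 : ℂ) + μ ≠ 0 := by exact_mod_cast (by positivity : (1 : ℝ) + μ ≠ 0)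
    refine ⟨μ, hμ.le, ((μ⁻¹ : ℝ) : ℂ) • (((1 + μ : ℝ) : ℂ) • T - N), ⟨?_, ?_⟩, ?_⟩
    · rw [isCP_iff]
      convert (h.add hT.posSemidef).smul_ofReal (inv_nonneg.2 hμ.le) using 1
      simp only [choi_smul, choi_sub]
      push_cast
      module
    · intro X
      simp only [LinearMap.smul_apply, LinearMap.sub_apply, trace_smul, trace_sub, hN.2 X, hT.1.2 X,
        smul_eq_mul]
      push_cast
      field_simp
      ring
    · convert hT using 1
      push_cast
      rw [smul_smul, mul_inv_cancel₀ hm, one_smul, add_sub_cancel, smul_smul, inv_mul_cancel₀ h1,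
        one_smul]
  obtain ⟨r, ⟨hr, M, hM, hS⟩, hrs⟩ := exists_lt_of_csInf_lt hne h
  refine SepDom.mono (μ := 1 + r) ⟨_, hS, ?_⟩ (by linarith)
  have h1 : ((1 + r : ℝ) : ℂ) ≠ 0 := by exact_mod_cast (by positivity : (1 : ℝ) + r ≠ 0)
  convert (isCP_iff.1 hM.1).smul_ofReal hr using 1
  simp only [choi_smul, choi_add]
  rw [smul_smul, mul_inv_cancel₀ h1, one_smul, add_sub_cancel_left]

end Separable

/-! ### The Choi matrix of the swap and of N ⊗ F^L -/

section SwapChannel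

theorem swapGate_apply (K : ℕ) (p q : Fin K × Fin K) :
    swapGate K p q = if p = q.swap then 1 else 0 := by
  obtain ⟨a, b⟩ := p
  obtain ⟨c, d⟩ := q
  simp only [swapGate, Matrix.sum_apply, Matrix.single_apply, Prod.mk.injEq, Prod.swap_prod_mk]
  rw [Finset.sum_eq_single a (by intros; simp_all) (by simp),
    Finset.sum_eq_single b (by intros; simp_all) (by simp)]
  simp [and_comm]

theorem swapChannel_apply (K : ℕ) (X : Matrix (Fin K × Fin K) (Fin K × Fin K) ℂ)
    (p q : Fin K × Fin K) : swapChannel K X p q = X p.swap q.swap := by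
  have h : ∀ p q : Fin K × Fin K, (p = q.swap) ↔ (q = p.swap) := by
    rintro ⟨_, _⟩ ⟨_, _⟩
    simp [eq_comm, and_comm]
  simp only [swapChannel, LinearMap.coe_mk, AddHom.coe_mk, mul_apply, conjTranspose_apply,
    swapGate_apply, h]
  simp [apply_ite star]

theorem choi_swapChannel (K : ℕ) (p q : (Fin K × Fin K) × (Fin K × Fin K)) :
    choi (swapChannel K) p q =
      (if p.1 = p.2.swap then 1 else 0) * (if q.1 = q.2.swap then 1 else 0) := by
  rw [choi_apply, swapChannel_apply, Matrix.single_apply, ite_and]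
  split_ifs <;> simp

variable {a₀ a₁ b₀ b₁ c₀ c₁ d₀ d₁ : Type*}
  [Fintype a₀] [DecidableEq a₀] [Fintype a₁] [DecidableEq a₁]
  [Fintype b₀] [DecidableEq b₀] [Fintype b₁] [DecidableEq b₁]
  [Fintype c₀] [DecidableEq c₀] [Fintype d₀] [DecidableEq d₀]

theorem choi_bipTensor (N : LMap (a₀ × b₀) (a₁ × b₁)) (F : LMap (c₀ × d₀) (c₁ × d₁))
    (p q : ((a₀ × c₀) × (b₀ × d₀)) × ((a₁ × c₁) × (b₁ × d₁))) :
    choi (bipTensor N F) p q =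
      choi N ((p.1.1.1, p.1.2.1), (p.2.1.1, p.2.2.1)) ((q.1.1.1, q.1.2.1), (q.2.1.1, q.2.2.1)) *
      choi F ((p.1.1.2, p.1.2.2), (p.2.1.2, p.2.2.2)) ((q.1.1.2, q.1.2.2), (q.2.1.2, q.2.2.2)) := by
  obtain ⟨⟨⟨_, _⟩, _, _⟩, ⟨_, _⟩, _, _⟩ := p
  obtain ⟨⟨⟨_, _⟩, _, _⟩, ⟨_, _⟩, _, _⟩ := q
  rw [choi_apply]
  simp only [bipTensor, LinearMap.comp_apply, LinearEquiv.coe_coe, Matrix.coe_reindexLinearEquiv,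
    Matrix.reindex_apply, Matrix.submatrix_apply, Matrix.submatrix_single_equiv]
  simpa [choi_apply] using choi_tensor N F ((_, _), (_, _)) ((_, _), (_, _))

/-- The index of the `AB` part of an index of a map `ACBD → ACBD`. -/
def corePart {c : Type*} (p : ((a₀ × c) × (b₀ × c)) × ((a₁ × c) × (b₁ × c))) :
    (a₀ × b₀) × (a₁ × b₁) := ((p.1.1.1, p.1.2.1), (p.2.1.1, p.2.2.1))

/-- The indices of the systems held by the first party on `C₀C₁`. -/
def leftPart {c : Type*} (p : ((a₀ × c) × (b₀ × c)) × ((a₁ × c) × (b₁ × c))) : c × c :=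
  (p.1.1.2, p.2.1.2)

/-- The indices of the systems held by the second party on `D₁D₀`. -/
def rightPart {c : Type*} (p : ((a₀ × c) × (b₀ × c)) × ((a₁ × c) × (b₁ × c))) : c × c :=
  (p.2.2.2, p.1.2.2)

/-- The vectorised swap gate. -/
def swapVec {c : Type*} [DecidableEq c] (p : ((a₀ × c) × (b₀ × c)) × ((a₁ × c) × (b₁ × c))) : ℂ :=
  if leftPart p = rightPart p then 1 else 0

theorem choi_bipTensor_swap (N : LMap (a₀ × b₀) (a₁ × b₁)) (L : ℕ)
    (p q : ((a₀ × Fin L) × (b₀ × Fin L)) × ((a₁ × Fin L) × (b₁ × Fin L))) :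
    choi (bipTensor N (swapChannel L)) p q =
      swapVec p * choi N (corePart p) (corePart q) * star (swapVec q) := by
  have h : ∀ p : ((a₀ × Fin L) × (b₀ × Fin L)) × ((a₁ × Fin L) × (b₁ × Fin L)),
      (((p.1.1.2, p.1.2.2) : Fin L × Fin L) = (p.2.1.2, p.2.2.2).swap) ↔
        leftPart p = rightPart p := by
    intro p
    simp [leftPart, rightPart, eq_comm]
  rw [choi_bipTensor, choi_swapChannel]
  simp only [h]
  simp only [swapVec, corePart, apply_ite star, star_one, star_zero]
  ring

end SwapChannel

theorem Matrix.PosSemidef.diag_conj {ι : Type*} [Fintype ι] [DecidableEq ι] {M : Matrix ι ι ℂ}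
    (hM : M.PosSemidef) (c : ι → ℂ) :
    (Matrix.of fun i j => c i * M i j * star (c j) : Matrix ι ι ℂ).PosSemidef := by
  convert hM.mul_mul_conjTranspose_same (diagonal c) using 1
  ext i j
  simp [diagonal_conjTranspose, mul_diagonal, diagonal_mul]

/-! ### Weyl operators and their orthogonality relations -/

section Weyl

/-- The Weyl operators of a finite abelian group. -/
def weyl {G : Type*} [AddCommGroup G] [DecidableEq G] (t : G × AddChar G ℂ) (i j : G) : ℂ :=
  if i = j + t.1 then t.2 j else 0

variable {G : Type*} [AddCommGroup G] [Fintype G] [DecidableEq G]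

/-- The shift in the first component is determined by i and j, and the sum over characters then
forces j = l: the Weyl operators form an orthogonal unitary basis. -/
theorem sum_weyl_mul_star (i j k l : G) :
    ∑ t : G × AddChar G ℂ, weyl t i j * star (weyl t k l) =
      if i = k ∧ j = l then (Fintype.card G : ℂ) else 0 := by
  have h : ∀ g : G, ∑ ψ : AddChar G ℂ, weyl (g, ψ) i j * star (weyl (g, ψ) k l) =
      if i = j + g ∧ k = l + g then (if j = l then (Fintype.card G : ℂ) else 0) else 0 := by
    intro g
    by_cases h1 : i = j + g <;> by_cases h2 : k = l + g <;> simp [weyl, h1, h2]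
    simp only [← AddChar.map_neg_eq_conj, ← AddChar.map_add_eq_mul, ← sub_eq_add_neg]
    rw [AddChar.sum_apply_eq_ite]
    simp [sub_eq_zero]
  rw [Fintype.sum_prod_type, Finset.sum_congr rfl fun g _ => h g]
  rw [Finset.sum_eq_single (i - j)]
  · by_cases h2 : j = l
    · subst h2
      by_cases h1 : i = k <;> simp [h1, eq_comm]
    · simp [h2]
  · intro g _ hg
    rw [if_neg]
    rintro ⟨rfl, -⟩
    simp at hg
  · simp

theorem sum_weyl_unitary (t : G × AddChar G ℂ) (j l : G) :
    ∑ i, weyl t i j * star (weyl t i l) = if j = l then 1 else 0 := by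
  by_cases h : j = l
  · subst h
    simp only [weyl, ite_mul, zero_mul, Finset.sum_ite_eq', Finset.mem_univ, if_true]
    simp only [Complex.star_def, Complex.mul_conj]
    simp [Complex.normSq_eq_norm_sq]
  · simp [weyl, h]

end Weyl

section Twirl

variable {G : Type*} [AddCommGroup G] [Fintype G] [DecidableEq G]

/-- Tensor products of two Weyl operators. -/
def weyl₂ (s : (G × AddChar G ℂ) × (G × AddChar G ℂ)) (u e : G × G) : ℂ :=
  weyl s.1 u.1 e.1 * weyl s.2 u.2 e.2

theorem sum_weyl₂_mul_star (u e u' e' : G × G) :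
    ∑ s, weyl₂ s u e * star (weyl₂ s u' e') =
      if u = u' ∧ e = e' then (Fintype.card G : ℂ) ^ 2 else 0 := by
  have : ∀ s t, weyl₂ (s, t) u e * star (weyl₂ (s, t) u' e') =
      (weyl s u.1 e.1 * star (weyl s u'.1 e'.1)) * (weyl t u.2 e.2 * star (weyl t u'.2 e'.2)) := by
    intro s t
    simp only [weyl₂, star_mul']
    ring
  rw [Fintype.sum_prod_type]
  simp only [this, ← Finset.mul_sum, ← Finset.sum_mul, sum_weyl_mul_star, Prod.ext_iff]
  split_ifs <;> first | ring1 | (exfalso; tauto)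

/-- Tracing out C₁ removes the second Weyl factor on the first side, and tracing out D₁ removes the
first factor on the other, both by unitarity. What remains are two independent full twirls, one on
C₀ and one on D₀. -/
theorem sum_weyl₂_marginal (c₀ c₀' d₀ d₀' : G) (e e' f f' : G × G) :
    ∑ s, (∑ c₁, weyl₂ s (c₀, c₁) e * star (weyl₂ s (c₀', c₁) e')) *
      (∑ d₁, star (weyl₂ s (d₁, d₀) f) * weyl₂ s (d₁, d₀') f') =
      if (c₀ = c₀' ∧ d₀ = d₀') ∧ e = e' ∧ f = f' then (Fintype.card G : ℂ) ^ 2 else 0 := by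
  have h1 : ∀ s, (∑ c₁, weyl₂ s (c₀, c₁) e * star (weyl₂ s (c₀', c₁) e')) =
      (weyl s.1 c₀ e.1 * star (weyl s.1 c₀' e'.1)) * (if e.2 = e'.2 then 1 else 0) := by
    intro s
    rw [← sum_weyl_unitary s.2, Finset.mul_sum]
    refine Finset.sum_congr rfl fun c _ => ?_
    simp only [weyl₂, star_mul']
    ring
  have h2 : ∀ s, (∑ d₁, star (weyl₂ s (d₁, d₀) f) * weyl₂ s (d₁, d₀') f') =
      (if f'.1 = f.1 then 1 else 0) * (weyl s.2 d₀' f'.2 * star (weyl s.2 d₀ f.2)) := by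
    intro s
    rw [← sum_weyl_unitary s.1, Finset.sum_mul]
    refine Finset.sum_congr rfl fun c _ => ?_
    simp only [weyl₂, star_mul']
    ring
  simp only [h1, h2]
  rw [Fintype.sum_prod_type]
  have h3 : ∀ s t : G × AddChar G ℂ, (weyl s c₀ e.1 * star (weyl s c₀' e'.1)) *
      (if e.2 = e'.2 then 1 else 0) * ((if f'.1 = f.1 then 1 else 0) *
        (weyl t d₀' f'.2 * star (weyl t d₀ f.2))) =
      ((if e.2 = e'.2 then 1 else 0) * (if f'.1 = f.1 then 1 else 0)) *
      ((weyl s c₀ e.1 * star (weyl s c₀' e'.1)) * (weyl t d₀' f'.2 * star (weyl t d₀ f.2))) := by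
    intro s t; ring
  simp only [h3, ← Finset.mul_sum, ← Finset.sum_mul, sum_weyl_mul_star, Prod.ext_iff]
  simp only [eq_comm (a := d₀'), eq_comm (a := f'.1), eq_comm (a := f'.2)]
  split_ifs <;> first | ring1 | (exfalso; tauto)

end Twirl

/-! ### Twirling Kraus vectors into a separable channel on AC : BD -/

section Transfer

variable {a₀ a₁ b₀ b₁ κ : Type*}
  [Fintype a₀] [DecidableEq a₀] [Fintype a₁] [DecidableEq a₁]
  [Fintype b₀] [DecidableEq b₀] [Fintype b₁] [DecidableEq b₁] [Fintype κ]

theorem Finset.sum_comm_four {A B C D S M : Type*} [Fintype A] [Fintype B] [Fintype C] [Fintype D]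
    [Fintype S] [AddCommMonoid M] (f : S → A → B → C → D → M) :
    ∑ s, ∑ a, ∑ b, ∑ c, ∑ d, f s a b c d = ∑ a, ∑ b, ∑ c, ∑ d, ∑ s, f s a b c d := by
  rw [Finset.sum_comm]
  refine Finset.sum_congr rfl fun a _ => ?_
  rw [Finset.sum_comm]
  refine Finset.sum_congr rfl fun b _ => ?_
  rw [Finset.sum_comm]
  refine Finset.sum_congr rfl fun c _ => ?_
  rw [Finset.sum_comm]

/-- The sum of W ⊗ W̄ is L² times |Ω⟩⟨Ω|, Ω being the unnormalised maximally entangled vector; this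
is where the swap vector on the catalyst comes from. -/
theorem twirl_overlap {L : ℕ} [NeZero L] (x y : Fin L × Fin L → ℂ) (u v : Fin L × Fin L) :
    ∑ s, (∑ e, weyl₂ s u e * x e) * (∑ f, star (weyl₂ s v f) * y f) =
      if u = v then (L : ℂ) ^ 2 * ∑ e, x e * y e else 0 := by
  simp only [Finset.sum_mul_sum]
  rw [Finset.sum_comm]
  rw [Finset.sum_congr rfl fun e _ => Finset.sum_comm]
  have : ∀ e f, ∑ s, weyl₂ s u e * x e * (star (weyl₂ s v f) * y f) =
      (if u = v ∧ e = f then (L : ℂ) ^ 2 else 0) * (x e * y f) := by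
    intro e f
    have := sum_weyl₂_mul_star u e v f
    rw [Fintype.card_fin] at this
    rw [← this, Finset.sum_mul]
    exact Finset.sum_congr rfl fun s _ => by ring
  simp only [this]
  by_cases h : u = v
  · simp [h, Finset.mul_sum]
  · simp [h]

theorem twirl_marginal {L : ℕ} [NeZero L] (x x' y y' : Fin L × Fin L → ℂ) (c₀ c₀' d₀ d₀' : Fin L) :
    ∑ s, (∑ c₁, (∑ e, weyl₂ s (c₀, c₁) e * x e) * star (∑ e, weyl₂ s (c₀', c₁) e * x' e)) *
      (∑ d₁, (∑ f, star (weyl₂ s (d₁, d₀) f) * y f) * star (∑ f, star (weyl₂ s (d₁, d₀') f) * y' f)) =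
      if c₀ = c₀' ∧ d₀ = d₀' then (L : ℂ) ^ 2 * ((∑ e, x e * star (x' e)) * (∑ f, y f * star (y' f)))
      else 0 := by
  obtain ⟨P, hP⟩ : ∃ P : (Fin L × AddChar (Fin L) ℂ) × (Fin L × AddChar (Fin L) ℂ) →
      Fin L × Fin L → Fin L × Fin L → ℂ, ∀ s e e',
      P s e e' = ∑ c₁, weyl₂ s (c₀, c₁) e * star (weyl₂ s (c₀', c₁) e') := ⟨_, fun _ _ _ => rfl⟩
  obtain ⟨Q, hQ⟩ : ∃ Q : (Fin L × AddChar (Fin L) ℂ) × (Fin L × AddChar (Fin L) ℂ) →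
      Fin L × Fin L → Fin L × Fin L → ℂ, ∀ s f f',
      Q s f f' = ∑ d₁, star (weyl₂ s (d₁, d₀) f) * weyl₂ s (d₁, d₀') f' := ⟨_, fun _ _ _ => rfl⟩
  have h1 : ∀ s, (∑ c₁, (∑ e, weyl₂ s (c₀, c₁) e * x e) * star (∑ e, weyl₂ s (c₀', c₁) e * x' e)) =
      ∑ e, ∑ e', P s e e' * (x e * star (x' e')) := by
    intro s
    simp only [hP, star_sum, star_mul', Finset.sum_mul, Finset.mul_sum]
    rw [Finset.sum_comm]
    conv_rhs => rw [Finset.sum_comm]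
    refine Finset.sum_congr rfl fun e _ => ?_
    rw [Finset.sum_comm]
    refine Finset.sum_congr rfl fun e' _ => Finset.sum_congr rfl fun c _ => by ring
  have h2 : ∀ s, (∑ d₁, (∑ f, star (weyl₂ s (d₁, d₀) f) * y f) *
        star (∑ f, star (weyl₂ s (d₁, d₀') f) * y' f)) =
      ∑ f, ∑ f', Q s f f' * (y f * star (y' f')) := by
    intro s
    simp only [hQ, star_sum, star_mul', Finset.sum_mul, Finset.mul_sum, star_star]
    rw [Finset.sum_comm]
    conv_rhs => rw [Finset.sum_comm]
    refine Finset.sum_congr rfl fun e _ => ?_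
    rw [Finset.sum_comm]
    refine Finset.sum_congr rfl fun e' _ => Finset.sum_congr rfl fun c _ => by ring
  simp only [h1, h2]
  simp only [Finset.sum_mul]
  simp only [Finset.mul_sum]
  have h4 : ∀ e e' f f' : Fin L × Fin L,
      ∑ s, P s e e' * (x e * star (x' e')) * (Q s f f' * (y f * star (y' f'))) =
      (if (c₀ = c₀' ∧ d₀ = d₀') ∧ e = e' ∧ f = f' then (L : ℂ) ^ 2 else 0) *
      ((x e * star (x' e')) * (y f * star (y' f'))) := by
    intro e e' f f'
    have := sum_weyl₂_marginal c₀ c₀' d₀ d₀' e e' f f'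
    rw [Fintype.card_fin] at this
    rw [← this, Finset.sum_mul]
    exact Finset.sum_congr rfl fun s _ => by rw [hP, hQ]; ring
  rw [Finset.sum_comm_four]
  simp only [h4]
  by_cases h : c₀ = c₀' ∧ d₀ = d₀'
  · simp [h, ite_and]
  · simp [h]

/-- Twirling a separable map on `AC : BD` yields a separable channel that dominates `N ⊗ F^L`. -/
theorem sepDom_of_twirl {L : ℕ} [NeZero L] (α : κ → a₀ × a₁ → Fin L × Fin L → ℂ)
    (β : κ → b₀ × b₁ → Fin L × Fin L → ℂ) {C g : ℝ} (hC : 0 < C) (hg : 0 < g)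
    (hm : ∀ i i' j j', ∑ k, ∑ a, ∑ b, (∑ u, α k (i, a) u * star (α k (i', a) u)) *
      (∑ v, β k (j, b) v * star (β k (j', b) v)) = if i = i' ∧ j = j' then (C : ℂ) else 0)
    (N : LMap (a₀ × b₀) (a₁ × b₁))
    (hN : (Matrix.of (fun p q : (a₀ × b₀) × (a₁ × b₁) => ∑ k, (∑ u, α k (p.1.1, p.2.1) u * β k (p.1.2, p.2.2) u) *
      star (∑ u, α k (q.1.1, q.2.1) u * β k (q.1.2, q.2.2) u)) - (g : ℂ) • choi N).PosSemidef) :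
    SepDom (C * L ^ 2 / g) (bipTensor N (swapChannel L)) := by
  have hL : (0 : ℝ) < L := by exact_mod_cast NeZero.pos L
  -- By `twirl_marginal` the twirl multiplies the input marginal C by L²; r² undoes both.
  set r : ℝ := √(C * L ^ 2)⁻¹ with hr
  have hrr : r * r = (C * L ^ 2)⁻¹ := Real.mul_self_sqrt (by positivity)
  let σ := (Fin L × AddChar (Fin L) ℂ) × (Fin L × AddChar (Fin L) ℂ)
  have hσ : (Fintype.card σ : ℂ) = (L : ℂ) ^ 4 := by
    simp only [σ, Fintype.card_prod, AddChar.card_eq, Fintype.card_fin]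
    push_cast; ring
  -- The two parties apply conjugate operators with a common label s, so each w k s is still a
  -- product vector.
  let x : κ → σ → a₀ × a₁ → Fin L × Fin L → ℂ := fun k s a u => ∑ e, weyl₂ s u e * α k a e
  let y : κ → σ → b₀ × b₁ → Fin L × Fin L → ℂ := fun k s b v => ∑ f, star (weyl₂ s v f) * β k b f
  let w : κ → σ → ((a₀ × Fin L) × (b₀ × Fin L)) × ((a₁ × Fin L) × (b₁ × Fin L)) → ℂ :=
    fun k s p => x k s (p.1.1.1, p.2.1.1) (leftPart p) * y k s (p.1.2.1, p.2.2.1) (rightPart p)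
  let T : LMap ((a₀ × Fin L) × (b₀ × Fin L)) ((a₁ × Fin L) × (b₁ × Fin L)) :=
    ofChoi (Matrix.of fun p q => ((r * r : ℝ) : ℂ) * ∑ k, ∑ s, w k s p * star (w k s q))
  have hT : IsSepChannel T := by
    refine isSepChannel_of_choi (κ := κ × σ) ?_
      (fun k => Matrix.of fun a i => (r : ℂ) * x k.1 k.2 (i.1, a.1) (i.2, a.2))
      (fun k => Matrix.of fun b j => y k.1 k.2 (j.1, b.1) (b.2, j.2)) ?_
    · rw [isTP_iff]
      rintro ⟨⟨i, c₀⟩, j, d₀⟩ ⟨⟨i', c₀'⟩, j', d₀'⟩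
      simp only [T, choi_ofChoi, of_apply, ← Finset.mul_sum]
      have e1 : ∀ k (s : σ) a b c₁ d₁, w k s (((i, c₀), (j, d₀)), ((a, c₁), (b, d₁))) *
          star (w k s (((i', c₀'), (j', d₀')), ((a, c₁), (b, d₁)))) =
          (x k s (i, a) (c₀, c₁) * star (x k s (i', a) (c₀', c₁))) *
          (y k s (j, b) (d₁, d₀) * star (y k s (j', b) (d₁, d₀'))) := by
        intro k s a b c₁ d₁
        simp only [w, leftPart, rightPart, star_mul']
        ring
      have e2 : ∑ o : (a₁ × Fin L) × (b₁ × Fin L), ∑ k, ∑ s : σ, w k s (((i, c₀), (j, d₀)), o) *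
          star (w k s (((i', c₀'), (j', d₀')), o)) =
          ∑ k, ∑ a, ∑ b, ∑ s : σ, (∑ c₁, x k s (i, a) (c₀, c₁) * star (x k s (i', a) (c₀', c₁))) *
            (∑ d₁, y k s (j, b) (d₁, d₀) * star (y k s (j', b) (d₁, d₀'))) := by
        rw [Finset.sum_comm]
        refine Finset.sum_congr rfl fun k _ => ?_
        simp only [Finset.sum_mul_sum, Fintype.sum_prod_type (α₁ := a₁ × Fin L),
          Fintype.sum_prod_type (α₁ := a₁), Fintype.sum_prod_type (α₁ := b₁), e1]
        refine Finset.sum_congr rfl fun a _ => ?_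
        rw [Finset.sum_comm]
        refine Finset.sum_congr rfl fun b _ => ?_
        rw [Finset.sum_congr rfl fun c _ => Finset.sum_comm, Finset.sum_comm]
      rw [e2]
      simp only [x, y, σ, twirl_marginal]
      by_cases h : c₀ = c₀' ∧ d₀ = d₀'
      · have e3 := congrArg (fun z => (L : ℂ) ^ 2 * z) (hm i i' j j')
        simp only [Finset.mul_sum _ _ ((L : ℂ) ^ 2)] at e3
        simp only [h, and_self, if_true, e3, hrr, Prod.mk.injEq, and_true]
        split_ifs
        · push_cast
          have : (C : ℂ) ≠ 0 := by exact_mod_cast hC.ne'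
          have : (L : ℂ) ≠ 0 := by exact_mod_cast hL.ne'
          field_simp
        · simp
      · simp only [h, if_false, Finset.sum_const_zero, mul_zero, Prod.mk.injEq]
        rw [if_neg]
        tauto
    · intro p q
      simp only [T, choi_ofChoi, of_apply, Fintype.sum_prod_type (α₁ := κ), Finset.mul_sum]
      refine Finset.sum_congr rfl fun k _ => Finset.sum_congr rfl fun s _ => ?_
      simp only [prodVec, of_apply, w, leftPart, rightPart, star_mul', Complex.star_def,
        Complex.conj_ofReal]
      push_cast
      ring
  refine ⟨T, hT, ?_⟩
  have hov : ∀ k p, ∑ s : σ, w k s p = (L : ℂ) ^ 2 * (swapVec p *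
      ∑ u, α k ((corePart p).1.1, (corePart p).2.1) u * β k ((corePart p).1.2, (corePart p).2.2) u) := by
    intro k p
    simp only [w, x, y, σ, twirl_overlap, swapVec, corePart]
    split_ifs <;> ring
  -- For each k, L⁴ ∑ₛ ww* ≥ (∑ₛ w)(∑ₛ w)*, as there are L⁴ labels s; by `hov` the right side is L⁴
  -- times a rank-one term supported on the swap vector.
  have h1 := Matrix.posSemidef_sum Finset.univ (fun k (_ : k ∈ Finset.univ) =>
    (Matrix.posSemidef_card_smul_gram_sub (w k)).smul_ofReal
      (inv_nonneg.2 (by positivity : (0 : ℝ) ≤ L ^ 4)))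
  have h2 := (hN.submatrix (corePart (c := Fin L))).diag_conj swapVec
  have h3 := (h1.add h2).smul_ofReal (inv_nonneg.2 hg.le)
  convert h3 using 1
  ext p q
  have hLc : (L : ℂ) ≠ 0 := by exact_mod_cast hL.ne'
  have hgc : (g : ℂ) ≠ 0 := by exact_mod_cast hg.ne'
  have hCc : (C : ℂ) ≠ 0 := by exact_mod_cast hC.ne'
  simp only [Matrix.sub_apply, Matrix.smul_apply, Matrix.add_apply, Matrix.sum_apply, of_apply,
    Matrix.submatrix_apply, choi_bipTensor_swap, T, choi_ofChoi, smul_eq_mul, hov, hσ, hrr]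
  have e4 : ∀ k, (((L ^ 4 : ℝ)⁻¹ : ℝ) : ℂ) * ((L : ℂ) ^ 4 * ∑ s : σ, w k s p * star (w k s q) -
      (L : ℂ) ^ 2 * (swapVec p *
      ∑ u, α k ((corePart p).1.1, (corePart p).2.1) u * β k ((corePart p).1.2, (corePart p).2.2) u)
      * star ((L : ℂ) ^ 2 * (swapVec q *
      ∑ u, α k ((corePart q).1.1, (corePart q).2.1) u * β k ((corePart q).1.2, (corePart q).2.2) u)))
      = ∑ s : σ, w k s p * star (w k s q) - swapVec p * star (swapVec q) *
      ((∑ u, α k ((corePart p).1.1, (corePart p).2.1) u * β k ((corePart p).1.2, (corePart p).2.2) u)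
       * star
      (∑ u, α k ((corePart q).1.1, (corePart q).2.1) u * β k ((corePart q).1.2, (corePart q).2.2) u))
      := by
    intro k
    simp only [star_mul', star_pow, star_natCast]
    push_cast
    field_simp
  simp only [e4, Finset.sum_sub_distrib, ← Finset.mul_sum]
  push_cast
  field_simp
  ring

end Transfer

/-! ### Realising a Gram matrix in a prescribed dimension -/

section Gram

/-- A square-root factorisation of the Gram matrix realises it in dimension |ι|, and an embedding of
ι into W pads with zeros. The original dimension plays no role, which is what frees the bounds from
the size of the catalyst. -/
theorem exists_gram_eq {ι W' W : Type*} [Fintype ι] [DecidableEq ι] [Fintype W'] [Fintype W]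
    [DecidableEq W] (f : ι → W' → ℂ) (h : Fintype.card ι ≤ Fintype.card W) :
    ∃ f' : ι → W → ℂ, ∀ i j, ∑ u, f' i u * star (f' j u) = ∑ w, f i w * star (f j w) := by
  obtain ⟨e⟩ := Function.Embedding.nonempty_of_card_le h
  obtain ⟨w, hw⟩ := (posSemidef_of_gram (fun w i => f i w)).exists_gram
  refine ⟨fun i u => ∑ k, if e k = u then w k i else 0, fun i j => ?_⟩
  have := hw i j
  rw [of_apply] at this
  rw [this]
  simp only [Finset.sum_mul, ite_mul, zero_mul]
  rw [Finset.sum_comm]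
  refine Finset.sum_congr rfl fun k _ => ?_
  rw [Finset.sum_ite_eq, if_pos (Finset.mem_univ _)]
  simp

theorem norm_sum_mul_sq_le {ι : Type*} [Fintype ι] (x y : ι → ℂ) :
    ((∑ u, x u * y u) * star (∑ u, x u * y u)).re ≤
      ((∑ u, x u * star (x u)) * (∑ v, y v * star (y v))).re := by
  have h1 : ∀ z : ℂ, z * star z = ((‖z‖ ^ 2 : ℝ) : ℂ) := fun z => by
    rw [Complex.star_def, Complex.mul_conj, Complex.normSq_eq_norm_sq]
  simp only [h1]
  rw [← Complex.ofReal_sum, ← Complex.ofReal_sum, ← Complex.ofReal_mul, Complex.ofReal_re,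
    Complex.ofReal_re]
  calc ‖∑ u, x u * y u‖ ^ 2 ≤ (∑ u, ‖x u‖ * ‖y u‖) ^ 2 := by
        gcongr
        exact (norm_sum_le _ _).trans (by simp)
    _ ≤ _ := Finset.sum_mul_sq_le_sq_mul_sq _ _ _

end Gram

/-! ### Exchanging catalysts of different dimensions -/

section Transfer

variable {a₀ a₁ b₀ b₁ : Type*}
  [Fintype a₀] [DecidableEq a₀] [Fintype a₁] [DecidableEq a₁]
  [Fintype b₀] [DecidableEq b₀] [Fintype b₁] [DecidableEq b₁]

/-- Replacing the vectors on the catalyst by vectors in `ℂ^L ⊗ ℂ^L` with the same Gram matrix. -/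
theorem sepDom_of_gram {κ W : Type*} [Fintype κ] [Fintype W] {L : ℕ} [NeZero L]
    (hL : Fintype.card (a₀ × a₁) + Fintype.card (b₀ × b₁) ≤ L ^ 2) (α : κ → a₀ × a₁ → W → ℂ)
    (β : κ → b₀ × b₁ → W → ℂ) {C g : ℝ} (hC : 0 < C) (hg : 0 < g)
    (hm : ∀ i i' j j', ∑ k, ∑ a, ∑ b, (∑ u, α k (i, a) u * star (α k (i', a) u)) *
      (∑ v, β k (j, b) v * star (β k (j', b) v)) = if i = i' ∧ j = j' then (C : ℂ) else 0)
    (N : LMap (a₀ × b₀) (a₁ × b₁))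
    (hN : (Matrix.of (fun p q : (a₀ × b₀) × (a₁ × b₁) =>
      ∑ k, (∑ u, α k (p.1.1, p.2.1) u * β k (p.1.2, p.2.2) u) *
      star (∑ u, α k (q.1.1, q.2.1) u * β k (q.1.2, q.2.2) u)) - (g : ℂ) • choi N).PosSemidef) :
    SepDom (C * L ^ 2 / g) (bipTensor N (swapChannel L)) := by
  -- The β are conjugated so that the bilinear pairing ∑ αβ becomes an inner product; one joint Gram
  -- matrix then records it together with both marginals.
  have hex : ∀ k, ∃ f' : (a₀ × a₁) ⊕ (b₀ × b₁) → Fin L × Fin L → ℂ, ∀ i j,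
      ∑ u, f' i u * star (f' j u) =
        ∑ w, Sum.elim (α k) (fun b v => star (β k b v)) i w *
          star (Sum.elim (α k) (fun b v => star (β k b v)) j w) := by
    intro k
    refine exists_gram_eq _ ?_
    rw [Fintype.card_sum, Fintype.card_prod (Fin L), Fintype.card_fin, ← sq]
    exact hL
  choose f hf using hex
  have h1 : ∀ k a a', ∑ u, f k (Sum.inl a) u * star (f k (Sum.inl a') u) =
      ∑ u, α k a u * star (α k a' u) := fun k a a' => hf k (Sum.inl a) (Sum.inl a')
  have h2 : ∀ k b b', ∑ u, star (f k (Sum.inr b) u) * star (star (f k (Sum.inr b') u)) =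
      ∑ u, β k b u * star (β k b' u) := fun k b b' => by
    have := hf k (Sum.inr b') (Sum.inr b)
    simp only [Sum.elim_inr, star_star] at this ⊢
    simpa only [mul_comm] using this
  have h3 : ∀ k a b, ∑ u, f k (Sum.inl a) u * star (f k (Sum.inr b) u) =
      ∑ u, α k a u * β k b u := fun k a b => by
    simpa using hf k (Sum.inl a) (Sum.inr b)
  refine sepDom_of_twirl (fun k a => f k (Sum.inl a)) (fun k b u => star (f k (Sum.inr b) u))
    hC hg ?_ N ?_
  · simpa only [h1, h2] using hm
  · simpa only [h3] using hN

/-- An index of a map `ACBD → ACBD` from an index of the `AB` part and indices on `C₀C₁`, `D₁D₀`. -/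
def glue {c : Type*} (p : (a₀ × b₀) × (a₁ × b₁)) (u v : c × c) :
    ((a₀ × c) × (b₀ × c)) × ((a₁ × c) × (b₁ × c)) :=
  (((p.1.1, u.1), (p.1.2, v.2)), ((p.2.1, u.2), (p.2.2, v.1)))

/-- The contraction of a Choi matrix on `ACBD` with the Choi vector of the swap gate on `CD`. -/
def collapse {c : Type*} [Fintype c]
    (J : Matrix (((a₀ × c) × (b₀ × c)) × ((a₁ × c) × (b₁ × c)))
      (((a₀ × c) × (b₀ × c)) × ((a₁ × c) × (b₁ × c))) ℂ) :
    Matrix ((a₀ × b₀) × (a₁ × b₁)) ((a₀ × b₀) × (a₁ × b₁)) ℂ :=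
  Matrix.of fun p q => ∑ u, ∑ u', J (glue p u u) (glue q u' u')

theorem collapse_posSemidef {c : Type*} [Fintype c]
    {J : Matrix (((a₀ × c) × (b₀ × c)) × ((a₁ × c) × (b₁ × c)))
      (((a₀ × c) × (b₀ × c)) × ((a₁ × c) × (b₁ × c))) ℂ} (hJ : J.PosSemidef) :
    (collapse J).PosSemidef :=
  (hJ.submatrix fun x : ((a₀ × b₀) × (a₁ × b₁)) × (c × c) => glue x.1 x.2 x.2).sum_block

theorem collapse_sub {c : Type*} [Fintype c]
    (J J' : Matrix (((a₀ × c) × (b₀ × c)) × ((a₁ × c) × (b₁ × c)))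
      (((a₀ × c) × (b₀ × c)) × ((a₁ × c) × (b₁ × c))) ℂ) :
    collapse (J - J') = collapse J - collapse J' := by
  ext p q
  simp [collapse, Finset.sum_sub_distrib]

theorem collapse_smul {c : Type*} [Fintype c] (t : ℂ)
    (J : Matrix (((a₀ × c) × (b₀ × c)) × ((a₁ × c) × (b₁ × c)))
      (((a₀ × c) × (b₀ × c)) × ((a₁ × c) × (b₁ × c))) ℂ) :
    collapse (t • J) = t • collapse J := by
  ext p q
  simp [collapse, Finset.mul_sum]

theorem collapse_bipTensor_swap (N : LMap (a₀ × b₀) (a₁ × b₁)) (L : ℕ) :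
    collapse (choi (bipTensor N (swapChannel L))) = ((L : ℂ) ^ 4) • choi N := by
  ext p q
  simp only [collapse, of_apply, choi_bipTensor_swap, swapVec, glue, leftPart, rightPart, corePart]
  simp
  ring

/-- Trace preservation of T, summed over the diagonal of the catalyst inputs C₀D₀; these |c|² values
give the constant. -/
theorem sum_kraus_marginal {c : Type*} [Fintype c] [DecidableEq c]
    {T : LMap ((a₀ × c) × (b₀ × c)) ((a₁ × c) × (b₁ × c))} {n : ℕ}
    (hT : IsTP T) (A : Fin n → Matrix (a₁ × c) (a₀ × c) ℂ) (B : Fin n → Matrix (b₁ × c) (b₀ × c) ℂ)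
    (hAB : ∀ p q, choi T p q = ∑ k, prodVec (A k) (B k) p * star (prodVec (A k) (B k) q))
    (i i' : a₀) (j j' : b₀) :
    ∑ k, ∑ a, ∑ b, (∑ u : c × c, A k (a, u.2) (i, u.1) * star (A k (a, u.2) (i', u.1))) *
      (∑ v : c × c, B k (b, v.1) (j, v.2) * star (B k (b, v.1) (j', v.2))) =
      if i = i' ∧ j = j' then (Fintype.card c : ℂ) ^ 2 else 0 := by
  have h := fun s t => (isTP_iff.1 hT) ((i, s), (j, t)) ((i', s), (j', t))
  simp only [Prod.mk.injEq, and_true] at h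
  have h2 : ∑ s, ∑ t, ∑ o, choi T (((i, s), (j, t)), o) (((i', s), (j', t)), o) =
      if i = i' ∧ j = j' then (Fintype.card c : ℂ) ^ 2 else 0 := by
    simp only [h]
    split_ifs <;> simp [sq]
  rw [← h2]
  simp only [hAB]
  have h3 : ∀ s t, ∑ o : (a₁ × c) × (b₁ × c), ∑ k, prodVec (A k) (B k) (((i, s), (j, t)), o) *
      star (prodVec (A k) (B k) (((i', s), (j', t)), o)) =
      ∑ k, (∑ a, ∑ x, A k (a, x) (i, s) * star (A k (a, x) (i', s))) *
        (∑ b, ∑ y, B k (b, y) (j, t) * star (B k (b, y) (j', t))) := by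
    intro s t
    rw [Finset.sum_comm]
    refine Finset.sum_congr rfl fun k _ => ?_
    rw [← Fintype.sum_prod_type', ← Fintype.sum_prod_type', Finset.sum_mul_sum,
      Fintype.sum_prod_type]
    refine Finset.sum_congr rfl fun x _ => Finset.sum_congr rfl fun y _ => ?_
    simp only [prodVec, star_mul']
    ring
  have h4 : ∀ f : c → c → Fin n → ℂ, ∑ s, ∑ t, ∑ k, f s t k = ∑ k, ∑ s, ∑ t, f s t k := fun f => by
    rw [Finset.sum_congr rfl fun s _ => Finset.sum_comm (f := f s), Finset.sum_comm]
  simp only [h3]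
  rw [h4]
  refine Finset.sum_congr rfl fun k _ => ?_
  rw [← Finset.sum_mul_sum, ← Finset.sum_mul_sum]
  congr 1
  · rw [Finset.sum_comm (s := (Finset.univ : Finset c))]
    refine Finset.sum_congr rfl fun a _ => ?_
    rw [Fintype.sum_prod_type]
  · rw [Finset.sum_comm (s := (Finset.univ : Finset c))]
    refine Finset.sum_congr rfl fun a _ => ?_
    rw [Fintype.sum_prod_type, Finset.sum_comm]

theorem collapse_eq_of_kraus {c : Type*} [Fintype c] [DecidableEq c]
    {T : LMap ((a₀ × c) × (b₀ × c)) ((a₁ × c) × (b₁ × c))} {n : ℕ}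
    (A : Fin n → Matrix (a₁ × c) (a₀ × c) ℂ) (B : Fin n → Matrix (b₁ × c) (b₀ × c) ℂ)
    (hAB : ∀ p q, choi T p q = ∑ k, prodVec (A k) (B k) p * star (prodVec (A k) (B k) q)) :
    collapse (choi T) = Matrix.of (fun p q : (a₀ × b₀) × (a₁ × b₁) =>
      ∑ k, (∑ u : c × c, A k (p.2.1, u.2) (p.1.1, u.1) * B k (p.2.2, u.1) (p.1.2, u.2)) *
      star (∑ u : c × c, A k (q.2.1, u.2) (q.1.1, u.1) * B k (q.2.2, u.1) (q.1.2, u.2))) := by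
  ext p q
  simp only [collapse, of_apply, hAB, star_sum, Finset.sum_mul_sum]
  rw [Finset.sum_congr rfl fun s _ => Finset.sum_comm, Finset.sum_comm]
  rfl

/-- If `S` on `ACBD`, with catalysts of dimension `M`, is dominated by a separable channel and
contracts to at least `N`, then `N ⊗ F^L` is dominated by a separable channel. -/
theorem SepDom.transfer {M L : ℕ} [NeZero M] [NeZero L]
    (hL : Fintype.card (a₀ × a₁) + Fintype.card (b₀ × b₁) ≤ L ^ 2) {μ : ℝ} (hμ : 0 < μ)
    {S : LMap ((a₀ × Fin M) × (b₀ × Fin M)) ((a₁ × Fin M) × (b₁ × Fin M))} (hS : SepDom μ S)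
    (N : LMap (a₀ × b₀) (a₁ × b₁))
    (hN : (collapse (choi S) - ((M : ℂ) ^ 4) • choi N).PosSemidef) :
    SepDom (μ * L ^ 2 / M ^ 2) (bipTensor N (swapChannel L)) := by
  obtain ⟨T, hT, h⟩ := hS
  obtain ⟨n, A, B, hAB⟩ := hT.exists_kraus
  have hM : (0 : ℝ) < M := by exact_mod_cast NeZero.pos M
  -- C is the marginal of the Kraus vectors, and g comes from μ·collapse T ≥ collapse S ≥ M⁴N. Hence
  -- CL²/g = μL²/M².
  have key := sepDom_of_gram (L := L) (C := (M : ℝ) ^ 2) (g := (M : ℝ) ^ 4 / μ) hL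
    (fun k a (u : Fin M × Fin M) => A k (a.2, u.2) (a.1, u.1))
    (fun k b (v : Fin M × Fin M) => B k (b.2, v.1) (b.1, v.2)) (by positivity) (by positivity)
    (fun i i' j j' => by
      have := sum_kraus_marginal hT.1.2 A B hAB i i' j j'
      rw [Fintype.card_fin] at this
      simpa only [Complex.ofReal_pow, Complex.ofReal_natCast] using this) N ?_
  · convert key using 1
    field_simp
  · have h1 := (collapse_posSemidef h).add hN
    rw [collapse_sub, collapse_smul, sub_add_sub_cancel] at h1
    have h2 := h1.smul_ofReal (inv_nonneg.2 hμ.le)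
    rw [collapse_eq_of_kraus A B hAB] at h2
    convert h2 using 1
    have hμ' : (μ : ℂ) ≠ 0 := by exact_mod_cast hμ.ne'
    rw [smul_sub, smul_smul, smul_smul]
    push_cast
    rw [inv_mul_cancel₀ hμ', one_smul, inv_mul_eq_div]

theorem IsSepChannel.sepDom_bipTensor_swap {L : ℕ} [NeZero L]
    (hL : Fintype.card (a₀ × a₁) + Fintype.card (b₀ × b₁) ≤ L ^ 2)
    {N : LMap (a₀ × b₀) (a₁ × b₁)} (hN : IsSepChannel N) :
    SepDom ((L : ℝ) ^ 2) (bipTensor N (swapChannel L)) := by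
  obtain ⟨n, A, B, hAB⟩ := hN.exists_kraus
  -- The Kraus entries of N are vectors on a trivial, one-dimensional catalyst.
  have key := sepDom_of_gram (L := L) (W := Unit) (C := 1) (g := 1) hL (fun k a _ => A k a.2 a.1)
    (fun k b _ => B k b.2 b.1) one_pos one_pos ?_ N ?_
  · simpa using key
  · intro i i' j j'
    have h := (isTP_iff.1 hN.1.2) (i, j) (i', j')
    simp only [hAB, Prod.mk.injEq] at h
    rw [Finset.sum_comm] at h
    push_cast
    rw [← h]
    refine Finset.sum_congr rfl fun k _ => ?_
    rw [Fintype.sum_prod_type]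
    refine Finset.sum_congr rfl fun a _ => Finset.sum_congr rfl fun b _ => ?_
    simp only [Finset.univ_unique, Finset.sum_singleton, prodVec, star_mul']
    ring
  · convert PosSemidef.zero using 1
    ext p q
    simp [hAB, prodVec]

/-- Cauchy–Schwarz on each product Kraus operator bounds its contraction with the swap by its
catalyst marginal. For N ⊗ F^L with N a channel the trace is larger by a factor L²; this gap forces
the robustness up. -/
theorem trace_collapse_le {c : Type*} [Fintype c] [DecidableEq c]
    {T : LMap ((a₀ × c) × (b₀ × c)) ((a₁ × c) × (b₁ × c))} (hT : IsSepChannel T) :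
    (collapse (choi T)).trace.re ≤
      (Fintype.card a₀ : ℝ) * Fintype.card b₀ * Fintype.card c ^ 2 := by
  obtain ⟨n, A, B, hAB⟩ := hT.exists_kraus
  have h1 : ∑ i, ∑ j, ∑ k, ∑ a, ∑ b,
      (∑ u : c × c, A k (a, u.2) (i, u.1) * star (A k (a, u.2) (i, u.1))) *
      (∑ v : c × c, B k (b, v.1) (j, v.2) * star (B k (b, v.1) (j, v.2))) =
      (Fintype.card a₀ : ℂ) * Fintype.card b₀ * Fintype.card c ^ 2 := by
    simp only [sum_kraus_marginal hT.1.2 A B hAB]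
    simp
    ring
  have h2 := congrArg Complex.re h1
  have h3 : ((Fintype.card a₀ : ℂ) * Fintype.card b₀ * Fintype.card c ^ 2).re =
      (Fintype.card a₀ : ℝ) * Fintype.card b₀ * Fintype.card c ^ 2 := by
    norm_cast
  rw [← h3, ← h2, collapse_eq_of_kraus A B hAB, Matrix.trace]
  simp only [diag_apply, of_apply, Complex.re_sum, Fintype.sum_prod_type (α₁ := a₀ × b₀),
    Fintype.sum_prod_type (α₁ := a₀) (α₂ := b₀), Fintype.sum_prod_type (α₁ := a₁) (α₂ := b₁)]
  refine Finset.sum_le_sum fun i _ => Finset.sum_le_sum fun j _ => ?_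
  rw [Finset.sum_congr rfl fun s _ => Finset.sum_comm, Finset.sum_comm]
  refine Finset.sum_le_sum fun k _ => Finset.sum_le_sum fun a _ => Finset.sum_le_sum fun b _ => ?_
  exact norm_sum_mul_sq_le (fun u : c × c => A k (a, u.2) (i, u.1))
    (fun u : c × c => B k (b, u.1) (j, u.2))

end Transfer

/-! ### Trace norm: duality with the operator norm and contractivity -/

section TraceNorm

open scoped Matrix.Norms.L2Operator

variable {x y : Type*} [Fintype x] [DecidableEq x] [Fintype y] [DecidableEq y]

theorem Matrix.l2_opNorm_le_of_forall {A : Matrix x y ℂ} {c : ℝ} (hc : 0 ≤ c)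
    (h : ∀ v : y → ℂ, ∑ i, ‖(A *ᵥ v) i‖ ^ 2 ≤ c ^ 2 * ∑ j, ‖v j‖ ^ 2) : ‖A‖ ≤ c := by
  rw [l2_opNorm_def]
  refine ContinuousLinearMap.opNorm_le_bound _ hc fun v => ?_
  refine abs_le_of_sq_le_sq' ?_ (by positivity) |>.2
  rw [mul_pow, EuclideanSpace.norm_sq_eq, EuclideanSpace.norm_sq_eq]
  exact h v

theorem Matrix.l2_opNorm_le_one_of_isometry {A : Matrix x y ℂ} (h : Aᴴ * A = 1) : ‖A‖ ≤ 1 := by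
  have h1 := l2_opNorm_conjTranspose_mul_self A
  rw [h] at h1
  have h2 : ‖(1 : Matrix y y ℂ)‖ ≤ 1 := by
    rw [← diagonal_one, l2_opNorm_diagonal]
    exact (pi_norm_le_iff_of_nonneg zero_le_one).2 fun i => by simp
  nlinarith [norm_nonneg A]

theorem traceNorm_nonneg (X : Matrix x x ℂ) : 0 ≤ traceNorm X :=
  Finset.sum_nonneg fun _ _ => Real.sqrt_nonneg _

theorem norm_trace_mul_le (W X : Matrix x x ℂ) : ‖(W * X).trace‖ ≤ ‖W‖ * traceNorm X := by
  have h := Matrix.isHermitian_conjTranspose_mul_self X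
  have htr : (W * X).trace = ∑ i, (WithLp.ofLp (WithLp.toLp 2 (W *ᵥ (X *ᵥ h.eigenvectorBasis i)))) ⬝ᵥ
      star (WithLp.ofLp (h.eigenvectorBasis i)) := by
    have hU : (h.eigenvectorUnitary : Matrix x x ℂ) * (h.eigenvectorUnitary : Matrix x x ℂ)ᴴ = 1 :=
      Unitary.coe_mul_star_self h.eigenvectorUnitary
    have h1 : (W * X).trace = ((h.eigenvectorUnitary : Matrix x x ℂ)ᴴ * (W * X) *
        (h.eigenvectorUnitary : Matrix x x ℂ)).trace := by
      rw [Matrix.trace_mul_comm _ (h.eigenvectorUnitary : Matrix x x ℂ), ← Matrix.mul_assoc, hU,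
        Matrix.one_mul]
    rw [h1, Matrix.trace]
    refine Finset.sum_congr rfl fun i _ => ?_
    rw [diag_apply, Matrix.mul_assoc, mul_apply, dotProduct]
    refine Finset.sum_congr rfl fun j _ => ?_
    rw [mul_comm, Matrix.mul_assoc]
    simp only [conjTranspose_apply, Matrix.IsHermitian.eigenvectorUnitary_apply, Pi.star_apply]
    congr 1
  have hX : ∀ i, ‖(WithLp.toLp 2 (X *ᵥ h.eigenvectorBasis i) : EuclideanSpace ℂ x)‖ =
      √(h.eigenvalues i) := by
    intro i
    rw [EuclideanSpace.norm_eq, h.eigenvalues_eq, ← mulVec_mulVec, dotProduct_mulVec,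
      vecMul_conjTranspose, star_star, dotProduct, RCLike.re_to_complex, Complex.re_sum]
    congr 1
    refine Finset.sum_congr rfl fun j _ => ?_
    rw [Pi.star_apply, mul_comm, Complex.star_def, Complex.mul_conj, Complex.normSq_eq_norm_sq,
      Complex.ofReal_re]
  rw [htr, traceNorm, Finset.mul_sum]
  refine (norm_sum_le _ _).trans (Finset.sum_le_sum fun i _ => ?_)
  rw [← EuclideanSpace.inner_eq_star_dotProduct]
  refine (norm_inner_le_norm _ _).trans ?_
  rw [h.eigenvectorBasis.norm_eq_one, one_mul, ← hX]
  exact l2_opNorm_mulVec W (WithLp.toLp 2 (X *ᵥ h.eigenvectorBasis i))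

/-- W is the adjoint of the partial isometry in the polar decomposition of X, that is, (X*X)^(-1/2)
X* with the inverse taken on the support. -/
theorem exists_trace_mul_eq_traceNorm (X : Matrix x x ℂ) :
    ∃ W : Matrix x x ℂ, ‖W‖ ≤ 1 ∧ (W * X).trace = traceNorm X := by
  have h := Matrix.isHermitian_conjTranspose_mul_self X
  set U : Matrix x x ℂ := (h.eigenvectorUnitary : Matrix x x ℂ) with hU
  have hUU : Uᴴ * U = 1 := Unitary.coe_star_mul_self h.eigenvectorUnitary
  set D : Matrix x x ℂ := diagonal fun i => (h.eigenvalues i : ℂ) with hD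
  -- The convention 0⁻¹ = 0 makes this the pseudo-inverse.
  set R : Matrix x x ℂ := diagonal fun i => (((√(h.eigenvalues i))⁻¹ : ℝ) : ℂ) with hR
  have hRR : Rᴴ = R := by
    rw [hR, diagonal_conjTranspose]
    congr 1
    ext i
    simp
  have hsp : Xᴴ * X = U * D * Uᴴ := by
    conv_lhs => rw [h.spectral_theorem, Unitary.conjStarAlgAut_apply]
    rfl
  have hl : ∀ i, 0 ≤ h.eigenvalues i := Matrix.eigenvalues_conjTranspose_mul_self_nonneg X
  refine ⟨U * R * Uᴴ * Xᴴ, ?_, ?_⟩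
  · have h1 : (U * R * Uᴴ * Xᴴ) * (U * R * Uᴴ * Xᴴ)ᴴ = U * (R * D * R) * Uᴴ := by
      simp only [conjTranspose_mul, conjTranspose_conjTranspose, hRR, Matrix.mul_assoc]
      rw [← Matrix.mul_assoc Xᴴ X, hsp]
      simp only [Matrix.mul_assoc]
      rw [← Matrix.mul_assoc Uᴴ U, hUU, Matrix.one_mul, ← Matrix.mul_assoc Uᴴ U, hUU, Matrix.one_mul]
    have h2 := l2_opNorm_conjTranspose_mul_self (U * R * Uᴴ * Xᴴ)ᴴ
    rw [conjTranspose_conjTranspose, l2_opNorm_conjTranspose, h1] at h2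
    have h3 : ‖R * D * R‖ ≤ 1 := by
      rw [hR, hD, diagonal_mul_diagonal, diagonal_mul_diagonal, l2_opNorm_diagonal]
      refine (pi_norm_le_iff_of_nonneg zero_le_one).2 fun i => ?_
      rw [← Complex.ofReal_mul, ← Complex.ofReal_mul, Complex.norm_real]
      rcases (hl i).eq_or_lt with h0 | h0
      · simp [← h0]
      · have : (√(h.eigenvalues i))⁻¹ * h.eigenvalues i * (√(h.eigenvalues i))⁻¹ = 1 := by
          have := Real.mul_self_sqrt (hl i)
          have h5 := (Real.sqrt_pos.2 h0).ne'
          field_simp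
          nlinarith
        rw [this]; simp
    have h4 : ‖U‖ ≤ 1 := l2_opNorm_le_one_of_isometry hUU
    have h5 : ‖U * (R * D * R) * Uᴴ‖ ≤ 1 := by
      refine (l2_opNorm_mul _ _).trans ?_
      rw [l2_opNorm_conjTranspose]
      refine mul_le_one₀ ((l2_opNorm_mul _ _).trans (mul_le_one₀ h4 (norm_nonneg _) h3))
        (norm_nonneg _) h4
    rw [h2] at h5
    nlinarith [norm_nonneg (U * R * Uᴴ * Xᴴ)]
  · rw [Matrix.mul_assoc, hsp]
    have h1 : U * R * Uᴴ * (U * D * Uᴴ) = U * (R * D) * Uᴴ := by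
      simp only [Matrix.mul_assoc]
      rw [← Matrix.mul_assoc Uᴴ U, hUU, Matrix.one_mul]
    rw [h1, Matrix.trace_mul_comm, ← Matrix.mul_assoc, hUU, Matrix.one_mul, hR, hD,
      diagonal_mul_diagonal, trace_diagonal, traceNorm, Complex.ofReal_sum]
    refine Finset.sum_congr rfl fun i _ => ?_
    rw [← Complex.ofReal_mul]
    congr 1
    rw [inv_mul_eq_div, Real.div_sqrt]

/-- Duality and cyclicity of the trace: an optimal W for AXB gives the test operator BWA for X. -/
theorem traceNorm_mul_mul_le (A : Matrix y x ℂ) (X : Matrix x x ℂ) (B : Matrix x y ℂ) :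
    traceNorm (A * X * B) ≤ ‖A‖ * ‖B‖ * traceNorm X := by
  obtain ⟨W, hW, h⟩ := exists_trace_mul_eq_traceNorm (A * X * B)
  have h1 : ((traceNorm (A * X * B) : ℝ) : ℂ) = ((B * W * A) * X).trace := by
    rw [← h, Matrix.mul_assoc A, ← Matrix.mul_assoc W, Matrix.trace_mul_comm]
    simp only [Matrix.mul_assoc]
    rw [Matrix.trace_mul_comm]
    simp only [Matrix.mul_assoc]
  have h2 := norm_trace_mul_le (B * W * A) X
  rw [← h1, Complex.norm_real, Real.norm_of_nonneg (traceNorm_nonneg _)] at h2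
  refine h2.trans (mul_le_mul_of_nonneg_right ?_ (traceNorm_nonneg _))
  calc ‖B * W * A‖ ≤ ‖B‖ * ‖W‖ * ‖A‖ :=
        (l2_opNorm_mul _ _).trans (mul_le_mul_of_nonneg_right (l2_opNorm_mul _ _) (norm_nonneg _))
    _ ≤ ‖B‖ * 1 * ‖A‖ := by gcongr
    _ = _ := by ring

theorem traceNorm_add_le (X Y : Matrix x x ℂ) : traceNorm (X + Y) ≤ traceNorm X + traceNorm Y := by
  obtain ⟨W, hW, h⟩ := exists_trace_mul_eq_traceNorm (X + Y)
  have h1 := norm_trace_mul_le W X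
  have h2 := norm_trace_mul_le W Y
  have h3 : traceNorm (X + Y) ≤ ‖(W * X).trace‖ + ‖(W * Y).trace‖ := by
    rw [← Real.norm_of_nonneg (traceNorm_nonneg (X + Y)), ← Complex.norm_real, ← h, Matrix.mul_add,
      Matrix.trace_add]
    exact norm_add_le _ _
  nlinarith [traceNorm_nonneg X, traceNorm_nonneg Y]

theorem norm_trace_le (X : Matrix x x ℂ) : ‖X.trace‖ ≤ traceNorm X := by
  have h := norm_trace_mul_le 1 X
  rw [Matrix.one_mul] at h
  refine h.trans (mul_le_of_le_one_left (traceNorm_nonneg _) ?_)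
  exact l2_opNorm_le_one_of_isometry (by simp)

theorem traceNorm_submatrix_le (X : Matrix x x ℂ) {e : y → x} (he : Function.Injective e) :
    traceNorm (X.submatrix e e) ≤ traceNorm X := by
  have h : X.submatrix e e = (1 : Matrix x x ℂ).submatrix e id * X *
      ((1 : Matrix x x ℂ).submatrix e id)ᴴ := by
    ext i j
    simp [mul_apply, Matrix.one_apply]
  have h1 : ‖((1 : Matrix x x ℂ).submatrix e id)ᴴ‖ ≤ 1 := by
    refine l2_opNorm_le_one_of_isometry ?_
    ext i j
    simp [mul_apply, Matrix.one_apply, he.eq_iff]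
  have h2 := h1
  rw [l2_opNorm_conjTranspose] at h2
  rw [h]
  refine (traceNorm_mul_mul_le _ _ _).trans ?_
  refine mul_le_of_le_one_left (traceNorm_nonneg _) (mul_le_one₀ h2 (norm_nonneg _) h1)

end TraceNorm

/-! ### Trace norm under isometries and Kraus operators -/

section TraceNormBounds

open scoped Matrix.Norms.L2Operator

variable {x y : Type*} [Fintype x] [DecidableEq x] [Fintype y] [DecidableEq y]

theorem traceNorm_vecMulVec_le (v : x → ℂ) :
    traceNorm (vecMulVec v (star v)) ≤ ∑ i, ‖v i‖ ^ 2 := by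
  obtain ⟨W, hW, h⟩ := exists_trace_mul_eq_traceNorm (vecMulVec v (star v))
  have h1 : (W * vecMulVec v (star v)).trace =
      (WithLp.ofLp (WithLp.toLp 2 (W *ᵥ v) : EuclideanSpace ℂ x)) ⬝ᵥ
        star (WithLp.ofLp (WithLp.toLp 2 v : EuclideanSpace ℂ x)) := by
    rw [mul_vecMulVec, trace_vecMulVec]
  rw [← EuclideanSpace.inner_eq_star_dotProduct, h] at h1
  have h2 := norm_inner_le_norm (𝕜 := ℂ) (WithLp.toLp 2 v : EuclideanSpace ℂ x) (WithLp.toLp 2 (W *ᵥ v))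
  have h3 : ‖(WithLp.toLp 2 (W *ᵥ v) : EuclideanSpace ℂ x)‖ ≤
      ‖W‖ * ‖(WithLp.toLp 2 v : EuclideanSpace ℂ x)‖ := l2_opNorm_mulVec W (WithLp.toLp 2 v)
  rw [← h1, Complex.norm_real, Real.norm_of_nonneg (traceNorm_nonneg _)] at h2
  have h4 := EuclideanSpace.norm_sq_eq (WithLp.toLp 2 v : EuclideanSpace ℂ x)
  change _ = ∑ i, ‖v i‖ ^ 2 at h4
  rw [← h4]
  nlinarith [norm_nonneg (WithLp.toLp 2 v : EuclideanSpace ℂ x), norm_nonneg W,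
    mul_le_mul_of_nonneg_right hW (norm_nonneg (WithLp.toLp 2 v : EuclideanSpace ℂ x))]

theorem partialIsometry_norm_le (c : x → ℂ) (g : x → y)
    (h : ∀ j, ∑ i, (if g i = j then c i * star (c i) else 0) = 1) :
    ‖(Matrix.of fun i j => if g i = j then c i else 0 : Matrix x y ℂ)‖ ≤ 1 := by
  refine l2_opNorm_le_one_of_isometry ?_
  ext j k
  simp only [mul_apply, conjTranspose_apply, of_apply, Matrix.one_apply]
  by_cases hjk : j = k
  · subst hjk
    rw [if_pos rfl, ← h j]
    refine Finset.sum_congr rfl fun i _ => ?_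
    split_ifs <;> simp [mul_comm]
  · rw [if_neg hjk]
    refine Finset.sum_eq_zero fun i _ => ?_
    split_ifs with h1 h2 <;> simp_all

theorem traceNorm_dilate_le (c : x → ℂ) (g : x → y)
    (h : ∀ j, ∑ i, (if g i = j then c i * star (c i) else 0) = 1) (Z : Matrix y y ℂ) :
    traceNorm (Matrix.of fun i j => c i * Z (g i) (g j) * star (c j)) ≤ traceNorm Z := by
  have h1 := partialIsometry_norm_le c g h
  have h2 := traceNorm_mul_mul_le (Matrix.of fun i j => if g i = j then c i else 0 : Matrix x y ℂ) Z
    (Matrix.of fun i j => if g i = j then c i else 0 : Matrix x y ℂ)ᴴ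
  rw [l2_opNorm_conjTranspose] at h2
  refine le_trans (le_of_eq ?_) (h2.trans (mul_le_of_le_one_left (traceNorm_nonneg _)
    (mul_le_one₀ h1 (norm_nonneg _) h1)))
  congr 1
  ext i j
  simp [mul_apply, apply_ite star]

theorem traceNorm_compress_le (c : x → ℂ) (g : x → y)
    (h : ∀ j, ∑ i, (if g i = j then c i * star (c i) else 0) = 1) (Y : Matrix x x ℂ) :
    traceNorm (Matrix.of fun j l => ∑ i, if g i = j then star (c i) *
      (∑ k, if g k = l then c k * Y i k else 0) else 0) ≤ traceNorm Y := by
  have h1 := partialIsometry_norm_le c g h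
  have h2 := traceNorm_mul_mul_le (Matrix.of fun i j => if g i = j then c i else 0 : Matrix x y ℂ)ᴴ Y
    (Matrix.of fun i j => if g i = j then c i else 0 : Matrix x y ℂ)
  rw [l2_opNorm_conjTranspose] at h2
  refine le_trans (le_of_eq ?_) (h2.trans (mul_le_of_le_one_left (traceNorm_nonneg _)
    (mul_le_one₀ h1 (norm_nonneg _) h1)))
  congr 1
  ext i j
  rw [Matrix.mul_assoc]
  simp only [mul_apply, of_apply, conjTranspose_apply, apply_ite star, star_zero, ite_mul, zero_mul,
    mul_ite, mul_zero]
  simp only [mul_comm]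

theorem traceNorm_sum_le {κ : Type*} (s : Finset κ) (X : κ → Matrix x x ℂ) :
    traceNorm (∑ k ∈ s, X k) ≤ ∑ k ∈ s, traceNorm (X k) := by
  classical
  induction s using Finset.induction_on with
  | empty =>
    have h := traceNorm_mul_mul_le (0 : Matrix x x ℂ) 0 0
    simpa using h
  | insert a s ha ih =>
    rw [Finset.sum_insert ha, Finset.sum_insert ha]
    exact (traceNorm_add_le _ _).trans (by gcongr)

/-- The operator norm of 1 ⊗ A is bounded by the Hilbert–Schmidt norm of A, independently of the
reference r; row-wise Cauchy–Schwarz suffices. -/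
theorem norm_one_tensor_le {r : Type*} [Fintype r] [DecidableEq r] (w : x × y → ℂ) :
    ‖(Matrix.of fun s t => if s.1 = t.1 then w (t.2, s.2) else 0 : Matrix (r × y) (r × x) ℂ)‖ ^ 2 ≤
      ∑ p, ‖w p‖ ^ 2 := by
  have hw : 0 ≤ ∑ p, ‖w p‖ ^ 2 := by positivity
  rw [← Real.le_sqrt (norm_nonneg _) hw]
  refine l2_opNorm_le_of_forall (Real.sqrt_nonneg _) fun v => ?_
  rw [Real.sq_sqrt hw]
  have h1 : ∀ s a, ((Matrix.of fun s t => if s.1 = t.1 then w (t.2, s.2) else 0 :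
      Matrix (r × y) (r × x) ℂ) *ᵥ v) (s, a) = ∑ i, w (i, a) * v (s, i) := by
    intro s a
    simp [mulVec, dotProduct, Fintype.sum_prod_type, Finset.sum_ite_irrel]
  have h2 : ∀ s a, ‖∑ i, w (i, a) * v (s, i)‖ ^ 2 ≤
      (∑ i, ‖w (i, a)‖ ^ 2) * ∑ i, ‖v (s, i)‖ ^ 2 := by
    intro s a
    refine le_trans ?_ (Finset.sum_mul_sq_le_sq_mul_sq _ _ _)
    gcongr
    exact (norm_sum_le _ _).trans (by simp)
  rw [Fintype.sum_prod_type]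
  simp only [h1]
  refine (Finset.sum_le_sum fun s _ => Finset.sum_le_sum fun a _ => h2 s a).trans (le_of_eq ?_)
  rw [Finset.sum_comm, ← Finset.sum_mul_sum, Fintype.sum_prod_type,
    Fintype.sum_prod_type, Finset.sum_comm (f := fun i a => ‖w (i, a)‖ ^ 2)]

end TraceNormBounds

/-! ### Diamond-norm bounds -/

section Diamond

variable {x y : Type*} [Fintype x] [DecidableEq x] [Fintype y] [DecidableEq y]

/-- `‖Δ‖_⋄ ≤ c`, spelled out. -/
def DiamondLE (c : ℝ) (Δ : LMap x y) : Prop :=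
  ∀ (r : ℕ) (Z : Matrix (Fin r × x) (Fin r × x) ℂ), traceNorm Z ≤ 1 →
    traceNorm (LMap.tensor (LinearMap.id : LMap (Fin r) (Fin r)) Δ Z) ≤ c

theorem diamondClose_iff {ε : ℝ} (hε : 0 ≤ ε) {N' N : LMap x y} :
    DiamondClose ε N' N ↔ DiamondLE (2 * ε) (N' - N) := by
  rw [DiamondClose, ENNReal.div_le_iff_le_mul (by simp) (by simp),
    show (2 : ℝ≥0∞) = ENNReal.ofReal 2 by simp, ← ENNReal.ofReal_mul hε, mul_comm ε]
  simp only [diamondNorm, iSup_le_iff, DiamondLE]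
  refine forall_congr' fun r => forall_congr' fun Z => forall_congr' fun _ => ?_
  exact ENNReal.ofReal_le_ofReal_iff (by positivity)

theorem DiamondLE.fintype {c : ℝ} {Δ : LMap x y} (h : DiamondLE c Δ) {r : Type*} [Fintype r]
    [DecidableEq r] (Z : Matrix (r × x) (r × x) ℂ) (hZ : traceNorm Z ≤ 1) :
    traceNorm (LMap.tensor (LinearMap.id : LMap r r) Δ Z) ≤ c := by
  let e := Fintype.equivFin r
  have h1 : Function.Injective fun p : Fin (Fintype.card r) × x => (e.symm p.1, p.2) :=
    fun p q hpq => by simpa [Prod.ext_iff] using hpq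
  have h2 : Function.Injective fun p : r × y => (e p.1, p.2) :=
    fun p q hpq => by simpa [Prod.ext_iff] using hpq
  refine le_trans (le_trans (le_of_eq ?_) (traceNorm_submatrix_le _ h2))
    (h _ (Z.submatrix _ _) ((traceNorm_submatrix_le Z h1).trans hZ))
  congr 1
  ext s t
  simp [tensor_id_apply]

theorem DiamondLE.add {c d : ℝ} {Δ Γ : LMap x y} (h : DiamondLE c Δ) (h' : DiamondLE d Γ) :
    DiamondLE (c + d) (Δ + Γ) := by
  intro r Z hZ
  have : LMap.tensor (LinearMap.id : LMap (Fin r) (Fin r)) (Δ + Γ) Z =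
      LMap.tensor LinearMap.id Δ Z + LMap.tensor LinearMap.id Γ Z := by
    ext s t
    simp [tensor_id_apply, mul_add, Finset.sum_add_distrib]
  rw [this]
  exact (traceNorm_add_le _ _).trans (add_le_add (h r Z hZ) (h' r Z hZ))

theorem DiamondLE.mono {c d : ℝ} {Δ : LMap x y} (h : DiamondLE c Δ) (hcd : c ≤ d) :
    DiamondLE d Δ := fun r Z hZ => (h r Z hZ).trans hcd

theorem DiamondLE.norm_trace_le {c : ℝ} {Δ : LMap x y} (h : DiamondLE c Δ) (v : x → ℂ)
    (hv : ∑ i, ‖v i‖ ^ 2 = 1) : ‖(Δ (vecMulVec v (star v))).trace‖ ≤ c := by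
  have h1 := h 1 (vecMulVec (fun p : Fin 1 × x => v p.2) (star fun p : Fin 1 × x => v p.2))
    ((traceNorm_vecMulVec_le _).trans (by simp [Fintype.sum_prod_type, hv]))
  refine le_trans (le_of_eq ?_) ((_root_.norm_trace_le _).trans h1)
  congr 1
  simp only [Matrix.trace, diag_apply, Fintype.sum_prod_type, tensor_id_apply]
  simp [apply_eq_sum_choi, vecMulVec_apply]

/-- Gram vectors of the Choi matrix are Kraus operators, and their squared Hilbert–Schmidt norms add
up to its trace. The bound is crude: it produces the factor |A₀||B₀| in the smoothing parameter. -/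
theorem diamondLE_of_posSemidef {Λ : LMap x y} (h : (choi Λ).PosSemidef) :
    DiamondLE (choi Λ).trace.re Λ := by
  intro r Z hZ
  obtain ⟨w, hw⟩ := h.exists_gram
  let A : x × y → Matrix (Fin r × y) (Fin r × x) ℂ := fun k =>
    Matrix.of fun s t => if s.1 = t.1 then w k (t.2, s.2) else 0
  have h1 : LMap.tensor (LinearMap.id : LMap (Fin r) (Fin r)) Λ Z = ∑ k, A k * Z * (A k)ᴴ := by
    ext ⟨s, a⟩ ⟨t, b⟩
    rw [tensor_id_apply, Matrix.sum_apply]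
    have : ∀ k, (A k * Z * (A k)ᴴ) (s, a) (t, b) =
        ∑ i, ∑ j, Z (s, i) (t, j) * (w k (i, a) * star (w k (j, b))) := by
      intro k
      simp only [A, mul_apply, conjTranspose_apply, of_apply, Fintype.sum_prod_type, apply_ite star,
        star_zero, ite_mul, mul_ite, zero_mul, mul_zero, Finset.sum_ite_irrel,
        Finset.sum_const_zero, Finset.sum_ite_eq, Finset.mem_univ, if_true, Finset.sum_mul]
      rw [Finset.sum_comm]
      refine Finset.sum_congr rfl fun i _ => Finset.sum_congr rfl fun j _ => by ring
    simp only [this, hw, Finset.mul_sum]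
    rw [Finset.sum_congr rfl fun i _ => Finset.sum_comm, Finset.sum_comm]
  rw [h1]
  refine (traceNorm_sum_le _ _).trans ?_
  open scoped Matrix.Norms.L2Operator in
  calc ∑ k, traceNorm (A k * Z * (A k)ᴴ) ≤ ∑ k, ∑ p, ‖w k p‖ ^ 2 := by
        refine Finset.sum_le_sum fun k _ => ?_
        refine (traceNorm_mul_mul_le _ _ _).trans ?_
        rw [l2_opNorm_conjTranspose, ← sq]
        exact (mul_le_of_le_one_right (sq_nonneg _) hZ).trans (norm_one_tensor_le (w k))
    _ = (choi Λ).trace.re := by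
        rw [Finset.sum_comm, Matrix.trace, Complex.re_sum]
        refine Finset.sum_congr rfl fun p _ => ?_
        rw [diag_apply, hw, Complex.re_sum]
        refine Finset.sum_congr rfl fun k _ => ?_
        rw [Complex.star_def, Complex.mul_conj, Complex.normSq_eq_norm_sq, Complex.ofReal_re]

end Diamond

section Bipartite

variable {a₀ a₁ b₀ b₁ : Type*}
  [Fintype a₀] [DecidableEq a₀] [Fintype a₁] [DecidableEq a₁]
  [Fintype b₀] [DecidableEq b₀] [Fintype b₁] [DecidableEq b₁]

/-- The swap only relabels C and D, which can therefore be absorbed into the reference system. -/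
theorem DiamondLE.bipTensor_swap {c : ℝ} {Δ : LMap (a₀ × b₀) (a₁ × b₁)} (h : DiamondLE c Δ)
    (L : ℕ) : DiamondLE c (bipTensor Δ (swapChannel L)) := by
  intro r Z hZ
  have h1 : Function.Injective fun p : (Fin r × (Fin L × Fin L)) × (a₀ × b₀) =>
      ((p.1.1, ((p.2.1, p.1.2.1), (p.2.2, p.1.2.2))) : Fin r × ((a₀ × Fin L) × (b₀ × Fin L))) := by
    rintro ⟨⟨_, _, _⟩, _, _⟩ ⟨⟨_, _, _⟩, _, _⟩ h
    simp_all
  have h2 : Function.Injective fun p : Fin r × ((a₁ × Fin L) × (b₁ × Fin L)) =>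
      (((p.1, (p.2.2.2, p.2.1.2)), (p.2.1.1, p.2.2.1)) :
        (Fin r × (Fin L × Fin L)) × (a₁ × b₁)) := by
    rintro ⟨_, ⟨_, _⟩, _, _⟩ ⟨_, ⟨_, _⟩, _, _⟩ h
    simp_all
  refine le_trans (le_trans (le_of_eq ?_) (traceNorm_submatrix_le _ h2))
    (h.fintype (Z.submatrix _ _) ((traceNorm_submatrix_le Z h1).trans hZ))
  congr 1
  ext ⟨s, ⟨a, c₁⟩, b, d₁⟩ ⟨t, ⟨a', c₁'⟩, b', d₁'⟩
  simp only [tensor_id_apply, submatrix_apply, choi_bipTensor_swap, swapVec, leftPart, rightPart,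
    corePart, Prod.mk.injEq, Fintype.sum_prod_type, ite_and, ite_mul, mul_ite, zero_mul, mul_zero,
    one_mul, mul_one, apply_ite star, star_one, star_zero]
  simp [Finset.sum_ite_irrel, eq_comm]

/-- The normalised contraction is physical: entangle C₀D₀ maximally with a reference copy, apply Δ,
and compress C₁D₁ and the copy onto the maximally entangled vector. Both outer steps are trace-norm
contractions. -/
theorem DiamondLE.collapse {c : ℝ} {L : ℕ} [NeZero L]
    {Δ : LMap ((a₀ × Fin L) × (b₀ × Fin L)) ((a₁ × Fin L) × (b₁ × Fin L))} (h : DiamondLE c Δ) :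
    DiamondLE c (ofChoi (((L : ℂ) ^ 4)⁻¹ • collapse (choi Δ))) := by
  intro r Z hZ
  have hL : (L : ℂ) ≠ 0 := by exact_mod_cast NeZero.ne L
  let g₀ : (Fin r × (Fin L × Fin L)) × ((a₀ × Fin L) × (b₀ × Fin L)) → Fin r × (a₀ × b₀) :=
    fun p => (p.1.1, (p.2.1.1, p.2.2.1))
  let k₀ : (Fin r × (Fin L × Fin L)) × ((a₀ × Fin L) × (b₀ × Fin L)) → ℂ :=
    fun p => if p.1.2 = (p.2.1.2, p.2.2.2) then (L : ℂ)⁻¹ else 0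
  let g₁ : (Fin r × (Fin L × Fin L)) × ((a₁ × Fin L) × (b₁ × Fin L)) → Fin r × (a₁ × b₁) :=
    fun p => (p.1.1, (p.2.1.1, p.2.2.1))
  -- The output indices are matched in the order D₁, C₁, because the swap sends C₀ to D₁ and D₀ to
  -- C₁. The four amplitudes 1/L from both sides of `k₀` and `k₁` make up L⁻⁴.
  let k₁ : (Fin r × (Fin L × Fin L)) × ((a₁ × Fin L) × (b₁ × Fin L)) → ℂ :=
    fun p => if p.1.2 = (p.2.2.2, p.2.1.2) then (L : ℂ)⁻¹ else 0
  have hs₁ : ∀ (F : _ → ℂ) s a b, (∑ i, if g₁ i = (s, (a, b)) then k₁ i * F i else 0) =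
      (L : ℂ)⁻¹ * ∑ u : Fin L × Fin L, F ((s, u), ((a, u.2), (b, u.1))) := by
    intro F s a b
    simp only [g₁, k₁, Prod.mk.injEq, Fintype.sum_prod_type, ite_and, ite_mul, zero_mul]
    simp [Finset.sum_ite_irrel, Finset.mul_sum]
  have hs₀ : ∀ (F : _ → ℂ) s i j, (∑ p, if g₀ p = (s, (i, j)) then k₀ p * F p else 0) =
      (L : ℂ)⁻¹ * ∑ u : Fin L × Fin L, F ((s, u), ((i, u.1), (j, u.2))) := by
    intro F s a b
    simp only [g₀, k₀, Prod.mk.injEq, Fintype.sum_prod_type, ite_and, ite_mul, zero_mul]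
    simp [Finset.sum_ite_irrel, Finset.mul_sum]
  have hk₀ : ∀ j, ∑ i, (if g₀ i = j then k₀ i * star (k₀ i) else 0) = 1 := by
    rintro ⟨s, i, j⟩
    rw [hs₀]
    simp [k₀]
  have hk₁ : ∀ j, ∑ i, (if g₁ i = j then k₁ i * star (k₁ i) else 0) = 1 := by
    rintro ⟨s, i, j⟩
    rw [hs₁]
    simp [k₁]
  have hstar : ∀ i, star (k₁ i) = k₁ i := by
    intro i
    simp [k₁, apply_ite star]
  refine le_trans (le_trans (le_of_eq ?_) (traceNorm_compress_le k₁ g₁ hk₁ _))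
    (h.fintype _ ((traceNorm_dilate_le k₀ g₀ hk₀ Z).trans hZ))
  congr 1
  ext ⟨s, a, b⟩ ⟨t, a', b'⟩
  have hin : ∀ (F : (a₀ × Fin L) × (b₀ × Fin L) → ℂ) (s : Fin r) (u : Fin L × Fin L),
      ∑ p, k₀ ((s, u), p) * F p =
        (L : ℂ)⁻¹ * ∑ i : a₀ × b₀, F ((i.1, u.1), (i.2, u.2)) := by
    rintro F s ⟨u, v⟩
    simp only [k₀, Prod.mk.injEq, Fintype.sum_prod_type, ite_and, ite_mul, zero_mul]
    simp [Finset.sum_ite_irrel, Finset.mul_sum]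
  have hstar₀ : ∀ i, star (k₀ i) = k₀ i := by
    intro i
    simp [k₀, apply_ite star]
  have hD : ∀ u u' : Fin L × Fin L, LMap.tensor (LinearMap.id : LMap (Fin r × (Fin L × Fin L)) _) Δ
      (Matrix.of fun i j => k₀ i * Z (g₀ i) (g₀ j) * star (k₀ j))
      ((s, u), ((a, u.2), (b, u.1))) ((t, u'), ((a', u'.2), (b', u'.1))) =
      (L : ℂ)⁻¹ * ((L : ℂ)⁻¹ * ∑ i, ∑ j, Z (s, i) (t, j) *
        choi Δ (glue (i, (a, b)) u u) (glue (j, (a', b')) u' u')) := by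
    intro u u'
    simp only [tensor_id_apply, of_apply, hstar₀]
    have h5 : ∀ p q : (a₀ × Fin L) × (b₀ × Fin L),
        k₀ ((s, u), p) * Z (g₀ ((s, u), p)) (g₀ ((t, u'), q)) * k₀ ((t, u'), q) *
          choi Δ (p, ((a, u.2), (b, u.1))) (q, ((a', u'.2), (b', u'.1))) =
        k₀ ((s, u), p) * (k₀ ((t, u'), q) * (Z (g₀ ((s, u), p)) (g₀ ((t, u'), q)) *
          choi Δ (p, ((a, u.2), (b, u.1))) (q, ((a', u'.2), (b', u'.1))))) := by
      intro p q; ring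
    simp only [h5, ← Finset.mul_sum]
    simp only [hin]
    rw [← Finset.mul_sum]
    rfl
  simp only [of_apply, hstar, hs₁, hD]
  simp only [tensor_id_apply, choi_ofChoi, Matrix.smul_apply, _root_.collapse, of_apply, smul_eq_mul,
    Finset.mul_sum]
  have h6 : ∀ f : (a₀ × b₀) → (a₀ × b₀) → Fin L × Fin L → Fin L × Fin L → ℂ,
      ∑ i, ∑ j, ∑ u, ∑ u', f i j u u' = ∑ u, ∑ u', ∑ i, ∑ j, f i j u u' := by
    intro f
    rw [Finset.sum_congr rfl fun i _ => Finset.sum_comm (f := fun j u => ∑ u', f i j u u'),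
      Finset.sum_comm]
    refine Finset.sum_congr rfl fun u _ => ?_
    rw [Finset.sum_congr rfl fun i _ => Finset.sum_comm (f := fun j u' => f i j u u'),
      Finset.sum_comm]
  rw [h6]
  refine Finset.sum_congr rfl fun u _ => Finset.sum_congr rfl fun u' _ =>
    Finset.sum_congr rfl fun i _ => Finset.sum_congr rfl fun j _ => ?_
  field_simp

end Bipartite

/-- The normalised sum over a block and a graph in it is at most the block trace. -/
theorem Matrix.PosSemidef.card_smul_trace_block_sub_sum_graph {p u v : Type*} [Fintype p]
    [DecidableEq p] [Fintype u] [DecidableEq u] [Fintype v] [DecidableEq v]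
    {M : Matrix (p × (u × v)) (p × (u × v)) ℂ} (hM : M.PosSemidef) (f : u → v) :
    (Matrix.of fun i j => (Fintype.card u : ℂ) * ∑ w, M (i, w) (j, w)
      - ∑ x, ∑ y, M (i, (x, f x)) (j, (y, f y)) : Matrix p p ℂ).PosSemidef := by
  have h1 := (hM.submatrix fun z : p × u => (z.1, (z.2, f z.2))).card_smul_trace_block_sub_sum_block
  -- `h1` treats the points on the graph; the diagonal blocks off the graph are added here.
  have h2 := (Matrix.posSemidef_sum Finset.univ (fun w (_ : w ∈ Finset.univ) =>
    (hM.submatrix fun i : p => (i, w)).smul_ofReal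
      (show (0 : ℝ) ≤ if w.2 = f w.1 then 0 else 1 by split_ifs <;> simp))).smul_ofReal
      (Nat.cast_nonneg (Fintype.card u))
  convert h1.add h2 using 1
  ext i j
  have h3 : ∑ w : u × v, (((if w.2 = f w.1 then 0 else 1 : ℝ) : ℝ) : ℂ) * M (i, w) (j, w) =
      ∑ w, M (i, w) (j, w) - ∑ x, M (i, (x, f x)) (j, (x, f x)) := by
    rw [eq_sub_iff_add_eq]
    have : ∑ x, M (i, (x, f x)) (j, (x, f x)) =
        ∑ w : u × v, if w.2 = f w.1 then M (i, w) (j, w) else 0 := by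
      rw [Fintype.sum_prod_type]
      simp
    rw [this, ← Finset.sum_add_distrib]
    refine Finset.sum_congr rfl fun w _ => ?_
    split_ifs <;> simp
  simp only [Matrix.add_apply, Matrix.smul_apply, Matrix.sum_apply, of_apply, submatrix_apply,
    smul_eq_mul, h3]
  push_cast
  ring

/-! ### Linearity, positivity and trace preservation of N ↦ N ⊗ F^L -/

section BipTensor

variable {a₀ a₁ b₀ b₁ : Type*}
  [Fintype a₀] [DecidableEq a₀] [Fintype a₁] [DecidableEq a₁]
  [Fintype b₀] [DecidableEq b₀] [Fintype b₁] [DecidableEq b₁]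

theorem posSemidef_choi_bipTensor_swap {N : LMap (a₀ × b₀) (a₁ × b₁)} (h : (choi N).PosSemidef)
    (L : ℕ) : (choi (bipTensor N (swapChannel L))).PosSemidef := by
  convert (h.submatrix (corePart (c := Fin L))).diag_conj swapVec using 1
  ext p q
  exact choi_bipTensor_swap N L p q

theorem IsChannel.bipTensor_swap {N : LMap (a₀ × b₀) (a₁ × b₁)} (h : IsChannel N) (L : ℕ) :
    IsChannel (bipTensor N (swapChannel L)) := by
  refine ⟨isCP_iff.2 (posSemidef_choi_bipTensor_swap (isCP_iff.1 h.1) L), isTP_iff.2 ?_⟩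
  rintro ⟨⟨i, c⟩, j, d⟩ ⟨⟨i', c'⟩, j', d'⟩
  have h1 := isTP_iff.1 h.2 (i, j) (i', j')
  rw [Fintype.sum_prod_type] at h1
  simp only [choi_bipTensor_swap, swapVec, leftPart, rightPart, corePart, Fintype.sum_prod_type,
    Prod.mk.injEq, apply_ite star, star_one, star_zero, ite_and, ite_mul, mul_ite, zero_mul,
    mul_zero, one_mul, mul_one]
  by_cases hc : c = c'
  · subst hc
    by_cases hd : d = d'
    · subst hd
      simp [Finset.sum_ite_irrel]
      simpa [ite_and] using h1
    · simp [hd, Ne.symm hd]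
  · simp [hc]

theorem bipTensor_add (N M : LMap (a₀ × b₀) (a₁ × b₁)) (L : ℕ) :
    bipTensor (N + M) (swapChannel L) =
      bipTensor N (swapChannel L) + bipTensor M (swapChannel L) := by
  apply choi_injective
  ext p q
  simp [choi_bipTensor_swap, mul_add, add_mul]

theorem bipTensor_sub (N M : LMap (a₀ × b₀) (a₁ × b₁)) (L : ℕ) :
    bipTensor (N - M) (swapChannel L) =
      bipTensor N (swapChannel L) - bipTensor M (swapChannel L) := by
  apply choi_injective
  ext p q
  simp [choi_bipTensor_swap, mul_sub, sub_mul]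

theorem bipTensor_smul (t : ℂ) (N : LMap (a₀ × b₀) (a₁ × b₁)) (L : ℕ) :
    bipTensor (t • N) (swapChannel L) = t • bipTensor N (swapChannel L) := by
  apply choi_injective
  ext p q
  simp [choi_bipTensor_swap]
  ring

theorem choi_bipTensor_swapChannel (K L : ℕ)
    (p q : ((Fin K × Fin L) × (Fin K × Fin L)) × ((Fin K × Fin L) × (Fin K × Fin L))) :
    choi (bipTensor (swapChannel K) (swapChannel L)) p q =
      (if p.2 = p.1.swap then 1 else 0) * (if q.2 = q.1.swap then 1 else 0) := by
  rw [choi_bipTensor_swap, choi_swapChannel]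
  have h : ∀ p : ((Fin K × Fin L) × (Fin K × Fin L)) × ((Fin K × Fin L) × (Fin K × Fin L)),
      (if p.2 = p.1.swap then (1 : ℂ) else 0) =
        swapVec p * (if (corePart p).1 = (corePart p).2.swap then 1 else 0) := by
    rintro ⟨⟨⟨_, _⟩, _, _⟩, ⟨_, _⟩, _, _⟩
    simp only [swapVec, leftPart, rightPart, corePart, Prod.mk.injEq, Prod.swap_prod_mk,
      ← ite_and, ite_mul, one_mul, zero_mul]
    congr 1
    rw [eq_iff_iff]
    constructor <;> (intro h; simp_all)
  rw [h, h]
  simp only [swapVec, apply_ite star, star_one, star_zero]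
  ring

end BipTensor

/-! ### The swap-test superchannel -/

section SwapTest

variable {d y₀ y₁ : Type*} [Fintype d] [DecidableEq d] [Fintype y₀] [DecidableEq y₀]
  [Fintype y₁] [DecidableEq y₁]

/-- The overlap of a map with the swap channel. -/
def swapOverlap : LMap (d × d) (d × d) →ₗ[ℂ] ℂ where
  toFun E := ((Fintype.card d : ℂ) ^ 4)⁻¹ *
    ∑ u : d × d, ∑ u' : d × d, choi E (u, u.swap) (u', u'.swap)
  map_add' E F := by simp [Finset.sum_add_distrib, mul_add]
  map_smul' c E := by
    simp only [choi_smul, Matrix.smul_apply, smul_eq_mul, ← Finset.mul_sum, RingHom.id_apply]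
    ring

/-- The normalised trace of the Choi matrix. -/
def choiTrace : LMap (d × d) (d × d) →ₗ[ℂ] ℂ where
  toFun E := ((Fintype.card d : ℂ) ^ 2)⁻¹ * ∑ w, choi E w w
  map_add' E F := by simp [Finset.sum_add_distrib, mul_add]
  map_smul' c E := by
    simp only [choi_smul, Matrix.smul_apply, smul_eq_mul, ← Finset.mul_sum, RingHom.id_apply]
    ring

/-- The supermap that tests for the swap channel, and prepares `P` or `X`. -/
def swapTest (P X : LMap y₀ y₁) : Supermap (d × d) (d × d) y₀ y₁ :=
  swapOverlap.smulRight P + (choiTrace - swapOverlap).smulRight X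

theorem swapTest_apply (P X : LMap y₀ y₁) (E : LMap (d × d) (d × d)) :
    swapTest P X E = swapOverlap E • P + (choiTrace E - swapOverlap E) • X := rfl

theorem choiTrace_eq_one [Nonempty d] {E : LMap (d × d) (d × d)} (hE : IsTP E) :
    choiTrace E = 1 := by
  have h : ∑ w, choi E w w = (Fintype.card d : ℂ) ^ 2 := by
    rw [Fintype.sum_prod_type]
    have := fun i => isTP_iff.1 hE i i
    simp only [if_true] at this
    simp [this, sq]
  have hd : (Fintype.card d : ℂ) ≠ 0 := by exact_mod_cast Fintype.card_ne_zero
  simp only [choiTrace, LinearMap.coe_mk, AddHom.coe_mk, h]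
  field_simp

theorem choi_coeff {r₀ r₁ x₀ x₁ : Type*} [DecidableEq r₀] [DecidableEq x₀]
    (Ψ : LMap (r₀ × x₀) (r₁ × x₁)) (i j : r₀) (k l : r₁) (s t : x₀ × x₁) :
    choi (Ψ.coeff i j k l) s t = choi Ψ ((i, s.1), (k, s.2)) ((j, t.1), (l, t.2)) := by
  rw [choi_apply, choi_apply]
  simp only [LMap.coeff, LinearMap.coe_mk, AddHom.coe_mk, of_apply]
  rw [Matrix.single_kronecker_single]
  simp

theorem choi_extend {r₀ r₁ x₀ x₁ : Type*} [Fintype r₀] [DecidableEq r₀] [Fintype r₁]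
    [DecidableEq r₁] [Fintype x₀] [DecidableEq x₀] (Θ : Supermap x₀ x₁ y₀ y₁)
    (Ψ : LMap (r₀ × x₀) (r₁ × x₁)) (s t : (r₀ × y₀) × (r₁ × y₁)) :
    choi (Θ.extend Ψ) s t = choi (Θ (Ψ.coeff s.1.1 t.1.1 s.2.1 t.2.1)) (s.1.2, s.2.2)
      (t.1.2, t.2.2) := by
  have h1 : choi (Θ.extend Ψ) s t = ∑ i, ∑ j, ∑ k, ∑ l,
      choi (LMap.tensor (unitMap i j k l) (Θ (Ψ.coeff i j k l))) s t := by
    simp only [choi_apply, Supermap.extend, LinearMap.sum_apply, Matrix.sum_apply]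
  have h2 : ∀ (i j : r₀) (k l : r₁), choi (unitMap i j k l) (s.1.1, s.2.1) (t.1.1, t.2.1) =
      if i = s.1.1 then (if j = t.1.1 then (if k = s.2.1 then (if l = t.2.1 then 1 else 0) else 0)
        else 0) else 0 := by
    intro i j k l
    simp only [choi_apply, unitMap, LinearMap.coe_mk, AddHom.coe_mk, Matrix.smul_apply,
      Matrix.single_apply, smul_eq_mul, ite_and]
    split_ifs <;> simp_all
  rw [h1]
  simp only [choi_tensor, h2, ite_mul, zero_mul, one_mul]
  simp

/-- Both coefficients are completely positive functionals of the Choi matrix: the overlap with the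
normalised swap vector, and the trace minus that overlap. On trace-preserving maps they sum to 1, so
the output is an affine combination of P and X. -/
theorem isSuperchannel_swapTest [Nonempty d] {P X : LMap y₀ y₁} (hP : IsChannel P)
    (hX : IsChannel X) : IsSuperchannel (swapTest (d := d) P X) := by
  constructor
  · intro m n Ψ hΨ
    rw [isCP_iff] at hΨ ⊢
    have hd : (0 : ℝ) < Fintype.card d := by exact_mod_cast Fintype.card_pos
    have hdc : (Fintype.card d : ℂ) ≠ 0 := by exact_mod_cast hd.ne'
    have h1 := (hΨ.submatrix fun z : (Fin m × Fin n) × (d × d) =>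
      ((z.1.1, z.2), (z.1.2, z.2.swap))).sum_block.smul_ofReal
      (show (0 : ℝ) ≤ ((Fintype.card d : ℝ) ^ 4)⁻¹ by positivity)
    have h2 := ((hΨ.submatrix fun z : (Fin m × Fin n) × ((d × d) × (d × d)) =>
      ((z.1.1, z.2.1), (z.1.2, z.2.2))).card_smul_trace_block_sub_sum_graph Prod.swap).smul_ofReal
      (show (0 : ℝ) ≤ ((Fintype.card d : ℝ) ^ 4)⁻¹ by positivity)
    have h3 := ((h1.kronecker (isCP_iff.1 hP.1)).add (h2.kronecker (isCP_iff.1 hX.1))).submatrix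
      (fun s : (Fin m × y₀) × (Fin n × y₁) => ((s.1.1, s.2.1), (s.1.2, s.2.2)))
    refine (congrArg Matrix.PosSemidef (Matrix.ext fun s t => ?_)).mpr h3
    rw [choi_extend, swapTest_apply]
    simp only [choi_add, choi_smul, Matrix.add_apply, Matrix.smul_apply, submatrix_apply,
      kroneckerMap_apply, of_apply, smul_eq_mul, swapOverlap, choiTrace, LinearMap.coe_mk,
      AddHom.coe_mk, choi_coeff, Fintype.card_prod]
    push_cast
    congr 2
    field_simp
  · intro E hE Z
    rw [swapTest_apply, choiTrace_eq_one hE]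
    exact hP.2.convexComb hX.2 (by ring) Z

theorem swapOverlap_nonneg {E : LMap (d × d) (d × d)} (hE : (choi E).PosSemidef) :
    0 ≤ (swapOverlap E).re ∧ (swapOverlap E).im = 0 := by
  have h := ((hE.submatrix fun z : Unit × (d × d) => (z.2, z.2.swap)).sum_block.smul_ofReal
      (show (0 : ℝ) ≤ ((Fintype.card d : ℝ) ^ 4)⁻¹ by positivity)).diag_nonneg (i := ())
  simp only [Matrix.smul_apply, of_apply, submatrix_apply, smul_eq_mul] at h
  push_cast at h
  rw [Complex.le_def] at h
  exact ⟨h.1, h.2.symm⟩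

/-- Cauchy–Schwarz for each product Kraus operator: its squared overlap with the swap is at most its
Hilbert–Schmidt weight, and these weights total |d|² by trace preservation, against the
normalisation |d|⁴. -/
theorem IsSepChannel.swapOverlap_le [Nonempty d] {E : LMap (d × d) (d × d)} (hE : IsSepChannel E) :
    (swapOverlap E).re * (Fintype.card d : ℝ) ^ 2 ≤ 1 := by
  obtain ⟨n, A, B, hAB⟩ := hE.exists_kraus
  have hd : (0 : ℝ) < Fintype.card d := by exact_mod_cast Fintype.card_pos
  have h1 : ∑ w, choi E w w = (Fintype.card d : ℂ) ^ 2 := by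
    rw [Fintype.sum_prod_type]
    have := fun i => isTP_iff.1 hE.1.2 i i
    simp only [if_true] at this
    simp [this, sq]
  have h2 : ∑ w, choi E w w = ∑ k, (∑ u : d × d, A k u.2 u.1 * star (A k u.2 u.1)) *
      (∑ v : d × d, B k v.1 v.2 * star (B k v.1 v.2)) := by
    simp only [hAB]
    rw [Finset.sum_comm]
    refine Finset.sum_congr rfl fun k _ => ?_
    simp only [prodVec, star_mul', Fintype.sum_prod_type, Finset.sum_mul_sum]
    refine Finset.sum_congr rfl fun i _ => ?_
    rw [Finset.sum_congr rfl fun j _ => Finset.sum_comm, Finset.sum_comm]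
    refine Finset.sum_congr rfl fun b _ => ?_
    rw [Finset.sum_comm]
    refine Finset.sum_congr rfl fun a _ => Finset.sum_congr rfl fun j _ => by ring
  have h3 : ∑ u : d × d, ∑ u' : d × d, choi E (u, u.swap) (u', u'.swap) =
      ∑ k, (∑ u : d × d, A k u.2 u.1 * B k u.1 u.2) *
        star (∑ u : d × d, A k u.2 u.1 * B k u.1 u.2) := by
    simp only [hAB, star_sum, Finset.sum_mul_sum]
    rw [Finset.sum_congr rfl fun s _ => Finset.sum_comm, Finset.sum_comm]
    rfl
  have h4 : (∑ u : d × d, ∑ u' : d × d, choi E (u, u.swap) (u', u'.swap)).re ≤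
      (Fintype.card d : ℝ) ^ 2 := by
    have : ((Fintype.card d : ℂ) ^ 2).re = (Fintype.card d : ℝ) ^ 2 := by norm_cast
    rw [← this, ← h1, h2, h3, Complex.re_sum, Complex.re_sum]
    exact Finset.sum_le_sum fun k _ => norm_sum_mul_sq_le (fun u : d × d => A k u.2 u.1)
      (fun u : d × d => B k u.1 u.2)
  have h5 : (swapOverlap E).re = ((Fintype.card d : ℝ) ^ 4)⁻¹ *
      (∑ u : d × d, ∑ u' : d × d, choi E (u, u.swap) (u', u'.swap)).re := by
    simp only [swapOverlap, LinearMap.coe_mk, AddHom.coe_mk]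
    rw [← Complex.re_ofReal_mul]
    push_cast
    rfl
  rw [h5]
  calc _ ≤ ((Fintype.card d : ℝ) ^ 4)⁻¹ * (Fintype.card d : ℝ) ^ 2 * (Fintype.card d : ℝ) ^ 2 := by
        gcongr
    _ = 1 := by field_simp

end SwapTest

/-! ### Simulations from domination by a separable channel -/

section Cost

variable {a₀ a₁ b₀ b₁ : Type*}
  [Fintype a₀] [DecidableEq a₀] [Fintype a₁] [DecidableEq a₁]
  [Fintype b₀] [DecidableEq b₀] [Fintype b₁] [DecidableEq b₁]

/-- If `P ≤ μ T` with `T` separable and `μ = |d|²`, the swap test with outputs `P` and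
`(μ T - P) / (μ - 1)` preserves separability up to `δ`. -/
theorem exists_isDeltaSEPPSC {d : Type*} [Fintype d] [DecidableEq d] [Nonempty d] {δ : ℝ}
    (hδ : 0 < δ) (hd : 1 + 1 / δ ≤ (Fintype.card d : ℝ) ^ 2) {P : LMap (a₀ × b₀) (a₁ × b₁)}
    (hP : IsChannel P) (h : SepDom ((Fintype.card d : ℝ) ^ 2) P) :
    ∃ X : LMap (a₀ × b₀) (a₁ × b₁), IsDeltaSEPPSC δ (swapTest (d := d) P X) := by
  obtain ⟨T, hT, h⟩ := h
  set μ : ℝ := (Fintype.card d : ℝ) ^ 2 with hμ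
  have hμ1 : 0 < μ - 1 := by
    have : 0 < 1 / δ := by positivity
    linarith
  have hμc : ((μ : ℂ) - 1) ≠ 0 := by exact_mod_cast hμ1.ne'
  let X : LMap (a₀ × b₀) (a₁ × b₁) := (((μ - 1)⁻¹ : ℝ) : ℂ) • ((μ : ℂ) • T - P)
  have hX : IsChannel X := by
    refine ⟨isCP_iff.2 (h.smul_ofReal (inv_nonneg.2 hμ1.le)), fun Z => ?_⟩
    simp only [X, LinearMap.smul_apply, LinearMap.sub_apply, trace_smul, trace_sub, hP.2 Z,
      hT.1.2 Z, smul_eq_mul]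
    push_cast
    field_simp
  refine ⟨X, isSuperchannel_swapTest hP hX, fun E hE => ?_⟩
  have hsc := (isSuperchannel_swapTest (d := d) hP hX).2 E hE.1.2
  refine robustness_le hsc hδ.le ⟨T, hT, ?_⟩
  obtain ⟨h0, him⟩ := swapOverlap_nonneg hE.posSemidef
  have h1 := hE.swapOverlap_le
  rw [← hμ] at h1
  set p : ℝ := (swapOverlap E).re with hp
  have hpc : swapOverlap E = (p : ℂ) := Complex.ext (by simp [hp]) (by simp [him])
  have e1 : 0 ≤ (1 - p * μ) * (μ - 1)⁻¹ :=
    mul_nonneg (by linarith) (inv_nonneg.2 hμ1.le)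
  have e2 : 0 ≤ (1 + δ) - (1 - p) * μ * (μ - 1)⁻¹ := by
    have h5 : (1 - p) * μ * (μ - 1)⁻¹ ≤ μ * (μ - 1)⁻¹ := by
      refine mul_le_mul_of_nonneg_right ?_ (inv_nonneg.2 hμ1.le)
      nlinarith
    have h6 : μ * (μ - 1)⁻¹ = 1 + (μ - 1)⁻¹ := by field_simp; ring
    have h7 : (μ - 1)⁻¹ ≤ δ := by
      rw [inv_le_comm₀ hμ1 hδ, ← one_div]
      linarith
    linarith
  -- Writing p for the overlap, (1+δ)T − Θ[E] has T-coefficient 1+δ − (1−p)μ/(μ−1) and P-coefficient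
  -- (1−pμ)/(μ−1). The second is nonnegative since pμ ≤ 1, the first since p ≥ 0 and 1/(μ−1) ≤ δ.
  convert (hT.posSemidef.smul_ofReal e2).add ((isCP_iff.1 hP.1).smul_ofReal e1) using 1
  rw [swapTest_apply, choiTrace_eq_one hE.1.2, hpc]
  ext s t
  simp only [X, choi_add, choi_smul, choi_sub, Matrix.sub_apply, Matrix.smul_apply,
    Matrix.add_apply, smul_eq_mul]
  push_cast
  field_simp
  ring

/-- F^K ⊗ F^L is itself the swap of dimension KL, so it passes the test with certainty and the
prepared output is exactly N' ⊗ F^L. -/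
theorem mem_catalyticCostSet {δ ε : ℝ} (hδ : 0 < δ) {K L : ℕ} (hK : 0 < K) (hL : 0 < L)
    (hLδ : 1 + 1 / δ ≤ (L : ℝ) ^ 2) {N N' : LMap (a₀ × b₀) (a₁ × b₁)} (hN' : IsChannel N')
    (hNN' : DiamondClose ε N' N)
    (h : SepDom ((K : ℝ) ^ 2 * L ^ 2) (bipTensor N' (swapChannel L))) :
    Real.logb 2 ((K : ℝ) ^ 2) ∈ catalyticCostSet δ ε N := by
  have : NeZero K := ⟨hK.ne'⟩
  have : NeZero L := ⟨hL.ne'⟩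
  have hc : (Fintype.card (Fin K × Fin L) : ℝ) ^ 2 = (K : ℝ) ^ 2 * L ^ 2 := by
    simp only [Fintype.card_prod, Fintype.card_fin]
    push_cast
    ring
  have hd : 1 + 1 / δ ≤ (Fintype.card (Fin K × Fin L) : ℝ) ^ 2 := by
    rw [hc]
    have hK1 : (1 : ℝ) ≤ K := by exact_mod_cast hK
    exact hLδ.trans (le_mul_of_one_le_left (sq_nonneg _) (one_le_pow₀ hK1))
  obtain ⟨X, hX⟩ := exists_isDeltaSEPPSC (d := Fin K × Fin L) hδ hd (hN'.bipTensor_swap L)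
    (by rwa [hc])
  refine ⟨K, L, hK, hL, _, hX, N', hN', hNN', ?_, rfl⟩
  have h1 : swapOverlap (bipTensor (swapChannel K) (swapChannel L)) = 1 := by
    simp only [swapOverlap, LinearMap.coe_mk, AddHom.coe_mk, choi_bipTensor_swapChannel, if_true,
      one_mul, Finset.sum_const, Finset.card_univ, Fintype.card_prod, Fintype.card_fin, nsmul_eq_mul]
    have h2 : (K : ℂ) ≠ 0 := by exact_mod_cast hK.ne'
    have h3 : (L : ℂ) ≠ 0 := by exact_mod_cast hL.ne'
    push_cast
    field_simp
  have h2 : choiTrace (bipTensor (swapChannel K) (swapChannel L)) = 1 := by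
    have h4 : ∑ w : ((Fin K × Fin L) × (Fin K × Fin L)) × ((Fin K × Fin L) × (Fin K × Fin L)),
        choi (bipTensor (swapChannel K) (swapChannel L)) w w = ((K : ℂ) * L) ^ 2 := by
      rw [Fintype.sum_prod_type]
      simp [choi_bipTensor_swapChannel]
      ring
    simp only [choiTrace, LinearMap.coe_mk, AddHom.coe_mk, h4, Fintype.card_prod, Fintype.card_fin]
    have h2 : (K : ℂ) ≠ 0 := by exact_mod_cast hK.ne'
    have h3 : (L : ℂ) ≠ 0 := by exact_mod_cast hL.ne'
    push_cast
    field_simp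
  rw [swapTest_apply, h1, h2, one_smul, sub_self, zero_smul, add_zero]

end Cost

/-! ### Superchannels preserve the completely positive order -/

section Superchannel

variable {x₀ x₁ y₀ y₁ : Type*} [Fintype x₀] [DecidableEq x₀] [Fintype x₁] [DecidableEq x₁]
  [Fintype y₀] [DecidableEq y₀] [Fintype y₁] [DecidableEq y₁]

theorem IsSuperchannel.posSemidef {Θ : Supermap x₀ x₁ y₀ y₁} (hΘ : IsSuperchannel Θ)
    {E : LMap x₀ x₁} (hE : (choi E).PosSemidef) : (choi (Θ E)).PosSemidef := by
  have hid : ∀ s t : Fin 1 × Fin 1, choi (LinearMap.id : LMap (Fin 1) (Fin 1)) s t = 1 := by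
    intro s t
    rw [choi_apply, LinearMap.id_apply, Matrix.single_apply,
      if_pos ⟨Subsingleton.elim _ _, Subsingleton.elim _ _⟩]
  have h1 : IsCP (LMap.tensor (LinearMap.id : LMap (Fin 1) (Fin 1)) E) := by
    rw [isCP_iff]
    convert hE.submatrix (fun s : (Fin 1 × x₀) × (Fin 1 × x₁) => (s.1.2, s.2.2)) using 1
    ext s t
    rw [choi_tensor, hid, one_mul]
    rfl
  have h2 := hΘ.1 1 1 _ h1
  rw [Supermap.extend_tensor, isCP_iff] at h2
  convert h2.submatrix (fun s : y₀ × y₁ => ((0, s.1), (0, s.2))) using 1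
  ext s t
  rw [submatrix_apply, choi_tensor, hid, one_mul]

theorem IsSuperchannel.isChannel {Θ : Supermap x₀ x₁ y₀ y₁} (hΘ : IsSuperchannel Θ)
    {E : LMap x₀ x₁} (hE : IsChannel E) : IsChannel (Θ E) :=
  ⟨isCP_iff.2 (hΘ.posSemidef (isCP_iff.1 hE.1)), hΘ.2 E hE.2⟩

end Superchannel

/-- The dephased swap channel is separable and dominates the swap channel up to a factor `|d|²`. -/
theorem exists_isSepChannel_ge_swap (d : Type*) [Fintype d] [DecidableEq d] :
    ∃ T : LMap (d × d) (d × d), IsSepChannel T ∧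
      (((Fintype.card d : ℝ) ^ 2 : ℝ) • choi T - Matrix.of fun p q : (d × d) × (d × d) =>
        (if p.2 = p.1.swap then (1 : ℂ) else 0) * (if q.2 = q.1.swap then 1 else 0)).PosSemidef := by
  let w : d × d → (d × d) × (d × d) → ℂ := fun k p => if p = (k, k.swap) then 1 else 0
  have hww : ∀ p q, ∑ k, w k p * star (w k q) =
      if p = q ∧ p.2 = p.1.swap then 1 else 0 := by
    rintro ⟨p, p'⟩ ⟨q, q'⟩
    simp only [w, apply_ite star, star_one, star_zero, mul_ite, mul_one, mul_zero, ← ite_and,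
      Prod.mk.injEq]
    rw [Finset.sum_eq_single p]
    · congr 1
      rw [eq_iff_iff]
      constructor <;> (rintro ⟨⟨h1, h2⟩, h3⟩; subst_vars; simp_all)
    · intro b _ hb
      rw [if_neg]
      rintro ⟨-, h, -⟩
      exact hb h.symm
    · simp
  let T : LMap (d × d) (d × d) := ofChoi (Matrix.of fun p q => ∑ k, w k p * star (w k q))
  refine ⟨T, isSepChannel_of_choi ?_ (fun k : d × d => Matrix.single k.2 k.1 1)
    (fun k : d × d => Matrix.single k.1 k.2 1) ?_, ?_⟩
  · rw [isTP_iff]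
    intro i j
    simp only [T, choi_ofChoi, of_apply, hww, Prod.mk.injEq, and_true]
    rw [Finset.sum_eq_single i.swap]
    · simp
    · intro b _ hb
      simp [hb]
    · simp
  · have e : ∀ (k : d × d) p,
        prodVec (Matrix.single k.2 k.1 (1 : ℂ)) (Matrix.single k.1 k.2 1) p = w k p := by
      rintro ⟨i, j⟩ ⟨⟨_, _⟩, _, _⟩
      simp only [prodVec, Matrix.single_apply, w, Prod.mk.injEq, Prod.swap_prod_mk, ← ite_and,
        ite_mul, one_mul, zero_mul]
      congr 1
      grind
    intro p q
    simp only [T, choi_ofChoi, of_apply, e]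
  · have hsum : ∀ p, ∑ k, w k p = if p.2 = p.1.swap then 1 else 0 := by
      rintro ⟨p, p'⟩
      simp only [w, Prod.mk.injEq]
      rw [Finset.sum_eq_single p] <;> simp +contextual [eq_comm]
    have h := posSemidef_card_smul_gram_sub w
    convert h using 1
    ext p q
    simp only [T, choi_ofChoi, Matrix.sub_apply, Matrix.smul_apply, of_apply, hsum, Complex.real_smul,
      Fintype.card_prod, apply_ite star, star_one, star_zero]
    push_cast
    ring

theorem DiamondLE.norm_trace_le_mul {x y : Type*} [Fintype x] [DecidableEq x] [Fintype y]
    [DecidableEq y] {c : ℝ} {Δ : LMap x y} (h : DiamondLE c Δ) (v : x → ℂ) :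
    ‖(Δ (vecMulVec v (star v))).trace‖ ≤ c * ∑ i, ‖v i‖ ^ 2 := by
  set s : ℝ := ∑ i, ‖v i‖ ^ 2 with hs
  have hs0 : 0 ≤ s := by positivity
  rcases hs0.eq_or_lt with h0 | h0
  · have hv : v = 0 := by
      ext i
      have := (Finset.sum_eq_zero_iff_of_nonneg (fun i _ => sq_nonneg ‖v i‖)).1 h0.symm i
        (Finset.mem_univ i)
      simpa using this
    simp [hv, ← h0]
  · have hs1 : (0 : ℝ) < √s := Real.sqrt_pos.2 h0
    have h1 := h.norm_trace_le (fun i => (((√s)⁻¹ : ℝ) : ℂ) * v i) (by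
      simp only [norm_mul, Complex.norm_real, mul_pow, ← Finset.mul_sum, ← hs, Real.norm_eq_abs,
        sq_abs, inv_pow, Real.sq_sqrt hs0]
      exact inv_mul_cancel₀ h0.ne')
    have h2 : vecMulVec (fun i => (((√s)⁻¹ : ℝ) : ℂ) * v i)
        (star fun i => (((√s)⁻¹ : ℝ) : ℂ) * v i) = ((s⁻¹ : ℝ) : ℂ) • vecMulVec v (star v) := by
      have hss : ((s⁻¹ : ℝ) : ℂ) = (((√s)⁻¹ : ℝ) : ℂ) * (((√s)⁻¹ : ℝ) : ℂ) := by
        rw [← Complex.ofReal_mul, ← mul_inv, Real.mul_self_sqrt hs0]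
      ext i j
      rw [Matrix.smul_apply, hss]
      simp only [vecMulVec_apply, Pi.star_apply, star_mul', Complex.star_def, Complex.conj_ofReal,
        smul_eq_mul]
      ring
    rw [h2, map_smul, trace_smul, norm_smul, Complex.norm_real, Real.norm_of_nonneg
      (inv_nonneg.2 hs0), inv_mul_le_iff₀ h0] at h1
    linarith

/-! ### The lower bound on the cost -/

section Bounds

variable {a₀ a₁ b₀ b₁ : Type*}
  [Fintype a₀] [DecidableEq a₀] [Fintype a₁] [DecidableEq a₁] [Nonempty a₁]
  [Fintype b₀] [DecidableEq b₀] [Fintype b₁] [DecidableEq b₁] [Nonempty b₁]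

theorem smoothLogRobustness_le {ε : ℝ} {N N' : LMap (a₀ × b₀) (a₁ × b₁)} (hN' : IsChannel N')
    (h : DiamondClose ε N' N) : smoothLogRobustness ε N ≤ logRobustness N' := by
  refine csInf_le ⟨0, ?_⟩ ⟨N', hN', h, rfl⟩
  rintro _ ⟨M, -, -, rfl⟩
  exact Real.logb_nonneg one_lt_two (by linarith [robustness_nonneg M])

theorem DiamondClose.bipTensor_swap {ε : ℝ} (hε : 0 ≤ ε) {N N' : LMap (a₀ × b₀) (a₁ × b₁)}
    (h : DiamondClose ε N' N) (L : ℕ) :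
    DiamondClose ε (bipTensor N' (swapChannel L)) (bipTensor N (swapChannel L)) := by
  rw [diamondClose_iff hε] at h ⊢
  rw [← bipTensor_sub]
  exact h.bipTensor_swap L

theorem diamondClose_self {x y : Type*} [Fintype x] [DecidableEq x] [Fintype y] [DecidableEq y]
    {ε : ℝ} (hε : 0 ≤ ε) (N : LMap x y) : DiamondClose ε N N := by
  rw [diamondClose_iff hε, sub_self]
  intro r Z _
  have h1 : LMap.tensor (LinearMap.id : LMap (Fin r) (Fin r)) (0 : LMap x y) Z = 0 := by
    ext s t
    simp [tensor_id_apply, choi_apply]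
  rw [h1]
  have h := traceNorm_sum_le (∅ : Finset Unit) (fun _ => (0 : Matrix (Fin r × y) (Fin r × y) ℂ))
  simp only [Finset.sum_empty] at h
  linarith

/-- The converse bound, for a simulation with an arbitrary catalyst. -/
theorem smoothLogRobustness_le_of_mem {L : ℕ} [NeZero L]
    (hL : Fintype.card (a₀ × a₁) + Fintype.card (b₀ × b₁) ≤ L ^ 2) {δ ε : ℝ} (hδ : 0 < δ)
    (hε : 0 ≤ ε) (N : LMap (a₀ × b₀) (a₁ × b₁)) {e : ℝ} (he : e ∈ catalyticCostSet δ ε N) :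
    smoothLogRobustness ε (bipTensor N (swapChannel L))
      - Real.logb 2 ((L : ℝ) ^ 2) - Real.logb 2 (1 + δ) ≤ e := by
  obtain ⟨K, M, hK, hM, Θ, ⟨hΘ, hδΘ⟩, N', hN', hNN', hsim, rfl⟩ := he
  have : NeZero M := ⟨hM.ne'⟩
  have hK0 : (1 : ℝ) ≤ K := by exact_mod_cast hK
  have hL0 : (1 : ℝ) ≤ L := by exact_mod_cast NeZero.pos L
  have hM0 : (0 : ℝ) < M := by exact_mod_cast hM
  obtain ⟨T, hT, hTF⟩ := exists_isSepChannel_ge_swap (Fin K × Fin M)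
  set c : ℝ := (Fintype.card (Fin K × Fin M) : ℝ) ^ 2 with hc
  have hcKM : c = (K : ℝ) ^ 2 * M ^ 2 := by
    rw [hc, Fintype.card_prod, Fintype.card_fin, Fintype.card_fin]
    push_cast
    ring
  have hc0 : 0 < c := by rw [hcKM]; positivity
  -- The robustness is an infimum not known to be attained, hence the slack η.
  have hdom : ∀ η : ℝ, 0 < η →
      SepDom ((K : ℝ) ^ 2 * L ^ 2 * (1 + δ + η)) (bipTensor N' (swapChannel L)) := by
    intro η hη
    have h1 : SepDom (1 + (δ + η)) (Θ T) :=
      sepDom_of_robustness_lt (hΘ.isChannel hT.1) ((hδΘ T hT).trans_lt (by linarith))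
    have h2 : SepDom (c * (1 + (δ + η))) (bipTensor N' (swapChannel M)) := by
      -- Θ applied to cT − F^K ⊗ F^M is completely positive, so N' ⊗ F^M ≤ cΘ[T].
      refine (h1.smul hc0.le).of_le ?_
      rw [← hsim, ← choi_sub, ← map_smul, ← map_sub]
      refine hΘ.posSemidef ?_
      convert hTF using 1
      ext p q
      rw [choi_sub, choi_smul, Matrix.sub_apply, Matrix.sub_apply, choi_bipTensor_swapChannel]
      rfl
    have h3 := h2.transfer (L := L) hL (by positivity) N' (by
      rw [collapse_bipTensor_swap, sub_self]; exact PosSemidef.zero)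
    convert h3 using 1
    rw [hcKM]
    field_simp
    ring
  have hrob : 1 + robustness (bipTensor N' (swapChannel L)) ≤ (K : ℝ) ^ 2 * L ^ 2 * (1 + δ) := by
    refine le_of_forall_pos_le_add fun η hη => ?_
    have hKL : (1 : ℝ) ≤ (K : ℝ) ^ 2 * L ^ 2 :=
      one_le_mul_of_one_le_of_one_le (one_le_pow₀ hK0) (one_le_pow₀ hL0)
    have h1 := hdom (η / ((K : ℝ) ^ 2 * L ^ 2)) (by positivity)
    have h2 : (K : ℝ) ^ 2 * L ^ 2 * (1 + δ + η / ((K : ℝ) ^ 2 * L ^ 2)) =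
        (K : ℝ) ^ 2 * L ^ 2 * (1 + δ) + η := by
      field_simp
    rw [h2] at h1
    have h3 := robustness_le (s := (K : ℝ) ^ 2 * L ^ 2 * (1 + δ) + η - 1)
      (hN'.bipTensor_swap L).2 (by nlinarith) (by convert h1 using 1; ring)
    linarith
  have hsm := smoothLogRobustness_le (hN'.bipTensor_swap L) (hNN'.bipTensor_swap hε L)
  have hlog : logRobustness (bipTensor N' (swapChannel L)) ≤
      Real.logb 2 ((K : ℝ) ^ 2) + Real.logb 2 ((L : ℝ) ^ 2) + Real.logb 2 (1 + δ) := by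
    rw [logRobustness, ← Real.logb_mul (by positivity) (by positivity),
      ← Real.logb_mul (by positivity) (by positivity)]
    exact Real.logb_le_logb_of_le one_lt_two
      (by linarith [robustness_nonneg (bipTensor N' (swapChannel L))]) hrob
  linarith

end Bounds

/-! ### Completing a trace-nonincreasing map to a channel -/

section Completion

variable {x y : Type*} [Fintype x] [DecidableEq x] [Fintype y] [DecidableEq y]

/-- The dual map evaluated at the identity, transposed: the input marginal of the Choi matrix. -/
def marginal (P : LMap x y) : Matrix x x ℂ :=
  Matrix.of fun i j => ∑ a, choi P (i, a) (j, a)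

theorem posSemidef_marginal_sub {P N : LMap x y} (hP : (choi P).PosSemidef) (hN : IsTP N) {η : ℝ}
    (h : DiamondLE η (P - N)) : (marginal P - ((1 - η : ℝ) : ℂ) • 1).PosSemidef := by
  have hσ : (marginal P).PosSemidef := hP.trace_block
  refine PosSemidef.of_dotProduct_mulVec_nonneg
    (hσ.isHermitian.sub (by simp [IsHermitian, conjTranspose_smul])) fun v => ?_
  -- Trace deviation on pure inputs controls the quadratic form; v is conjugated because `marginal`
  -- is a transpose.
  have h1 := h.norm_trace_le_mul (star v)
  set n : ℝ := ∑ i, ‖v i‖ ^ 2 with hn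
  have hvv : star v ⬝ᵥ v = (n : ℂ) := by
    rw [hn, Complex.ofReal_sum, dotProduct]
    refine Finset.sum_congr rfl fun i _ => ?_
    rw [Pi.star_apply, mul_comm, Complex.star_def, Complex.mul_conj, Complex.normSq_eq_norm_sq]
  have hPv : (P (vecMulVec (star v) (star (star v)))).trace = star v ⬝ᵥ (marginal P *ᵥ v) := by
    simp only [Matrix.trace, diag_apply, apply_eq_sum_choi, dotProduct, mulVec, marginal, of_apply,
      Finset.mul_sum, Finset.sum_mul, vecMulVec_apply, star_star]
    rw [Finset.sum_comm]
    refine Finset.sum_congr rfl fun i _ => ?_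
    rw [Finset.sum_comm]
    refine Finset.sum_congr rfl fun j _ => Finset.sum_congr rfl fun a _ => ?_
    ring
  rw [LinearMap.sub_apply, trace_sub, hN, hPv, star_star, trace_vecMulVec, hvv] at h1
  have h2 := hσ.dotProduct_mulVec_nonneg v
  obtain ⟨r, hr⟩ : ∃ r : ℝ, star v ⬝ᵥ (marginal P *ᵥ v) = r :=
    ⟨_, Complex.ext rfl (Complex.nonneg_iff.1 h2).2.symm⟩
  have hsn : ∑ i, ‖star v i‖ ^ 2 = n := by simp [hn]
  rw [hr, hsn, ← Complex.ofReal_sub, Complex.norm_real, Real.norm_eq_abs] at h1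
  rw [sub_mulVec, dotProduct_sub, hr, smul_mulVec, one_mulVec, dotProduct_smul, hvv, smul_eq_mul,
    ← Complex.ofReal_mul, ← Complex.ofReal_sub]
  refine Complex.zero_le_real.2 ?_
  linarith [(abs_le.1 h1).1]

/-- A subnormalised completely positive map becomes a channel after adding a small multiple of the
depolarizing channel. -/
theorem exists_isChannel_add [Nonempty y] {P : LMap x y} (hP : (choi P).PosSemidef) {η : ℝ}
    (h1 : (1 - marginal P).PosSemidef) (h2 : (marginal P - ((1 - η : ℝ) : ℂ) • 1).PosSemidef) :
    ∃ Q : LMap x y, (choi Q).PosSemidef ∧ IsChannel (P + Q) ∧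
      (choi ((η : ℂ) • ofChoi ((((Fintype.card y : ℝ)⁻¹ : ℝ) : ℂ) • 1) : LMap x y)
        - choi Q).PosSemidef := by
  set c : ℝ := (Fintype.card y : ℝ)⁻¹ with hc
  have hc0 : 0 ≤ c := by positivity
  have hcc : (Fintype.card y : ℂ) * c = 1 := by
    rw [hc]
    push_cast
    exact mul_inv_cancel₀ (by exact_mod_cast Fintype.card_ne_zero)
  have hone : ((c : ℂ) • (1 : Matrix y y ℂ)).PosSemidef := PosSemidef.one.smul_ofReal hc0
  have hQ : ((1 - marginal P) ⊗ₖ ((c : ℂ) • (1 : Matrix y y ℂ))).PosSemidef := h1.kronecker hone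
  -- Q replaces the missing trace by the maximally mixed output, so 1 − marginal P ≤ η gives Q ≤ η
  -- times depolarizing.
  refine ⟨ofChoi ((1 - marginal P) ⊗ₖ ((c : ℂ) • 1)), by rwa [choi_ofChoi],
    ⟨isCP_iff.2 ?_, isTP_iff.2 fun i j => ?_⟩, ?_⟩
  · rw [choi_add, choi_ofChoi]
    exact hP.add hQ
  · simp only [choi_add, choi_ofChoi, Matrix.add_apply, Finset.sum_add_distrib, kronecker_apply,
      Matrix.smul_apply, Matrix.one_apply_eq, smul_eq_mul, mul_one, Finset.sum_const,
      Finset.card_univ, nsmul_eq_mul, Matrix.sub_apply, Matrix.one_apply, marginal, of_apply]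
    linear_combination ((if i = j then 1 else 0) - ∑ a, choi P (i, a) (j, a)) * hcc
  · have h3 : choi ((η : ℂ) • ofChoi ((c : ℂ) • 1) : LMap x y) - (1 - marginal P) ⊗ₖ ((c : ℂ) • 1) =
        (marginal P - ((1 - η : ℝ) : ℂ) • 1) ⊗ₖ ((c : ℂ) • (1 : Matrix y y ℂ)) := by
      rw [choi_smul, choi_ofChoi, ← one_kronecker_one, ← kronecker_smul, ← smul_kronecker,
        sub_eq_iff_eq_add, ← add_kronecker]
      congr 1
      push_cast
      module
    rw [choi_ofChoi, h3]
    exact h2.kronecker hone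

end Completion

/-! ### From a channel near N ⊗ F^L back to a channel near N -/

section Upper

variable {a₀ a₁ b₀ b₁ : Type*}
  [Fintype a₀] [DecidableEq a₀] [Fintype a₁] [DecidableEq a₁]
  [Fintype b₀] [DecidableEq b₀] [Fintype b₁] [DecidableEq b₁]

/-- The map on `AB` obtained by contracting the catalyst with the swap gate. -/
def contract {L : ℕ} (S : LMap ((a₀ × Fin L) × (b₀ × Fin L)) ((a₁ × Fin L) × (b₁ × Fin L))) :
    LMap (a₀ × b₀) (a₁ × b₁) :=
  ofChoi (((L : ℂ) ^ 4)⁻¹ • collapse (choi S))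

theorem posSemidef_choi_contract {L : ℕ}
    {S : LMap ((a₀ × Fin L) × (b₀ × Fin L)) ((a₁ × Fin L) × (b₁ × Fin L))}
    (hS : (choi S).PosSemidef) : (choi (contract S)).PosSemidef := by
  rw [contract, choi_ofChoi]
  convert (collapse_posSemidef hS).smul_ofReal (show (0 : ℝ) ≤ ((L : ℝ) ^ 4)⁻¹ by positivity) using 2
  push_cast
  rfl

/-- The projector on the swap vector is at most the identity, and the full trace over the catalyst
indices is L² by trace preservation. -/
theorem posSemidef_one_sub_marginal_contract {L : ℕ} [NeZero L]
    {S : LMap ((a₀ × Fin L) × (b₀ × Fin L)) ((a₁ × Fin L) × (b₁ × Fin L))} (hS : IsChannel S) :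
    (1 - marginal (contract S)).PosSemidef := by
  have hL : (L : ℂ) ≠ 0 := by exact_mod_cast NeZero.ne L
  have h1 := fun o : a₁ × b₁ => ((isCP_iff.1 hS.1).submatrix
    fun z : (a₀ × b₀) × ((Fin L × Fin L) × (Fin L × Fin L)) =>
      glue (z.1, o) z.2.1 z.2.2).card_smul_trace_block_sub_sum_graph id
  have h2 := (posSemidef_sum Finset.univ fun o (_ : o ∈ Finset.univ) => h1 o).smul_ofReal
    (show (0 : ℝ) ≤ ((L : ℝ) ^ 4)⁻¹ by positivity)
  convert h2 using 1
  ext i j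
  have h3 : ∑ o : a₁ × b₁, ∑ w : (Fin L × Fin L) × (Fin L × Fin L),
      choi S (glue (i, o) w.1 w.2) (glue (j, o) w.1 w.2) = (L : ℂ) ^ 2 * if i = j then 1 else 0 := by
    have h4 := fun u v : Fin L => isTP_iff.1 hS.2 ((i.1, u), (i.2, v)) ((j.1, u), (j.2, v))
    calc _ = ∑ u : Fin L, ∑ v : Fin L, ∑ o : (a₁ × Fin L) × (b₁ × Fin L),
          choi S (((i.1, u), (i.2, v)), o) (((j.1, u), (j.2, v)), o) := by
          simp only [← Fintype.sum_prod_type']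
          refine Fintype.sum_equiv
            { toFun := fun z => (z.2.1.1, z.2.2.2, (z.1.1, z.2.1.2), (z.1.2, z.2.2.1))
              invFun := fun z => ((z.2.2.1.1, z.2.2.2.1), ((z.1, z.2.2.1.2), (z.2.2.2.2, z.2.1)))
              left_inv := fun _ => rfl
              right_inv := fun _ => rfl } _ _ fun _ => rfl
      _ = _ := by
          simp only [h4, Prod.mk.injEq, and_true, ← Prod.ext_iff, Finset.sum_const, Finset.card_univ,
            Fintype.card_fin, nsmul_eq_mul]
          ring
  simp only [Matrix.sub_apply, Matrix.smul_apply, Matrix.sum_apply, of_apply, marginal, contract,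
    choi_ofChoi, submatrix_apply, smul_eq_mul, Finset.sum_sub_distrib, ← Finset.mul_sum, h3, id,
    collapse, Fintype.card_prod, Fintype.card_fin, Matrix.one_apply]
  push_cast
  field_simp

theorem trace_marginal_contract {L : ℕ}
    (S : LMap ((a₀ × Fin L) × (b₀ × Fin L)) ((a₁ × Fin L) × (b₁ × Fin L))) :
    (marginal (contract S)).trace = ((L : ℂ) ^ 4)⁻¹ * (collapse (choi S)).trace := by
  simp only [Matrix.trace, diag_apply, marginal, of_apply, contract, choi_ofChoi,
    Matrix.smul_apply, smul_eq_mul, Fintype.sum_prod_type, Finset.mul_sum]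

theorem contract_bipTensor_swap {L : ℕ} [NeZero L] (N : LMap (a₀ × b₀) (a₁ × b₁)) :
    contract (bipTensor N (swapChannel L)) = N := by
  have hL : (L : ℂ) ≠ 0 := by exact_mod_cast NeZero.ne L
  apply choi_injective
  rw [contract, choi_ofChoi, collapse_bipTensor_swap, smul_smul, inv_mul_cancel₀ (pow_ne_zero _ hL),
    one_smul]

theorem contract_sub {L : ℕ}
    (S T : LMap ((a₀ × Fin L) × (b₀ × Fin L)) ((a₁ × Fin L) × (b₁ × Fin L))) :
    contract (S - T) = contract S - contract T := by
  apply choi_injective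
  simp only [contract, choi_ofChoi, choi_sub, collapse_sub, smul_sub]

/-- A channel close to `N ⊗ F^L` yields a channel close to `N` whose tensor product with `F^L` is
dominated by a separable channel. -/
theorem exists_sepDom_bipTensor_swap [Nonempty a₀] [Nonempty a₁] [Nonempty b₀] [Nonempty b₁]
    {L : ℕ} [NeZero L] (hL : Fintype.card (a₀ × a₁) + Fintype.card (b₀ × b₁) ≤ L ^ 2)
    {N : LMap (a₀ × b₀) (a₁ × b₁)} (hN : IsChannel N) {η μ : ℝ} (hη : 0 ≤ η)
    {S : LMap ((a₀ × Fin L) × (b₀ × Fin L)) ((a₁ × Fin L) × (b₁ × Fin L))} (hS : IsChannel S)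
    (hSN : DiamondLE η (S - bipTensor N (swapChannel L))) (hμ : 0 < μ) (hdom : SepDom μ S) :
    (1 - η) * L ^ 2 ≤ μ ∧ ∃ N', IsChannel N' ∧
      DiamondLE (η * (1 + Fintype.card a₀ * Fintype.card b₀)) (N' - N) ∧
      SepDom (μ + η * L ^ 2) (bipTensor N' (swapChannel L)) := by
  have hL0 : (0 : ℝ) < L := by exact_mod_cast NeZero.pos L
  have hLc : (L : ℂ) ≠ 0 := by exact_mod_cast NeZero.ne L
  have hP := posSemidef_choi_contract (isCP_iff.1 hS.1)
  have hPN : DiamondLE η (contract S - N) := by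
    have := hSN.collapse
    rwa [← contract, contract_sub, contract_bipTensor_swap] at this
  have h2 := posSemidef_marginal_sub hP hN.2 hPN
  obtain ⟨Q, hQ, hPQ, hQE⟩ := exists_isChannel_add hP (posSemidef_one_sub_marginal_contract hS) h2
  set d : ℝ := Fintype.card a₀ * Fintype.card b₀ with hd
  have hd0 : 0 < d := by rw [hd]; positivity
  refine ⟨?_, contract S + Q, hPQ, ?_, ?_⟩
  -- With d = |A₀||B₀|, compare traces of contractions: (1−η)dL⁴ ≤ tr collapse S ≤ μ tr collapse T ≤
  -- μdL².
  · obtain ⟨T, hT, hST⟩ := hdom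
    have h3 := (collapse_posSemidef hST).trace_nonneg
    rw [collapse_sub, collapse_smul, trace_sub, trace_smul] at h3
    have h3 := (Complex.nonneg_iff.1 h3).1
    have h4 := (Complex.nonneg_iff.1 h2.trace_nonneg).1
    rw [trace_sub, trace_marginal_contract, trace_smul, trace_one, Fintype.card_prod] at h4
    rw [smul_eq_mul, Complex.sub_re, Complex.re_ofReal_mul] at h3
    have h5 := trace_collapse_le hT
    rw [Fintype.card_fin, ← hd] at h5
    have h6 : (((L : ℂ) ^ 4)⁻¹ * (collapse (choi S)).trace).re =
        ((L : ℝ) ^ 4)⁻¹ * (collapse (choi S)).trace.re := by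
      rw [← Complex.re_ofReal_mul]
      push_cast
      rfl
    have h7 : ((((1 - η : ℝ) : ℂ)) • (((Fintype.card a₀ * Fintype.card b₀ : ℕ) : ℂ))).re =
        (1 - η) * d := by
      rw [smul_eq_mul, Complex.re_ofReal_mul, hd]
      simp
    rw [Complex.sub_re, h6, h7] at h4
    have h8 : (1 - η) * d * L ^ 4 ≤ μ * (d * L ^ 2) := by
      have h9 : (1 - η) * d * L ^ 4 ≤ (collapse (choi S)).trace.re := by
        have : (1 - η) * d ≤ ((L : ℝ) ^ 4)⁻¹ * (collapse (choi S)).trace.re := by linarith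
        rwa [inv_mul_eq_div, le_div_iff₀ (by positivity)] at this
      nlinarith [mul_le_mul_of_nonneg_left h5 hμ.le]
    have h10 : (0 : ℝ) < d * L ^ 2 := by positivity
    refine le_of_mul_le_mul_right ?_ h10
    linarith
  · have h3 := hPN.add ((diamondLE_of_posSemidef hQ).mono (d := η * d) ?_)
    · convert h3 using 1
      · ring
      · abel
    · have h4 := (Complex.nonneg_iff.1 hQE.trace_nonneg).1
      rw [trace_sub, choi_smul, choi_ofChoi, trace_smul, trace_smul, trace_one, Complex.sub_re,
        smul_eq_mul, smul_eq_mul, Complex.re_ofReal_mul, Complex.re_ofReal_mul,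
        Fintype.card_prod (a₀ × b₀), Fintype.card_prod a₀ b₀] at h4
      have hy : (Fintype.card (a₁ × b₁) : ℝ) ≠ 0 := by exact_mod_cast Fintype.card_ne_zero
      have h5 : (Fintype.card (a₁ × b₁) : ℝ)⁻¹ *
          (((Fintype.card a₀ * Fintype.card b₀ * Fintype.card (a₁ × b₁) : ℕ) : ℂ)).re = d := by
        rw [Complex.natCast_re, hd]
        push_cast [Fintype.card_prod] at hy ⊢
        field_simp
      rw [h5] at h4
      linarith
  -- The contracted part inherits μ by transfer from L to L; Q lies below η times a separable
  -- channel, which costs ηL².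
  · rw [bipTensor_add]
    refine SepDom.add ?_ ?_ hμ (by positivity)
    · have h3 := hdom.transfer hL hμ (contract S) (by
        rw [contract, choi_ofChoi, smul_smul, mul_inv_cancel₀ (pow_ne_zero _ hLc), one_smul,
          sub_self]
        exact PosSemidef.zero)
      convert h3 using 1
      field_simp
    · refine ((isSepChannel_depolarizing.sepDom_bipTensor_swap hL).smul hη).of_le ?_
      rw [← bipTensor_smul, ← choi_sub, ← bipTensor_sub]
      refine posSemidef_choi_bipTensor_swap ?_ L
      rw [Fintype.card_prod] at hQE
      push_cast at hQE ⊢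
      exact hQE

end Upper

/-! ### Attainment and the upper bound -/

section Main

variable {a₀ a₁ b₀ b₁ : Type*}
  [Fintype a₀] [DecidableEq a₀] [Nonempty a₀] [Fintype a₁] [DecidableEq a₁] [Nonempty a₁]
  [Fintype b₀] [DecidableEq b₀] [Nonempty b₀] [Fintype b₁] [DecidableEq b₁] [Nonempty b₁]

theorem catalyticCostSet.isLeast {δ ε : ℝ} {N : LMap (a₀ × b₀) (a₁ × b₁)}
    (h : (catalyticCostSet δ ε N).Nonempty) :
    IsLeast (catalyticCostSet δ ε N) (catalyticCost δ ε N) := by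
  classical
  have hex : ∃ K : ℕ, 0 < K ∧ Real.logb 2 ((K : ℝ) ^ 2) ∈ catalyticCostSet δ ε N := by
    obtain ⟨e, he⟩ := h
    have he' := he
    obtain ⟨K, M, hK, -, -, -, -, -, -, -, rfl⟩ := he'
    exact ⟨K, hK, he⟩
  have hleast : IsLeast (catalyticCostSet δ ε N) (Real.logb 2 ((Nat.find hex : ℝ) ^ 2)) := by
    refine ⟨(Nat.find_spec hex).2, fun e he => ?_⟩
    have he' := he
    obtain ⟨K, M, hK, -, -, -, -, -, -, -, rfl⟩ := he'
    have h1 : (Nat.find hex : ℝ) ≤ K := by exact_mod_cast Nat.find_min' hex ⟨hK, he⟩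
    have h2 : (0 : ℝ) < Nat.find hex := by exact_mod_cast (Nat.find_spec hex).1
    exact Real.logb_le_logb_of_le one_lt_two (by positivity) (by gcongr)
  rw [catalyticCost, hleast.csInf_eq]
  exact hleast

theorem catalyticCostSet.nonempty {δ ε : ℝ} (hδ : 0 < δ) (hε : 0 ≤ ε) {L : ℕ} [NeZero L]
    (hLδ : 1 + 1 / δ ≤ (L : ℝ) ^ 2) {N : LMap (a₀ × b₀) (a₁ × b₁)} (hN : IsChannel N) :
    (catalyticCostSet δ ε N).Nonempty := by
  have hL1 : (1 : ℝ) ≤ L := by exact_mod_cast NeZero.pos L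
  obtain ⟨μ, hμ, h⟩ := exists_sepDom _ (hN.bipTensor_swap L)
  refine ⟨_, mem_catalyticCostSet hδ (Nat.succ_pos ⌈μ⌉₊) (NeZero.pos L) hLδ hN
    (diamondClose_self hε N) (h.mono ?_)⟩
  have h1 : μ ≤ ((⌈μ⌉₊.succ : ℕ) : ℝ) :=
    (Nat.le_ceil μ).trans (by exact_mod_cast Nat.le_succ _)
  have h2 : (1 : ℝ) ≤ ((⌈μ⌉₊.succ : ℕ) : ℝ) := by exact_mod_cast Nat.succ_pos _
  calc μ ≤ ((⌈μ⌉₊.succ : ℕ) : ℝ) := h1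
    _ ≤ ((⌈μ⌉₊.succ : ℕ) : ℝ) ^ 2 := le_self_pow₀ h2 two_ne_zero
    _ ≤ ((⌈μ⌉₊.succ : ℕ) : ℝ) ^ 2 * (L : ℝ) ^ 2 :=
      le_mul_of_one_le_right (by positivity) (one_le_pow₀ hL1)

/-- Smoothing by ε' is lifted to N' at distance ε'(1 + |A₀||B₀|), so `hεε'` is all that ties ε' to
ε. -/
theorem catalyticCost_le {δ ε ε' : ℝ} (hδ : 0 < δ) (hε' : 0 ≤ ε') (hε1 : 0 < 1 - 2 * ε')
    (hεε' : ε' * (1 + Fintype.card a₀ * Fintype.card b₀) ≤ ε) {L : ℕ} [NeZero L]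
    (hL : Fintype.card (a₀ × a₁) + Fintype.card (b₀ × b₁) ≤ L ^ 2)
    (hLδ : 1 + 1 / δ ≤ (L : ℝ) ^ 2) {N : LMap (a₀ × b₀) (a₁ × b₁)} (hN : IsChannel N) :
    catalyticCost δ ε N ≤ smoothLogRobustness ε' (bipTensor N (swapChannel L))
      - Real.logb 2 ((L : ℝ) ^ 2) - Real.logb 2 (1 - 2 * ε') + 2 := by
  have hε : 0 ≤ ε := le_trans (by positivity) hεε'
  have hL0 : (0 : ℝ) < L := by exact_mod_cast NeZero.pos L
  have hleast := catalyticCostSet.isLeast (catalyticCostSet.nonempty hδ hε hLδ hN)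
  refine le_of_forall_pos_le_add fun γ hγ => ?_
  obtain ⟨_, ⟨S, hS, hSN, rfl⟩, hSγ⟩ := exists_lt_of_csInf_lt
    (s := {l : ℝ | ∃ N', IsChannel N' ∧ DiamondClose ε' N' (bipTensor N (swapChannel L)) ∧
      l = logRobustness N'})
    ⟨_, _, hN.bipTensor_swap L, diamondClose_self hε' _, rfl⟩
    (lt_add_of_pos_right (smoothLogRobustness ε' (bipTensor N (swapChannel L))) (half_pos hγ))
  rw [diamondClose_iff hε'] at hSN
  have hR := robustness_nonneg S
  have hpow : (1 : ℝ) < 2 ^ (γ / 2) := Real.one_lt_rpow one_lt_two (half_pos hγ)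
  set μ : ℝ := (1 + robustness S) * 2 ^ (γ / 2) with hμ
  have hμ0 : 0 < μ := by positivity
  have hdom : SepDom μ S := by
    have h1 := sepDom_of_robustness_lt (s := μ - 1) hS (by nlinarith)
    rwa [add_sub_cancel] at h1
  obtain ⟨hμL, N', hN', hNN', hdom'⟩ :=
    exists_sepDom_bipTensor_swap hL hN (by positivity : 0 ≤ 2 * ε') hS hSN hμ0 hdom
  have hclose : DiamondClose ε N' N := by
    rw [diamondClose_iff hε]
    exact hNN'.mono (by linarith)
  set t : ℝ := μ / (L : ℝ) ^ 2 with ht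
  have htμ : t * (L : ℝ) ^ 2 = μ := div_mul_cancel₀ _ (by positivity)
  have ht1 : 1 - 2 * ε' ≤ t := by rwa [ht, le_div_iff₀ (by positivity)]
  have hs1 : 1 ≤ √(t + 2 * ε') := Real.one_le_sqrt.2 (by linarith)
  have hsq : √(t + 2 * ε') ^ 2 = t + 2 * ε' := Real.sq_sqrt (by linarith)
  -- The smallest integer with K²L² ≥ μ + 2ε'L². As the root is at least 1, rounding up at most
  -- doubles it: K² ≤ 4(t + 2ε'), the source of the summand 2.
  set K : ℕ := ⌈√(t + 2 * ε')⌉₊ with hK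
  have hK0 : 0 < K := Nat.ceil_pos.2 (by linarith)
  have hKle : √(t + 2 * ε') ≤ K := Nat.le_ceil _
  have hKlt : (K : ℝ) < √(t + 2 * ε') + 1 := Nat.ceil_lt_add_one (by linarith)
  have hmem := mem_catalyticCostSet hδ hK0 (NeZero.pos L) hLδ hN' hclose (hdom'.mono (by
    have : t + 2 * ε' ≤ (K : ℝ) ^ 2 := by rw [← hsq]; gcongr
    calc μ + 2 * ε' * (L : ℝ) ^ 2 = (t + 2 * ε') * (L : ℝ) ^ 2 := by rw [← htμ]; ring
      _ ≤ (K : ℝ) ^ 2 * (L : ℝ) ^ 2 := by gcongr))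
  have hK2 : (K : ℝ) ^ 2 ≤ 4 * (t / (1 - 2 * ε')) := by
    have h1 : (K : ℝ) ^ 2 ≤ (2 * √(t + 2 * ε')) ^ 2 := by gcongr; linarith
    -- Equivalent to t ≥ 1 − 2ε' when ε' > 0; this turns the additive error into −log(1 − 2ε').
    have h2 : t + 2 * ε' ≤ t / (1 - 2 * ε') := by
      rw [le_div_iff₀ hε1]
      nlinarith
    rw [mul_pow, hsq] at h1
    linarith
  have hK0' : (0 : ℝ) < K := by exact_mod_cast hK0
  have hlogμ : Real.logb 2 μ = logRobustness S + γ / 2 := by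
    rw [hμ, Real.logb_mul (by positivity) (by positivity),
      Real.logb_rpow two_pos (by norm_num), logRobustness]
  have hlog4 : Real.logb 2 4 = 2 := by
    rw [show (4 : ℝ) = 2 ^ (2 : ℝ) by norm_num, Real.logb_rpow two_pos (by norm_num)]
  have hlog : Real.logb 2 ((K : ℝ) ^ 2) ≤
      2 + (logRobustness S + γ / 2 - Real.logb 2 ((L : ℝ) ^ 2) - Real.logb 2 (1 - 2 * ε')) := by
    refine (Real.logb_le_logb_of_le one_lt_two (by positivity) hK2).trans (le_of_eq ?_)
    rw [Real.logb_mul (by norm_num) (by positivity), Real.logb_div (by positivity) hε1.ne', ht,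
      Real.logb_div hμ0.ne' (by positivity), hlog4, hlogμ]
  have := hleast.2 hmem
  linarith

end Main

end

theorem mainTheorem3 {a₀ a₁ b₀ b₁ : Type*}
    [Fintype a₀] [DecidableEq a₀] [Nonempty a₀] [Fintype a₁] [DecidableEq a₁] [Nonempty a₁]
    [Fintype b₀] [DecidableEq b₀] [Nonempty b₀] [Fintype b₁] [DecidableEq b₁] [Nonempty b₁]
    (δ ε : ℝ) (hδ : 0 < δ) (hε : 0 ≤ ε) :
    ∃ L : ℕ, 1 + 1 / δ ≤ (L : ℝ) ^ 2 ∧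
      ∀ N : LMap (a₀ × b₀) (a₁ × b₁), IsChannel N →
        IsLeast (catalyticCostSet δ ε N) (catalyticCost δ ε N) ∧
        smoothLogRobustness ε (bipTensor N (swapChannel L))
            - Real.logb 2 ((L : ℝ) ^ 2) - Real.logb 2 (1 + δ)
          ≤ catalyticCost δ ε N ∧
        ∀ ε' : ℝ, ε' = ε ^ 2 / (2 * (Fintype.card a₀ : ℝ) ^ 2 * (Fintype.card b₀ : ℝ) ^ 2) →
          0 < 1 - 2 * ε' →
          catalyticCost δ ε N ≤
            smoothLogRobustness ε' (bipTensor N (swapChannel L))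
              - Real.logb 2 ((L : ℝ) ^ 2) - Real.logb 2 (1 - 2 * ε') + 2 := by
  -- Large enough both for the swap test (L² ≥ 1 + 1/δ) and for the Gram vectors, and independent of
  -- ε and N.
  set L : ℕ := ⌈1 + 1 / δ⌉₊ + Fintype.card (a₀ × a₁) + Fintype.card (b₀ × b₁) with hLdef
  have : NeZero L := ⟨by
    have : 0 < Fintype.card (a₀ × a₁) := Fintype.card_pos
    omega⟩
  have hLL : L ≤ L ^ 2 := Nat.le_self_pow two_ne_zero L
  have hL : Fintype.card (a₀ × a₁) + Fintype.card (b₀ × b₁) ≤ L ^ 2 := by omega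
  have hLδ : 1 + 1 / δ ≤ (L : ℝ) ^ 2 :=
    calc 1 + 1 / δ ≤ (⌈1 + 1 / δ⌉₊ : ℝ) := Nat.le_ceil _
      _ ≤ ((L ^ 2 : ℕ) : ℝ) := by exact_mod_cast (by omega : ⌈1 + 1 / δ⌉₊ ≤ L ^ 2)
      _ = (L : ℝ) ^ 2 := by push_cast; rfl
  refine ⟨L, hLδ, fun N hN => ?_⟩
  have hleast := catalyticCostSet.isLeast (catalyticCostSet.nonempty hδ hε hLδ hN)
  refine ⟨hleast, smoothLogRobustness_le_of_mem hL hδ hε N hleast.1, fun ε' hε' h1 => ?_⟩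
  have hd : (1 : ℝ) ≤ Fintype.card a₀ * Fintype.card b₀ :=
    one_le_mul_of_one_le_of_one_le (by exact_mod_cast Fintype.card_pos (α := a₀))
      (by exact_mod_cast Fintype.card_pos (α := b₀))
  set d : ℝ := Fintype.card a₀ * Fintype.card b₀ with hd_def
  have hε'd : ε' * (2 * d ^ 2) = ε ^ 2 := by
    rw [hε', hd_def]
    field_simp
  -- From 2ε' < 1 and ε² = 2ε'd²; with d ≥ 1 it yields ε(1+d) ≤ 2d², hence ε'(1+d) ≤ ε.
  have hεd : ε ≤ d := by
    refine le_of_sq_le_sq ?_ (by linarith)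
    nlinarith
  refine catalyticCost_le hδ (by rw [hε']; positivity) h1 ?_ hL hLδ hN
  rw [← hd_def]
  have h2 : ε' * (1 + d) * (2 * d ^ 2) ≤ ε * (2 * d ^ 2) := by
    have h3 : ε * (1 + d) ≤ 2 * d ^ 2 := by nlinarith
    calc ε' * (1 + d) * (2 * d ^ 2) = ε * (ε * (1 + d)) := by linear_combination (1 + d) * hε'd
      _ ≤ ε * (2 * d ^ 2) := by gcongr
  exact le_of_mul_le_mul_right h2 (by positivity)
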